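/- **Setting.** *Groupoids.* Let $G$ be an $r$-discrete groupoid, i.e. a locally compact Hausdorff topological groupoid whose range and domain maps $r,d\colon G\to G^0$ are local homeomorphisms onto the unit space. An *open $G$-set* is an open subset of $G$ on which $r$ and $d$ are injective. The open $G$-sets form an inverse semigroup $G^{op}$ with $st=\{xy: x\in s,\ y\in t,\ d(x)=r(y)\}$ and $s^*=\{x^{-1}:x\in s\}$; for $s \in G^{op}$ write $r(s)$, $d(s)$ for the images of $s$ in $G^0$ (identified with the idempotents $ss^*$, $s^*s$). An inverse subsemigroup $S\subseteq G^{op}$ is *full* if it is a base for the topology of $G$ and any two of its idempotents have a common upper bound among its idempotents, for the natural order ($s\le t$ iff $s=ss^*t$). *Bundles and actions.* An *upper semicontinuous $C^*$-bundle* over $G^0$ is a family of $C^*$-algebras $(A_u)_{u\in G^0}$ with a topology on the disjoint union $\mathcal A$ such that the projection $\mathcal A\to G^0$ is continuous and open, $a\mapsto\|a\|$ is upper semicontinuous, addition, multiplication (on $\mathcal A\times_{G^0}\mathcal A$), scalar multiplication and involution are continuous, and $a_i\to 0_u$ whenever the base points of $a_i$ tend to $u$ and $\|a_i\|\to0$.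 An *action* $\alpha$ of $G$ on $\mathcal A$ is a functor $x\mapsto\alpha_x\colon A_{d(x)}\to A_{r(x)}$ into $C^*$-algebras and $*$-homomorphisms such that $(x,a)\mapsto\alpha_x(a)$ is continuous from $d^*\mathcal A=\{(x,a)\in G\times\mathcal A: a\in A_{d(x)}\}$ to $\mathcal A$. Let $\Gamma_0(\mathcal A)$ be the $C^*$-algebra of continuous sections of $\mathcal A$ vanishing at infinity, with the supremum norm. Let $\Gamma_c(r^*\mathcal A)$ be the space of compactly supported continuous functions $f\colon G\to\mathcal A$ with $f(x)\in A_{r(x)}$, a $*$-algebra with $$(fg)(x)=\sum_{r(y)=r(x)}f(y)\,\alpha_y\bigl(g(y^{-1}x)\bigr),\qquad f^*(x)=\alpha_x\bigl(f(x^{-1})\bigr)^*.$$ *Enveloping algebras.* A $*$-algebra $D$ *has an enveloping $C^*$-algebra* if the supremum of all $C^*$-seminorms on $D$ is finite at every element of $D$; the enveloping $C^*$-algebra is then the Hausdorff completion of $D$ for this largest $C^*$-seminorm. *Inverse semigroup actions.* An action $\beta$ of an inverse semigroup $S$ on a $C^*$-algebra $B$ is a homomorphism from $S$ to the inverse semigroup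 of partial automorphisms of $B$ (isomorphisms between closed two-sided ideals, under composition of partial maps) whose domain ideals are upward-directed and have dense span. For an idempotent $e$ let $B_e$ be the domain of $\beta_e$; then $\beta_s$ maps $B_{s^*s}$ onto $B_{ss^*}$. A covariant representation of $(B,S,\beta)$ on a Hilbert space $H$ is a pair of a nondegenerate representation $\pi$ of $B$ on $H$ and a multiplicative $*$-preserving map $U\colon S\to\mathcal L(H)$ whose ranges have dense span in $H$, such that $U_eH=\pi(B_e)H$ for idempotents $e$ and $U_s\pi(b)U_s^*=\pi(\beta_s(b))$ for $b\in B_{s^*s}$. Let $\Gamma_c(r^*\mathcal B)=\bigoplus_{s\in S}(B_{ss^*},s)$, a $*$-algebra with $(b,s)(c,t)=(\beta_s(\beta_{s^*}(b)c),st)$ and $(b,s)^*=(\beta_{s^*}(b^*),s^*)$. The integrated form of $(\pi,U)$ is the representation $\Pi\bigl(\sum_i(b_i,s_i)\bigr)=\sum_i\pi(b_i)U_{s_i}$, and the crossed product $B\times_\beta S$ is the Hausdorff completion of $\Gamma_c(r^*\mathcal B)$ for the supremum of the $C^*$-seminorms $f\mapsto\|\Pi(f)\|$, where $\Pi$ runs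 over the integrated forms of all covariant representations. **Theorem.** Let $\alpha$ be an action of an $r$-discrete groupoid $G$ on an upper semicontinuous $C^*$-bundle $\mathcal A$ over $G^0$, let $S$ be a full inverse semigroup of open $G$-sets, and let $\beta$ be the associated action of $S$ on $B=\Gamma_0(\mathcal A)$: its ideals are $B_e=\{f\in\Gamma_0(\mathcal A): f=0\text{ off }e\}$, and for $s\in S$, $f\in B_{s^*s}$, $$\beta_s(f)(r(x))=\alpha_x(f(d(x)))\ \ (x\in s),\qquad \beta_s(f)=0\ \text{ off } r(s).$$ Let $\Gamma_c(\mathcal C)=\bigoplus_{s\in S}(C_s,s)\subseteq\Gamma_c(r^*\mathcal B)$, where $C_s$ is the space of compactly supported continuous sections of $\mathcal A$ with support contained in $r(s)$, and let $\Psi\colon\Gamma_c(\mathcal C)\to\Gamma_c(r^*\mathcal A)$ be the linear map with $\Psi(b,s)(x)=b(r(x))$ if $x\in s$ and $\Psi(b,s)(x)=0$ otherwise. Then: 1. the $*$-algebra $\Gamma_c(r^*\mathcal A)$ has an enveloping $C^*$-algebra $\mathcal A\times_\alpha G$; 2. $\Psi$ extends uniquely to an isomorphism of $B\times_\beta S$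 onto $\mathcal A\times_\alpha G$: there is exactly one $*$-isomorphism $\Phi\colon B\times_\beta S\to\mathcal A\times_\alpha G$ such that, for every $\xi\in\Gamma_c(\mathcal C)$, $\Phi$ maps the image of $\xi$ in $B\times_\beta S$ to the image of $\Psi(\xi)$ in $\mathcal A\times_\alpha G$. -/

import Mathlib

namespace GpdCStar

open Topology Filter

set_option linter.unusedSectionVars false

noncomputable section

/-! ## `C*`-seminorms, Hausdorff completions, enveloping `C*`-algebras -/

section Seminorms

variable {D : Type*} [NonUnitalRing D] [StarRing D] [Module ℂ D] [IsScalarTower ℂ D D]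
  [SMulCommClass ℂ D D] [StarModule ℂ D]

variable (D) in
/-- A `C*`-seminorm on a complex `*`-algebra. -/
structure CStarSeminorm extends Seminorm ℂ D where
  mul_le' : ∀ a b, toFun (a * b) ≤ toFun a * toFun b
  star_mul_self' : ∀ a, toFun (star a * a) = toFun a ^ 2

namespace CStarSeminorm

instance : CoeFun (CStarSeminorm D) (fun _ => D → ℝ) := ⟨fun p => p.toSeminorm⟩

theorem mul_le (p : CStarSeminorm D) (a b : D) : p (a * b) ≤ p a * p b := p.mul_le' a b

theorem star_mul_self (p : CStarSeminorm D) (a : D) : p (star a * a) = p a ^ 2 :=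
  p.star_mul_self' a

theorem nonneg (p : CStarSeminorm D) (a : D) : 0 ≤ p a := apply_nonneg p.toSeminorm a

theorem le_star (p : CStarSeminorm D) (a : D) : p a ≤ p (star a) := by
  have h := p.mul_le (star a) a
  rw [p.star_mul_self] at h
  by_contra hlt
  push Not at hlt
  have h0 := p.nonneg (star a)
  nlinarith

theorem star_eq (p : CStarSeminorm D) (a : D) : p (star a) = p a := by
  refine le_antisymm ?_ (p.le_star a)
  simpa using p.le_star (star a)

/-- The pointwise supremum of a pointwise bounded set of `C*`-seminorms. -/
def sup (P : Set (CStarSeminorm D))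
    (hP : ∀ a : D, BddAbove ((fun p : CStarSeminorm D => p a) '' P)) : CStarSeminorm D :=
  have nn : ∀ a : D, 0 ≤ sSup ((fun p : CStarSeminorm D => p a) '' P) := fun a =>
    Real.sSup_nonneg (by rintro _ ⟨p, -, rfl⟩; exact p.nonneg a)
  have le : ∀ (a : D), ∀ p ∈ P, p a ≤ sSup ((fun p : CStarSeminorm D => p a) '' P) :=
    fun a p hp => le_csSup (hP a) ⟨p, hp, rfl⟩
  { Seminorm.ofSMulLE (fun a => sSup ((fun p : CStarSeminorm D => p a) '' P))
      (by
        refine le_antisymm (Real.sSup_le ?_ le_rfl) (nn 0)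
        rintro _ ⟨p, -, rfl⟩
        exact (map_zero p.toSeminorm).le)
      (fun a b => by
        refine Real.sSup_le ?_ (add_nonneg (nn a) (nn b))
        rintro _ ⟨p, hp, rfl⟩
        exact (map_add_le_add p.toSeminorm a b).trans (add_le_add (le a p hp) (le b p hp)))
      (fun c a => by
        refine Real.sSup_le ?_ (mul_nonneg (norm_nonneg _) (nn a))
        rintro _ ⟨p, hp, rfl⟩
        refine (map_smul_eq_mul p.toSeminorm c a).le.trans ?_
        exact mul_le_mul_of_nonneg_left (le a p hp) (norm_nonneg _)) with
    mul_le' := fun a b => by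
      refine Real.sSup_le ?_ (mul_nonneg (nn a) (nn b))
      rintro _ ⟨p, hp, rfl⟩
      exact (p.mul_le a b).trans (mul_le_mul (le a p hp) (le b p hp) (p.nonneg b) (nn a))
    star_mul_self' := fun a => by
      refine le_antisymm (Real.sSup_le ?_ (sq_nonneg _)) ?_
      · rintro _ ⟨p, hp, rfl⟩
        refine (p.star_mul_self a).le.trans ?_
        exact pow_le_pow_left₀ (p.nonneg a) (le a p hp) 2
      · have h : sSup ((fun p : CStarSeminorm D => p a) '' P) ≤
            √ (sSup ((fun p : CStarSeminorm D => p (star a * a)) '' P)) := by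
          refine Real.sSup_le ?_ (Real.sqrt_nonneg _)
          rintro _ ⟨p, hp, rfl⟩
          refine Real.le_sqrt_of_sq_le ?_
          rw [← p.star_mul_self a]
          exact le _ p hp
        exact (Real.le_sqrt (nn a) (nn _)).1 h }

end CStarSeminorm

end Seminorms

section Completion

open UniformSpace UniformSpace.Completion

variable {E : Type*} [NonUnitalSeminormedRing E]

/-- The multiplication of the completion, extended by continuity. -/
abbrev complMul : Mul (Completion E) :=
  ⟨Function.curry ((isDenseInducing_coe.prodMap isDenseInducing_coe).extend
    (((↑) : E → Completion E) ∘ Function.uncurry (· * ·)))⟩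

attribute [local instance] complMul

theorem complMul_coe (a b : E) : ((a * b : E) : Completion E) = a * b :=
  ((isDenseInducing_coe.prodMap isDenseInducing_coe).extend_eq
      ((continuous_coe E).comp (continuous_mul (M := E))) (a, b)).symm

theorem complMul_continuous : ContinuousMul (Completion E) where
  continuous_mul := by
    let m := (AddMonoidHom.mul : E →+ E →+ E).compr₂ toCompl
    have : Continuous fun p : E × E => m p.1 p.2 := (continuous_coe E).comp continuous_mul
    have di : IsDenseInducing (toCompl : E → Completion E) := isDenseInducing_coe
    exact (di.extend_Z_bilin di this :)

attribute [local instance] complMul_continuous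

/-- The completion of a seminormed (not necessarily unital) ring. -/
abbrev complNormedRing : NonUnitalNormedRing (Completion E) :=
  { (inferInstance : NormedAddCommGroup (Completion E)), complMul (E := E) with
    zero_mul := fun a => Completion.induction_on a (isClosed_eq (by fun_prop) continuous_const)
      fun a => by rw [← coe_zero, ← complMul_coe, zero_mul]
    mul_zero := fun a => Completion.induction_on a (isClosed_eq (by fun_prop) continuous_const)
      fun a => by rw [← coe_zero, ← complMul_coe, mul_zero]
    mul_assoc := fun a b c => Completion.induction_on₃ a b c
      (isClosed_eq (by fun_prop) (by fun_prop))
      fun a b c => by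
        rw [← complMul_coe, ← complMul_coe, ← complMul_coe, ← complMul_coe, mul_assoc]
    left_distrib := fun a b c => Completion.induction_on₃ a b c
      (isClosed_eq (by fun_prop) (by fun_prop))
      fun a b c => by
        rw [← Completion.coe_add, ← complMul_coe, ← complMul_coe, ← complMul_coe,
          ← Completion.coe_add, mul_add]
    right_distrib := fun a b c => Completion.induction_on₃ a b c
      (isClosed_eq (by fun_prop) (by fun_prop))
      fun a b c => by
        rw [← Completion.coe_add, ← complMul_coe, ← complMul_coe, ← complMul_coe,
          ← Completion.coe_add, add_mul]
    norm_mul_le := fun x y => by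
      induction x, y using Completion.induction_on₂ with
      | hp => apply isClosed_le <;> fun_prop
      | ih x y => simpa only [← complMul_coe, norm_coe] using norm_mul_le x y }

variable [StarRing E] [NormedStarGroup E]

/-- The involution of the completion, extended by continuity. -/
abbrev complStar : Star (Completion E) := ⟨Completion.map star⟩

attribute [local instance] complStar

theorem complStar_uniformContinuous : UniformContinuous (star : E → E) :=
  (starNormedAddGroupHom (E := E)).uniformContinuous

theorem complStar_coe (a : E) : ((star a : E) : Completion E) = star (a : Completion E) :=
  (Completion.map_coe complStar_uniformContinuous a).symm

theorem complStar_continuous : ContinuousStar (Completion E) := ⟨Completion.continuous_map⟩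

attribute [local instance] complStar_continuous

theorem complStar_star (a : Completion E) : star (star a) = a :=
  Completion.induction_on a (isClosed_eq (by fun_prop) continuous_id)
    fun a => by rw [← complStar_coe, ← complStar_coe, star_star]

theorem complStar_mul (a b : Completion E) : star (a * b) = star b * star a :=
  Completion.induction_on₂ a b (isClosed_eq (by fun_prop) (by fun_prop))
    fun a b => by
      rw [← complMul_coe, ← complStar_coe, ← complStar_coe, ← complStar_coe, ← complMul_coe,
        star_mul]

theorem complStar_add (a b : Completion E) : star (a + b) = star a + star b :=
  Completion.induction_on₂ a b (isClosed_eq (by fun_prop) (by fun_prop))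
    fun a b => by
      rw [← Completion.coe_add, ← complStar_coe, ← complStar_coe, ← complStar_coe,
        ← Completion.coe_add, star_add]

theorem compl_norm_mul_self_le (hE : ∀ a : E, ‖star a * a‖ = ‖a‖ ^ 2) (a : Completion E) :
    ‖a‖ * ‖a‖ ≤ ‖star a * a‖ := by
  induction a using Completion.induction_on with
  | hp => apply isClosed_le <;> fun_prop
  | ih a => rw [← complStar_coe, ← complMul_coe, norm_coe, norm_coe, hE, sq]

variable [NormedSpace ℂ E] [IsScalarTower ℂ E E] [SMulCommClass ℂ E E] [StarModule ℂ E]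

theorem compl_continuous_smul (c : ℂ) : Continuous fun a : Completion E => c • a :=
  uniformContinuous_const_smul c |>.continuous

theorem compl_smul_mul (c : ℂ) (a b : Completion E) : (c • a) * b = c • (a * b) :=
  Completion.induction_on₂ a b
    (isClosed_eq
      (continuous_mul.comp (((compl_continuous_smul c).comp continuous_fst).prodMk continuous_snd))
      ((compl_continuous_smul c).comp continuous_mul))
    fun a b => by
      rw [← Completion.coe_smul, ← complMul_coe, ← complMul_coe, ← Completion.coe_smul,
        smul_mul_assoc]

theorem compl_mul_smul (c : ℂ) (a b : Completion E) : c • (a * b) = a * (c • b) :=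
  Completion.induction_on₂ a b
    (isClosed_eq ((compl_continuous_smul c).comp continuous_mul)
      (continuous_mul.comp (continuous_fst.prodMk ((compl_continuous_smul c).comp continuous_snd))))
    fun a b => by
      rw [← Completion.coe_smul, ← complMul_coe, ← complMul_coe, ← Completion.coe_smul,
        mul_smul_comm]

theorem complStar_smul (c : ℂ) (a : Completion E) : star (c • a) = star c • star a :=
  Completion.induction_on a
    (isClosed_eq (continuous_star.comp (compl_continuous_smul c))
      ((compl_continuous_smul (star c)).comp continuous_star))
    fun a => by
      rw [← Completion.coe_smul, ← complStar_coe, ← complStar_coe, star_smul,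
        Completion.coe_smul]

/-- The completion of a `*`-algebra for a seminorm with the `C*`-identity is a `C*`-algebra. -/
abbrev complCStarAlgebra (hE : ∀ a : E, ‖star a * a‖ = ‖a‖ ^ 2) :
    NonUnitalCStarAlgebra (Completion E) :=
  { complNormedRing (E := E),
    (inferInstance : NormedSpace ℂ (Completion E)),
    (inferInstance : CompleteSpace (Completion E)), complStar (E := E) with
    star_involutive := complStar_star
    star_mul := complStar_mul
    star_add := complStar_add
    norm_mul_self_le := compl_norm_mul_self_le hE
    smul_assoc := compl_smul_mul
    smul_comm := compl_mul_smul
    star_smul := complStar_smul }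

end Completion

section Envelope

variable {D : Type*} [NonUnitalRing D] [StarRing D] [Module ℂ D] [IsScalarTower ℂ D D]
  [SMulCommClass ℂ D D] [StarModule ℂ D]

/-- The `*`-algebra `D`, regarded as a seminormed space through the `C*`-seminorm `p`. -/
def Seminormed (_p : CStarSeminorm D) : Type _ := D

namespace Seminormed

variable (p : CStarSeminorm D)

instance : NonUnitalSeminormedRing (Seminormed p) :=
  { (inferInstanceAs (NonUnitalRing D) : NonUnitalRing (Seminormed p)),
    (p.toSeminorm.toAddGroupSeminorm.toSeminormedAddCommGroup :
      SeminormedAddCommGroup (Seminormed p)) with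
    norm_mul_le := p.mul_le }

instance : StarRing (Seminormed p) :=
  { (inferInstanceAs (Star D) : Star (Seminormed p)) with
    star_involutive := star_star (R := D)
    star_mul := star_mul (R := D)
    star_add := star_add (R := D) }

instance : NormedSpace ℂ (Seminormed p) :=
  { (inferInstanceAs (SMul ℂ D) : SMul ℂ (Seminormed p)) with
    one_smul := one_smul ℂ (α := D)
    mul_smul := mul_smul (α := ℂ) (β := D)
    smul_zero := smul_zero (M := ℂ) (A := D)
    smul_add := smul_add (M := ℂ) (A := D)
    add_smul := add_smul (R := ℂ) (M := D)
    zero_smul := zero_smul ℂ (A := D)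
    norm_smul_le := fun c a => (map_smul_eq_mul p.toSeminorm c a).le }

instance : IsScalarTower ℂ (Seminormed p) (Seminormed p) := ⟨smul_assoc (M := ℂ) (N := D) (α := D)⟩
instance : SMulCommClass ℂ (Seminormed p) (Seminormed p) :=
  ⟨smul_comm (M := ℂ) (N := D) (α := D)⟩
instance : StarModule ℂ (Seminormed p) := ⟨star_smul (R := ℂ) (A := D)⟩

instance : NormedStarGroup (Seminormed p) where
  norm_star_le a := (p.star_eq a).le

end Seminormed

/-- The Hausdorff completion of the `*`-algebra `D` relative to the `C*`-seminorm `p`. -/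
def HausdorffCompletion (p : CStarSeminorm D) : Type _ :=
  UniformSpace.Completion (Seminormed p)

instance (p : CStarSeminorm D) : NonUnitalCStarAlgebra (HausdorffCompletion p) :=
  complCStarAlgebra (E := Seminormed p) p.star_mul_self

/-- The canonical `*`-homomorphism of `D` into its Hausdorff completion. -/
def toCompletion (p : CStarSeminorm D) : D →⋆ₙₐ[ℂ] HausdorffCompletion p where
  toFun a := ((show Seminormed p from a : Seminormed p) : UniformSpace.Completion (Seminormed p))
  map_smul' c a := UniformSpace.Completion.coe_smul c (show Seminormed p from a)
  map_zero' := UniformSpace.Completion.coe_zero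
  map_add' a b := UniformSpace.Completion.coe_add (show Seminormed p from a) b
  map_mul' a b := complMul_coe (E := Seminormed p) a b
  map_star' a := complStar_coe (E := Seminormed p) a

theorem norm_toCompletion (p : CStarSeminorm D) (a : D) : ‖toCompletion p a‖ = p a :=
  UniformSpace.Completion.norm_coe (show Seminormed p from a)

theorem denseRange_toCompletion (p : CStarSeminorm D) : DenseRange (toCompletion p) :=
  UniformSpace.Completion.denseRange_coe (α := Seminormed p)

variable (D) in
/-- `D` has an enveloping `C*`-algebra if the supremum of the `C*`-seminorms on `D` is finite. -/
def HasEnveloping : Prop :=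
  ∀ a : D, BddAbove ((fun p : CStarSeminorm D => p a) '' Set.univ)

/-- The largest `C*`-seminorm. -/
def HasEnveloping.seminorm (h : HasEnveloping D) : CStarSeminorm D :=
  CStarSeminorm.sup Set.univ h

/-- The enveloping `C*`-algebra: the Hausdorff completion for the largest `C*`-seminorm. -/
abbrev HasEnveloping.CStar (h : HasEnveloping D) : Type _ := HausdorffCompletion h.seminorm

/-- The canonical map of `D` into its enveloping `C*`-algebra. -/
abbrev HasEnveloping.ι (h : HasEnveloping D) : D →⋆ₙₐ[ℂ] h.CStar := toCompletion h.seminorm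

end Envelope

end

end GpdCStar

namespace GpdCStar

open Topology Filter DirectSum

set_option linter.unusedSectionVars false

noncomputable section

section OfHom

variable {D : Type*} [NonUnitalRing D] [StarRing D] [Module ℂ D] [IsScalarTower ℂ D D]
  [SMulCommClass ℂ D D] [StarModule ℂ D]

/-- The `C*`-seminorm `f ↦ ‖Π(f)‖` of a `*`-homomorphism `Π` into a `C*`-algebra. -/
def CStarSeminorm.ofHom {C : Type*} [NonUnitalCStarAlgebra C] (φ : D →⋆ₙₐ[ℂ] C) :
    CStarSeminorm D :=
  { Seminorm.of (fun a => ‖φ a‖) (fun a b => by rw [map_add]; exact norm_add_le _ _)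
      (fun c a => by rw [map_smul, norm_smul]) with
    mul_le' := fun a b => by
      change ‖φ (a * b)‖ ≤ ‖φ a‖ * ‖φ b‖
      rw [map_mul]; exact norm_mul_le _ _
    star_mul_self' := fun a => by
      change ‖φ (star a * a)‖ = ‖φ a‖ ^ 2
      rw [map_mul, map_star, CStarRing.norm_star_mul_self, sq] }

@[simp] theorem CStarSeminorm.ofHom_apply {C : Type*} [NonUnitalCStarAlgebra C]
    (φ : D →⋆ₙₐ[ℂ] C) (a : D) : CStarSeminorm.ofHom φ a = ‖φ a‖ := rfl

end OfHom

/-! ## Inverse semigroups and their actions on `C*`-algebras -/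

/-- Inverse semigroups, as regular `*`-semigroups with commuting idempotents; `star s` is the
generalized inverse of `s`. -/
class InverseSemigroup (S : Type*) extends Semigroup S, StarMul S where
  mul_star_mul : ∀ s : S, s * star s * s = s
  idem_comm : ∀ e f : S, IsIdempotentElem e → IsIdempotentElem f → e * f = f * e

namespace InverseSemigroup

variable {S : Type*} [InverseSemigroup S]

/-- The natural partial order `s ≤ t ↔ s = s s* t`. -/
def natLE (s t : S) : Prop := s = s * star s * t

theorem star_mul_star (s : S) : star s * s * star s = star s := by
  simpa using mul_star_mul (star s)

theorem idem_star_mul (s : S) : IsIdempotentElem (star s * s) := by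
  rw [IsIdempotentElem, ← mul_assoc, star_mul_star]

theorem idem_mul_star (s : S) : IsIdempotentElem (s * star s) := by
  rw [IsIdempotentElem, ← mul_assoc, mul_star_mul]

end InverseSemigroup

section Actions

variable {B : Type*} [NonUnitalCStarAlgebra B]

/-- A `*`-subalgebra that is a closed two-sided ideal. (Closed two-sided ideals of `C*`-algebras
are automatically self-adjoint.) -/
structure IsClosedIdeal (J : NonUnitalStarSubalgebra ℂ B) : Prop where
  isClosed : IsClosed (J : Set B)
  mul_mem_left : ∀ (a : B) {b : B}, b ∈ J → a * b ∈ J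
  mul_mem_right : ∀ {a : B} (b : B), a ∈ J → a * b ∈ J

variable (B) in
/-- A partial automorphism of `B`: a `*`-isomorphism between two closed ideals. -/
structure PartialAut where
  dom : NonUnitalStarSubalgebra ℂ B
  ran : NonUnitalStarSubalgebra ℂ B
  dom_ideal : IsClosedIdeal dom
  ran_ideal : IsClosedIdeal ran
  equiv : dom ≃⋆ₐ[ℂ] ran

/-- The graph of a partial automorphism. -/
def PartialAut.Rel (φ : PartialAut B) (a b : B) : Prop :=
  ∃ h : a ∈ φ.dom, (φ.equiv ⟨a, h⟩ : B) = b

namespace PartialAut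

variable {φ : PartialAut B} {a a' b b' : B}

theorem Rel.mem_dom (h : φ.Rel a b) : a ∈ φ.dom := h.1

theorem Rel.mem_ran (h : φ.Rel a b) : b ∈ φ.ran := by
  obtain ⟨h, rfl⟩ := h; exact (φ.equiv ⟨a, h⟩).2

theorem Rel.unique (h : φ.Rel a b) (h' : φ.Rel a b') : b = b' := by
  obtain ⟨h, rfl⟩ := h; obtain ⟨h', rfl⟩ := h'; rfl

theorem Rel.inj (h : φ.Rel a b) (h' : φ.Rel a' b) : a = a' := by
  obtain ⟨h, rfl⟩ := h; obtain ⟨h', e⟩ := h'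
  exact (congrArg Subtype.val (φ.equiv.injective (Subtype.ext e))).symm

theorem rel_equiv (φ : PartialAut B) (a : φ.dom) : φ.Rel a (φ.equiv a) := ⟨a.2, rfl⟩

theorem rel_symm (φ : PartialAut B) (b : φ.ran) : φ.Rel (φ.equiv.symm b) b :=
  ⟨(φ.equiv.symm b).2, by simp⟩

theorem Rel.add (h : φ.Rel a b) (h' : φ.Rel a' b') : φ.Rel (a + a') (b + b') := by
  obtain ⟨h, rfl⟩ := h; obtain ⟨h', rfl⟩ := h'
  exact ⟨add_mem h h', congrArg Subtype.val (map_add φ.equiv ⟨a, h⟩ ⟨a', h'⟩)⟩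

theorem Rel.mul (h : φ.Rel a b) (h' : φ.Rel a' b') : φ.Rel (a * a') (b * b') := by
  obtain ⟨h, rfl⟩ := h; obtain ⟨h', rfl⟩ := h'
  exact ⟨mul_mem h h', congrArg Subtype.val (map_mul φ.equiv ⟨a, h⟩ ⟨a', h'⟩)⟩

theorem Rel.smul (c : ℂ) (h : φ.Rel a b) : φ.Rel (c • a) (c • b) := by
  obtain ⟨h, rfl⟩ := h
  exact ⟨SMulMemClass.smul_mem c h, congrArg Subtype.val (map_smul φ.equiv c ⟨a, h⟩)⟩

theorem Rel.star (h : φ.Rel a b) : φ.Rel (star a) (star b) := by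
  obtain ⟨h, rfl⟩ := h
  exact ⟨star_mem h, congrArg Subtype.val (map_star φ.equiv ⟨a, h⟩)⟩

end PartialAut

/-- An action of the inverse semigroup `S` on the `C*`-algebra `B`: a homomorphism into the inverse
semigroup of partial automorphisms of `B` (under composition of partial maps) whose domain ideals
are upward-directed and have dense span. -/
structure InvAction (S : Type*) [InverseSemigroup S] (B : Type*) [NonUnitalCStarAlgebra B] where
  toFun : S → PartialAut B
  map_comp : ∀ (s t : S) (a c : B),
    (toFun (s * t)).Rel a c ↔ ∃ b, (toFun t).Rel a b ∧ (toFun s).Rel b c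
  directed : ∀ s t : S, ∃ g : S, (toFun s).dom ≤ (toFun g).dom ∧ (toFun t).dom ≤ (toFun g).dom
  dense_span : Dense (Submodule.span ℂ (⋃ s : S, ((toFun s).dom : Set B)) : Set B)

variable {S : Type*} [InverseSemigroup S]

namespace InvAction

instance : CoeFun (InvAction S B) (fun _ => S → PartialAut B) := ⟨InvAction.toFun⟩

variable (β : InvAction S B)

theorem rel_idem {e : S} (he : IsIdempotentElem e) {a c : B} (h : (β e).Rel a c) : c = a := by
  have h' := h
  rw [← he.eq, β.map_comp] at h'
  obtain ⟨b, hab, hbc⟩ := h'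
  have hb : b = c := hab.unique h
  subst hb
  exact hbc.inj h

theorem rel_star_of {s : S} {a b : B} (h : (β s).Rel a b) : (β (star s)).Rel b a := by
  have h' := h
  rw [← InverseSemigroup.mul_star_mul s, β.map_comp] at h'
  obtain ⟨b', hab', hb'⟩ := h'
  obtain rfl : b' = b := hab'.unique h
  rw [β.map_comp] at hb'
  obtain ⟨c, hbc, hcb⟩ := hb'
  obtain rfl : c = a := hcb.inj h
  exact hbc

/-- `β_{s*}` is the inverse of `β_s`. -/
theorem rel_star {s : S} {a b : B} : (β (star s)).Rel b a ↔ (β s).Rel a b := by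
  refine ⟨fun h => ?_, β.rel_star_of⟩
  simpa using β.rel_star_of h

theorem mem_ran_star {s : S} {a : B} : a ∈ (β (star s)).ran ↔ a ∈ (β s).dom := by
  constructor
  · intro h
    exact (β.rel_star.1 ((β (star s)).rel_symm ⟨a, h⟩)).mem_dom
  · intro h
    exact (β.rel_star.2 ((β s).rel_equiv ⟨a, h⟩)).mem_ran

theorem mem_dom_star_mul {s : S} {a : B} : a ∈ (β (star s * s)).dom ↔ a ∈ (β s).dom := by
  constructor
  · intro h
    obtain ⟨b, hb, -⟩ := (β.map_comp _ _ _ _).1 ((β _).rel_equiv ⟨a, h⟩)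
    exact hb.mem_dom
  · intro h
    have hb := (β s).rel_equiv ⟨a, h⟩
    exact ((β.map_comp _ _ _ _).2 ⟨_, hb, β.rel_star.2 hb⟩).mem_dom

/-- The range of `β_s` is the ideal `B_{r(s)}` of the range idempotent `r(s) = s s*`. -/
theorem mem_ran_iff {s : S} {a : B} : a ∈ (β s).ran ↔ a ∈ (β (s * star s)).dom := by
  have h := β.mem_ran_star (s := star s) (a := a)
  have h' := β.mem_dom_star_mul (s := star s) (a := a)
  simp only [star_star] at h h'
  rw [h, h']

/-- The `*`-algebra `Γ_c(r^*ℬ)` of finitely supported sections: the direct sum over `s` of the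
ideals `B_{r(s)}`, which are the ranges of the `β_s`. -/
def FinSec : Type _ := ⨁ s : S, (β s).ran

namespace FinSec

instance : AddCommGroup β.FinSec := inferInstanceAs (AddCommGroup (⨁ s : S, (β s).ran))
instance : Module ℂ β.FinSec := inferInstanceAs (Module ℂ (⨁ s : S, (β s).ran))

variable {β}

open Classical in
/-- The generator `(b, s)`. -/
def gen (s : S) : (β s).ran →ₗ[ℂ] β.FinSec := DirectSum.lof ℂ S (fun s => (β s).ran) s

@[elab_as_elim]
theorem induction {P : β.FinSec → Prop} (f : β.FinSec) (zero : P 0)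
    (gen : ∀ s b, P (gen s b)) (add : ∀ f g, P f → P g → P (f + g)) : P f := by
  classical
  refine DirectSum.induction_on (motive := P) f zero (fun s b => ?_) add
  exact gen s b

theorem gen_congr {s t : S} (h : s = t) (b : (β s).ran) (c : (β t).ran) (hbc : (b : B) = c) :
    gen s b = gen t c := by
  subst h; congr 1; exact Subtype.ext hbc

open Classical in
/-- The linear map with given values on the generators. -/
def lift {N : Type*} [AddCommMonoid N] [Module ℂ N] (φ : ∀ s, (β s).ran →ₗ[ℂ] N) :
    β.FinSec →ₗ[ℂ] N :=
  DirectSum.toModule ℂ S N φ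

@[simp] theorem lift_gen {N : Type*} [AddCommMonoid N] [Module ℂ N]
    (φ : ∀ s, (β s).ran →ₗ[ℂ] N) (s : S) (b : (β s).ran) : lift φ (gen s b) = φ s b := by
  classical
  exact DirectSum.toModule_lof (M := fun s => (β s).ran) ℂ s b

theorem mulVal_mem (s t : S) (b : (β s).ran) (c : (β t).ran) :
    ((β s).equiv ⟨((β s).equiv.symm b : B) * c,
      (β s).dom_ideal.mul_mem_right _ ((β s).equiv.symm b).2⟩ : B) ∈ (β (s * t)).ran := by
  set a : (β s).dom := ⟨((β s).equiv.symm b : B) * c,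
      (β s).dom_ideal.mul_mem_right _ ((β s).equiv.symm b).2⟩ with ha
  have hat : (a : B) ∈ (β t).ran := (β t).ran_ideal.mul_mem_left _ c.2
  have h1 := (β t).rel_symm ⟨a, hat⟩
  exact ((β.map_comp _ _ _ _).2 ⟨_, h1, (β s).rel_equiv a⟩).mem_ran

/-- `β_s(β_{s*}(b) c)` for `b ∈ B_{r(s)}`, `c ∈ B_{r(t)}`, as an element of `B_{r(st)}`. -/
def mulVal (s t : S) (b : (β s).ran) (c : (β t).ran) : (β (s * t)).ran :=
  ⟨(β s).equiv ⟨((β s).equiv.symm b : B) * c,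
      (β s).dom_ideal.mul_mem_right _ ((β s).equiv.symm b).2⟩, mulVal_mem s t b c⟩

theorem mulVal_rel (s t : S) (b : (β s).ran) (c : (β t).ran) :
    (β s).Rel (((β s).equiv.symm b : B) * c) (mulVal s t b c) := ⟨_, rfl⟩

/-- `mulVal` as a bilinear map. -/
def mulBilin (s t : S) : (β s).ran →ₗ[ℂ] (β t).ran →ₗ[ℂ] (β (s * t)).ran :=
  LinearMap.mk₂ ℂ (mulVal s t)
    (fun b b' c => Subtype.ext <| (mulVal_rel s t (b + b') c).unique <| by
      simpa [add_mul] using (mulVal_rel s t b c).add (mulVal_rel s t b' c))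
    (fun r b c => Subtype.ext <| (mulVal_rel s t (r • b) c).unique <| by
      simpa [smul_mul_assoc, mul_smul_comm] using (mulVal_rel s t b c).smul r)
    (fun b c c' => Subtype.ext <| (mulVal_rel s t b (c + c')).unique <| by
      simpa [mul_add] using (mulVal_rel s t b c).add (mulVal_rel s t b c'))
    (fun r b c => Subtype.ext <| (mulVal_rel s t b (r • c)).unique <| by
      simpa [smul_mul_assoc, mul_smul_comm] using (mulVal_rel s t b c).smul r)

/-- The product of `Γ_c(r^*ℬ)`: `(b, s)(c, t) = (β_s(β_{s*}(b) c), st)` on generators. -/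
def mulLin : β.FinSec →ₗ[ℂ] β.FinSec →ₗ[ℂ] β.FinSec :=
  lift fun s => LinearMap.flip (lift fun t => LinearMap.flip ((mulBilin s t).compr₂ (gen (s * t))))

instance : Mul β.FinSec := ⟨fun f g => mulLin f g⟩

theorem mul_def (f g : β.FinSec) : f * g = mulLin f g := rfl

theorem gen_mul_gen (s t : S) (b : (β s).ran) (c : (β t).ran) :
    gen s b * gen t c = gen (s * t) (mulVal s t b c) := by
  simp [mul_def, mulLin, mulBilin]

/-- `β_t(β_{t*}(ac) d) = a β_t(β_{t*}(c) d)`. -/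
theorem assoc_aux (t : S) (a d c x y z w : B) (hc : (β t).Rel x c) (hac : (β t).Rel y (a * c))
    (h1 : (β t).Rel (y * d) z) (h2 : (β t).Rel (x * d) w) : z = a * w := by
  have hawr : a * w ∈ (β t).ran := (β t).ran_ideal.mul_mem_left _ h2.mem_ran
  have key : ∀ v ∈ (β t).ran, v * (z - a * w) = 0 := by
    intro v hv
    have hva : v * a ∈ (β t).ran := (β t).ran_ideal.mul_mem_right _ hv
    have r1 := (β t).rel_symm ⟨v, hv⟩
    have r2 := (β t).rel_symm ⟨v * a, hva⟩
    have e3 := r1.mul hac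
    have e4 := r2.mul hc
    simp only [mul_assoc] at e3 e4
    have e5 := e3.inj e4
    have e6 := r1.mul h1
    have e7 := r2.mul h2
    rw [← mul_assoc, e5, mul_assoc] at e6
    rw [mul_sub, e6.unique e7, mul_assoc, sub_self]
  have h := key (star (z - a * w)) (star_mem (sub_mem h1.mem_ran hawr))
  exact sub_eq_zero.1 ((CStarRing.star_mul_self_eq_zero_iff _).1 h)

theorem gen_mul_assoc (s t u : S) (b : (β s).ran) (c : (β t).ran) (d : (β u).ran) :
    gen s b * gen t c * gen u d = gen s b * (gen t c * gen u d) := by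
  simp only [gen_mul_gen]
  refine gen_congr (mul_assoc s t u) _ _ ?_
  have r1 := mulVal_rel s t b c
  have r2 := mulVal_rel (s * t) u (mulVal s t b c) d
  have r3 := mulVal_rel t u c d
  have r4 := mulVal_rel s (t * u) b (mulVal t u c d)
  have r5 := (β (s * t)).rel_symm (mulVal s t b c)
  obtain ⟨m, m1, m2⟩ := (β.map_comp _ _ _ _).1 r2
  obtain ⟨n, n1, n2⟩ := (β.map_comp _ _ _ _).1 r5
  obtain rfl := n2.inj r1
  have h := assoc_aux t _ _ _ _ _ _ _ ((β t).rel_symm c) n1 m1 r3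
  rw [h] at m2
  exact m2.unique r4

instance : NonUnitalRing β.FinSec :=
  { (inferInstance : AddCommGroup β.FinSec), (inferInstance : Mul β.FinSec) with
    left_distrib := fun f g h => map_add (mulLin f) g h
    right_distrib := fun f g h => LinearMap.map_add₂ mulLin f g h
    zero_mul := fun f => LinearMap.map_zero₂ mulLin f
    mul_zero := fun f => map_zero (mulLin f)
    mul_assoc := fun f g h => by
      simp only [mul_def]
      induction f using induction with
      | zero => simp
      | add f f' hf hf' => simp [hf, hf']
      | gen s b =>
        induction g using induction with
        | zero => simp
        | add g g' hg hg' => simp [hg, hg']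
        | gen t c =>
          induction h using induction with
          | zero => simp
          | add h h' hh hh' => simp [hh, hh']
          | gen u d => exact gen_mul_assoc s t u b c d }

instance : IsScalarTower ℂ β.FinSec β.FinSec := ⟨fun c f g => LinearMap.map_smul₂ mulLin c f g⟩
instance : SMulCommClass ℂ β.FinSec β.FinSec := ⟨fun c f g => (map_smul (mulLin f) c g).symm⟩

/-- `β_{s*}(b*)`. -/
def starVal (s : S) (b : (β s).ran) : (β (star s)).ran :=
  ⟨(β s).equiv.symm (star b), β.mem_ran_star.2 ((β s).equiv.symm (star b)).2⟩

theorem starVal_rel (s : S) (b : (β s).ran) : (β s).Rel (starVal s b) (star (b : B)) :=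
  (β s).rel_symm (star b)

open Classical in
/-- The involution of `Γ_c(r^*ℬ)`: `(b, s)* = (β_{s*}(b*), s*)` on generators. -/
def starHom : β.FinSec →+ β.FinSec :=
  DirectSum.toAddMonoid fun s => (gen (star s)).toAddMonoidHom.comp
    { toFun := starVal s
      map_zero' := by apply Subtype.ext; simp [starVal]
      map_add' := fun b c => by apply Subtype.ext; simp [starVal] }

instance : Star β.FinSec := ⟨fun f => starHom f⟩

theorem star_def (f : β.FinSec) : star f = starHom f := rfl

theorem star_gen (s : S) (b : (β s).ran) : star (gen s b) = gen (star s) (starVal s b) := by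
  classical
  rw [star_def]
  exact DirectSum.toAddMonoid_of (β := fun s => (β s).ran) _ s b

theorem star_gen_mul (s t : S) (b : (β s).ran) (c : (β t).ran) :
    star (gen s b * gen t c) = star (gen t c) * star (gen s b) := by
  simp only [gen_mul_gen, star_gen]
  refine gen_congr (star_mul s t) _ _ ?_
  have r1 := mulVal_rel s t b c
  have r2 := starVal_rel (s * t) (mulVal s t b c)
  have r3 := starVal_rel s b
  have r4 := starVal_rel t c
  have r5 := mulVal_rel (star t) (star s) (starVal t c) (starVal s b)
  -- the preimage of `starVal t c` under `β_{t*}` is `c*`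
  have e1 : (((β (star t)).equiv.symm (starVal t c) : (β (star t)).dom) : B) = star (c : B) := by
    have := β.rel_star.1 ((β (star t)).rel_symm (starVal t c))
    exact this.unique r4
  rw [e1] at r5
  have r6 := β.rel_star.1 r5
  obtain ⟨m, m1, m2⟩ := (β.map_comp _ _ _ _).1 r2
  have e2 : (starVal s b : B) = star (((β s).equiv.symm b : (β s).dom) : B) := by
    exact r3.inj ((β s).rel_symm b).star
  have e3 : m = star (c : B) * (starVal s b : B) := by
    rw [e2, ← star_mul]
    exact m2.inj r1.star
  rw [e3] at m1
  exact m1.inj r6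

instance : StarRing β.FinSec where
  star_involutive f := by
    induction f using induction with
    | zero => simp [star_def]
    | add f g hf hg => simp only [star_def, map_add] at *; rw [hf, hg]
    | gen s b =>
      rw [star_gen, star_gen]
      refine gen_congr (star_star s) _ _ ?_
      have r1 := starVal_rel s b
      have r2 := β.rel_star.1 (starVal_rel (star s) (starVal s b))
      have r3 := r1.star
      rw [star_star] at r3
      exact r2.unique r3
  star_mul f g := by
    induction f using induction with
    | zero => simp [star_def]
    | add f f' hf hf' =>
      rw [add_mul, star_def, map_add, ← star_def, ← star_def, hf, hf', star_def (f + f'), map_add,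
        mul_add]; rfl
    | gen s b =>
      induction g using induction with
      | zero => simp [star_def]
      | add g g' hg hg' =>
        rw [mul_add, star_def, map_add, ← star_def, ← star_def, hg, hg', star_def (g + g'),
          map_add, add_mul]; rfl
      | gen t c => exact star_gen_mul s t b c
  star_add f g := map_add starHom f g

instance : StarModule ℂ β.FinSec where
  star_smul r f := by
    induction f using induction with
    | zero => simp
    | add f g hf hg => rw [smul_add, star_add, hf, hg, star_add, smul_add]
    | gen s b =>
      rw [← map_smul, star_gen, star_gen, ← map_smul]
      congr 1
      apply Subtype.ext
      simp [starVal]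

end FinSec

end InvAction

/-! ## Covariant representations and crossed products -/

/-- A covariant representation of `(B, S, β)` on the Hilbert space `H`: a nondegenerate
representation `π` of `B` and a representation `U` of `S` such that `U_e H = π(B_e) H` (the closed
linear span of the vectors `π(b) ξ`) for idempotents `e`, and `U_s π(b) U_s* = π(β_s(b))` for `b`
in the domain of `β_s`. -/
structure CovariantRep (β : InvAction S B) (H : Type*) [NormedAddCommGroup H]
    [InnerProductSpace ℂ H] [CompleteSpace H] where
  π : B →⋆ₙₐ[ℂ] (H →L[ℂ] H)
  U : S →ₙ* (H →L[ℂ] H)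
  U_star : ∀ s, U (star s) = star (U s)
  U_dense : Dense (Submodule.span ℂ (⋃ s, Set.range (U s)) : Set H)
  π_nondegenerate : Dense (Submodule.span ℂ {x | ∃ (b : B) (ξ : H), π b ξ = x} : Set H)
  range_U : ∀ e : S, IsIdempotentElem e → Set.range (U e) =
    closure (Submodule.span ℂ {x | ∃ b ∈ (β e).dom, ∃ ξ : H, π b ξ = x} : Set H)
  covariant : ∀ (s : S) (b : (β s).dom), U s * π b * star (U s) = π ((β s).equiv b)

namespace CovariantRep

variable {β : InvAction S B} {H : Type*} [NormedAddCommGroup H] [InnerProductSpace ℂ H]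
  [CompleteSpace H] (ρ : CovariantRep β H)

theorem U_mul_π {e : S} (he : IsIdempotentElem e) {b : B} (hb : b ∈ (β e).dom) :
    ρ.U e * ρ.π b = ρ.π b := by
  ext ξ
  have h : ρ.π b ξ ∈ Set.range (ρ.U e) := by
    rw [ρ.range_U e he]
    exact subset_closure (Submodule.subset_span ⟨b, hb, ξ, rfl⟩)
  obtain ⟨η, hη⟩ := h
  have h2 : ρ.U e * ρ.U e = ρ.U e := by rw [← map_mul, he.eq]
  calc ρ.U e (ρ.π b ξ) = (ρ.U e * ρ.U e) η := by rw [← hη]; rfl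
    _ = ρ.π b ξ := by rw [h2, hη]

theorem π_mul_U {s : S} {b : B} (hb : b ∈ (β s).dom) :
    ρ.π b * (star (ρ.U s) * ρ.U s) = ρ.π b := by
  have h := ρ.U_mul_π (InverseSemigroup.idem_star_mul s) (β.mem_dom_star_mul.2 (star_mem hb))
  have h2 := congrArg star h
  rw [star_mul, map_star, star_star, map_mul, star_mul, ρ.U_star, star_star] at h2
  exact h2

theorem norm_U_le (s : S) : ‖ρ.U s‖ ≤ 1 := by
  have h : ρ.U s * star (ρ.U s) * ρ.U s = ρ.U s := by
    rw [← ρ.U_star, ← map_mul, ← map_mul, InverseSemigroup.mul_star_mul]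
  have h2 : ‖star (ρ.U s) * ρ.U s‖ = ‖ρ.U s‖ * ‖ρ.U s‖ := CStarRing.norm_star_mul_self
  have h3 : ‖star (star (ρ.U s) * ρ.U s) * (star (ρ.U s) * ρ.U s)‖ =
      ‖star (ρ.U s) * ρ.U s‖ * ‖star (ρ.U s) * ρ.U s‖ := CStarRing.norm_star_mul_self
  have h4 : star (star (ρ.U s) * ρ.U s) * (star (ρ.U s) * ρ.U s) = star (ρ.U s) * ρ.U s := by
    rw [star_mul, star_star, mul_assoc, ← mul_assoc (ρ.U s), h]
  rw [h4, h2] at h3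
  by_contra hlt
  push Not at hlt
  have h5 : 1 < ‖ρ.U s‖ * ‖ρ.U s‖ := by nlinarith
  nlinarith

/-- The linear map underlying the integrated form. -/
def integratedLin : β.FinSec →ₗ[ℂ] (H →L[ℂ] H) :=
  InvAction.FinSec.lift fun s =>
    { toFun := fun b => ρ.π b * ρ.U s
      map_add' := fun b c => by simp [add_mul]
      map_smul' := fun r b => by simp }

@[simp] theorem integratedLin_gen (s : S) (b : (β s).ran) :
    ρ.integratedLin (InvAction.FinSec.gen s b) = ρ.π b * ρ.U s := by
  simp [integratedLin]

theorem π_equiv_mul_U (s : S) (a : (β s).dom) :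
    ρ.π ((β s).equiv a) * ρ.U s = ρ.U s * ρ.π a := by
  rw [← ρ.covariant, mul_assoc, mul_assoc, ρ.π_mul_U a.2]

theorem integrated_mul (f g : β.FinSec) :
    ρ.integratedLin (f * g) = ρ.integratedLin f * ρ.integratedLin g := by
  induction f using InvAction.FinSec.induction with
  | zero => simp
  | add f f' hf hf' => simp [add_mul, hf, hf']
  | gen s b =>
    induction g using InvAction.FinSec.induction with
    | zero => simp
    | add g g' hg hg' => simp [mul_add, hg, hg']
    | gen t c =>
      rw [InvAction.FinSec.gen_mul_gen]
      simp only [integratedLin_gen]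
      have h1 : ρ.π b * ρ.U s = ρ.U s * ρ.π ((β s).equiv.symm b) := by
        have := ρ.π_equiv_mul_U s ((β s).equiv.symm b)
        simpa using this
      rw [h1, InvAction.FinSec.mulVal, map_mul ρ.U, ← mul_assoc]
      simp only
      rw [ρ.π_equiv_mul_U, map_mul, mul_assoc, mul_assoc, mul_assoc]

theorem integrated_star (f : β.FinSec) :
    ρ.integratedLin (star f) = star (ρ.integratedLin f) := by
  induction f using InvAction.FinSec.induction with
  | zero => simp
  | add f f' hf hf' => simp [hf, hf']
  | gen s b =>
    rw [InvAction.FinSec.star_gen]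
    simp only [integratedLin_gen]
    have h1 : ρ.π b * ρ.U s = ρ.U s * ρ.π ((β s).equiv.symm b) := by
      have := ρ.π_equiv_mul_U s ((β s).equiv.symm b)
      simpa using this
    rw [h1, star_mul, ρ.U_star, ← map_star ρ.π]
    have h2 := (InvAction.FinSec.starVal_rel s b).inj ((β s).rel_symm b).star
    rw [h2]

/-- The integrated form `∑ (b_i, s_i) ↦ ∑ π(b_i) U_{s_i}` of a covariant representation. -/
def integrated : β.FinSec →⋆ₙₐ[ℂ] (H →L[ℂ] H) :=
  { ρ.integratedLin with
    map_zero' := map_zero ρ.integratedLin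
    map_mul' := ρ.integrated_mul
    map_star' := ρ.integrated_star }

theorem integrated_apply (f : β.FinSec) : ρ.integrated f = ρ.integratedLin f := rfl

end CovariantRep

end Actions

section Crossed

universe u v

variable {S : Type u} [InverseSemigroup S] {B : Type v} [NonUnitalCStarAlgebra B]
  (β : InvAction S B)

namespace InvAction

/-- The `C*`-seminorms `f ↦ ‖Π(f)‖`, with `Π` an integrated form of a covariant representation on
a Hilbert space. -/
def integratedSeminorms : Set (CStarSeminorm β.FinSec) :=
  {p | ∃ (H : Type (max u v)) (_ : NormedAddCommGroup H) (_ : InnerProductSpace ℂ H)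
    (_ : CompleteSpace H) (ρ : CovariantRep β H), p = CStarSeminorm.ofHom ρ.integrated}

theorem bddAbove_integratedSeminorms (f : β.FinSec) :
    BddAbove ((fun p : CStarSeminorm β.FinSec => p f) '' β.integratedSeminorms) := by
  suffices h : ∃ M, ∀ p ∈ β.integratedSeminorms, p f ≤ M by
    obtain ⟨M, hM⟩ := h
    exact ⟨M, by rintro _ ⟨p, hp, rfl⟩; exact hM p hp⟩
  induction f using FinSec.induction with
  | zero => exact ⟨0, fun p _ => (map_zero p.toSeminorm).le⟩
  | add f g hf hg =>
    obtain ⟨M, hM⟩ := hf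
    obtain ⟨N, hN⟩ := hg
    exact ⟨M + N, fun p hp => (map_add_le_add p.toSeminorm f g).trans
      (add_le_add (hM p hp) (hN p hp))⟩
  | gen s b =>
    refine ⟨‖(b : B)‖, ?_⟩
    rintro _ ⟨H, _, _, _, ρ, rfl⟩
    rw [CStarSeminorm.ofHom_apply, CovariantRep.integrated_apply, CovariantRep.integratedLin_gen]
    refine (norm_mul_le _ _).trans ?_
    calc ‖ρ.π b‖ * ‖ρ.U s‖ ≤ ‖(b : B)‖ * 1 :=
          mul_le_mul (NonUnitalStarAlgHom.norm_apply_le ρ.π _) (ρ.norm_U_le s) (norm_nonneg _)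
            (norm_nonneg _)
      _ = ‖(b : B)‖ := mul_one _

/-- The supremum of the `C*`-seminorms of the integrated forms of covariant representations. -/
def crossedSeminorm : CStarSeminorm β.FinSec :=
  CStarSeminorm.sup β.integratedSeminorms β.bddAbove_integratedSeminorms

/-- The crossed product `B ×_β S`. -/
abbrev CrossedProduct : Type _ := HausdorffCompletion β.crossedSeminorm

/-- The canonical map of `Γ_c(r^*ℬ)` into `B ×_β S`, sending `(b, s)` to `[b, s]`. -/
abbrev toCrossed : β.FinSec →⋆ₙₐ[ℂ] β.CrossedProduct := toCompletion β.crossedSeminorm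

end InvAction

end Crossed

end

end GpdCStar

namespace GpdCStar

open Topology Filter CategoryTheory

set_option linter.unusedSectionVars false

noncomputable section

/-! ## `r`-discrete groupoids -/

/-- The set `G` of arrows of a groupoid with unit space `X = G⁰`; `src` is the domain map `d` and
`tgt` is the range map `r`. -/
@[ext]
structure Arr (X : Type*) [Quiver X] where
  src : X
  tgt : X
  hom : src ⟶ tgt

/-- The set `G²` of composable pairs `(x, y)`, `d(x) = r(y)`. -/
structure Composable (X : Type*) [Quiver X] where
  src : X
  mid : X
  tgt : X
  fst : mid ⟶ tgt
  snd : src ⟶ mid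

section Groupoid

variable {X : Type*} [Groupoid X]

namespace Composable

/-- The first entry `x` of the composable pair `(x, y)`. -/
abbrev left (p : Composable X) : Arr X := ⟨p.mid, p.tgt, p.fst⟩

/-- The second entry `y` of the composable pair `(x, y)`. -/
abbrev right (p : Composable X) : Arr X := ⟨p.src, p.mid, p.snd⟩

/-- The product `xy`; in the notation of category theory this is `y` followed by `x`. -/
abbrev prod (p : Composable X) : Arr X := ⟨p.src, p.tgt, p.snd ≫ p.fst⟩

/-- `G²` has the topology of a subspace of `G × G`. -/
instance [TopologicalSpace (Arr X)] : TopologicalSpace (Composable X) :=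
  TopologicalSpace.induced (fun p => (p.left, p.right)) inferInstance

end Composable

namespace Arr

/-- The unit at `u`. -/
abbrev unit (u : X) : Arr X := ⟨u, u, 𝟙 u⟩

/-- The inverse. -/
abbrev inv (x : Arr X) : Arr X := ⟨x.tgt, x.src, Groupoid.inv x.hom⟩

@[simp] theorem inv_inv (x : Arr X) : x.inv.inv = x := by
  obtain ⟨u, v, x⟩ := x
  simp [inv]

end Arr

variable (X) in
/-- `r`-discrete groupoids: locally compact Hausdorff topological groupoids whose range and domain
maps are local homeomorphisms onto the unit space. (The continuity of `unit` and of `src` makes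
`X` a topological subspace of the space of arrows.) -/
class RDiscreteGroupoid [TopologicalSpace X] [TopologicalSpace (Arr X)] : Prop where
  t2 : T2Space (Arr X)
  locallyCompact : LocallyCompactSpace (Arr X)
  continuous_unit : Continuous fun u : X => Arr.unit u
  continuous_inv : Continuous fun x : Arr X => x.inv
  continuous_prod : Continuous fun p : Composable X => p.prod
  isLocalHomeomorph_src : IsLocalHomeomorph (Arr.src : Arr X → X)
  isLocalHomeomorph_tgt : IsLocalHomeomorph (Arr.tgt : Arr X → X)

namespace RDiscreteGroupoid

variable [TopologicalSpace X] [TopologicalSpace (Arr X)] [RDiscreteGroupoid X]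

instance : T2Space (Arr X) := RDiscreteGroupoid.t2
instance : LocallyCompactSpace (Arr X) := RDiscreteGroupoid.locallyCompact

theorem continuous_src : Continuous (Arr.src : Arr X → X) := isLocalHomeomorph_src.continuous
theorem continuous_tgt : Continuous (Arr.tgt : Arr X → X) := isLocalHomeomorph_tgt.continuous

instance t2Space_units : T2Space X :=
  T2Space.of_injective_continuous (f := fun u : X => Arr.unit u)
    (fun _ _ h => congrArg Arr.src h) continuous_unit

theorem isClosedEmbedding_unit : IsClosedEmbedding fun u : X => Arr.unit u := by
  refine ⟨?_, ?_⟩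
  · exact Function.LeftInverse.isEmbedding (f := Arr.src) (fun _ => rfl) continuous_src
      continuous_unit
  · have : Set.range (fun u : X => Arr.unit u) = {x : Arr X | Arr.unit x.src = x} := by
      ext x
      constructor
      · rintro ⟨u, rfl⟩; rfl
      · intro h; exact ⟨_, h⟩
    rw [this]
    exact isClosed_eq (continuous_unit.comp continuous_src) continuous_id

instance locallyCompactSpace_units : LocallyCompactSpace X :=
  isClosedEmbedding_unit.locallyCompactSpace

theorem tendsto_composable {ι : Type*} {l : Filter ι} {p : ι → Composable X} {p₀ : Composable X}
    (h₁ : Tendsto (fun i => (p i).left) l (𝓝 p₀.left))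
    (h₂ : Tendsto (fun i => (p i).right) l (𝓝 p₀.right)) :
    Tendsto (fun i => (p i).prod) l (𝓝 p₀.prod) := by
  refine (continuous_prod.tendsto p₀).comp ?_
  rw [nhds_induced, tendsto_comap_iff]
  exact h₁.prodMk_nhds h₂

theorem tendsto_inv {ι : Type*} {l : Filter ι} {x : ι → Arr X} {x₀ : Arr X}
    (h : Tendsto x l (𝓝 x₀)) : Tendsto (fun i => (x i).inv) l (𝓝 x₀.inv) :=
  (continuous_inv.tendsto x₀).comp h

theorem isClosedEmbedding_composable :
    IsClosedEmbedding fun p : Composable X => (p.left, p.right) := by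
  refine ⟨⟨⟨rfl⟩, ?_⟩, ?_⟩
  · rintro ⟨u, v, w, x, y⟩ ⟨u', v', w', x', y'⟩ h
    simp only [Prod.mk.injEq, Arr.mk.injEq] at h
    obtain ⟨⟨rfl, rfl, h1⟩, rfl, -, h2⟩ := h
    obtain rfl := eq_of_heq h1
    obtain rfl := eq_of_heq h2
    rfl
  · have : Set.range (fun p : Composable X => (p.left, p.right)) =
        {q : Arr X × Arr X | q.1.src = q.2.tgt} := by
      ext ⟨⟨v, w, x⟩, ⟨u, v', y⟩⟩
      constructor
      · rintro ⟨p, hp⟩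
        rw [← hp]
        rfl
      · rintro h
        obtain rfl : v = v' := h
        exact ⟨⟨u, v, w, x, y⟩, rfl⟩
    rw [this]
    exact isClosed_eq (continuous_src.comp continuous_fst) (continuous_tgt.comp continuous_snd)

end RDiscreteGroupoid

/-! ## The inverse semigroup of open `G`-sets -/

variable (X) in
/-- Open `G`-sets: open sets of arrows on which the range and domain maps are injective. -/
@[ext]
structure OpenBisection [TopologicalSpace (Arr X)] where
  carrier : Set (Arr X)
  isOpen : IsOpen carrier
  src_injOn : Set.InjOn Arr.src carrier
  tgt_injOn : Set.InjOn Arr.tgt carrier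

namespace OpenBisection

variable [TopologicalSpace X] [TopologicalSpace (Arr X)] [RDiscreteGroupoid X]

open RDiscreteGroupoid

/-- The set `d(s)` of the domains of the arrows in `s`. -/
abbrev dSet (s : OpenBisection X) : Set X := Arr.src '' s.carrier

/-- The set `r(s)` of the ranges of the arrows in `s`. -/
abbrev rSet (s : OpenBisection X) : Set X := Arr.tgt '' s.carrier

theorem isOpen_dSet (s : OpenBisection X) : IsOpen s.dSet :=
  isLocalHomeomorph_src.isOpenMap _ s.isOpen

theorem isOpen_rSet (s : OpenBisection X) : IsOpen s.rSet :=
  isLocalHomeomorph_tgt.isOpenMap _ s.isOpen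

theorem tendsto_of_src (s : OpenBisection X) {ι : Type*} {l : Filter ι} {y : ι → Arr X}
    {y₀ : Arr X} (hy : ∀ i, y i ∈ s.carrier) (hy₀ : y₀ ∈ s.carrier)
    (h : Tendsto (fun i => (y i).src) l (𝓝 y₀.src)) : Tendsto y l (𝓝 y₀) := by
  have h1 : IsLocalHomeomorph (Arr.src ∘ (Subtype.val : s.carrier → Arr X)) :=
    isLocalHomeomorph_src.comp s.isOpen.isOpenEmbedding_subtypeVal.isLocalHomeomorph
  have h2 := h1.isOpenEmbedding_of_injective (s.src_injOn.injective)
  have h3 : Tendsto (fun i => (⟨y i, hy i⟩ : s.carrier)) l (𝓝 ⟨y₀, hy₀⟩) :=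
    h2.isInducing.tendsto_nhds_iff.2 h
  exact (continuous_subtype_val.tendsto _).comp h3

theorem tendsto_of_tgt (s : OpenBisection X) {ι : Type*} {l : Filter ι} {y : ι → Arr X}
    {y₀ : Arr X} (hy : ∀ i, y i ∈ s.carrier) (hy₀ : y₀ ∈ s.carrier)
    (h : Tendsto (fun i => (y i).tgt) l (𝓝 y₀.tgt)) : Tendsto y l (𝓝 y₀) := by
  have h1 : IsLocalHomeomorph (Arr.tgt ∘ (Subtype.val : s.carrier → Arr X)) :=
    isLocalHomeomorph_tgt.comp s.isOpen.isOpenEmbedding_subtypeVal.isLocalHomeomorph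
  have h2 := h1.isOpenEmbedding_of_injective (s.tgt_injOn.injective)
  have h3 : Tendsto (fun i => (⟨y i, hy i⟩ : s.carrier)) l (𝓝 ⟨y₀, hy₀⟩) :=
    h2.isInducing.tendsto_nhds_iff.2 h
  exact (continuous_subtype_val.tendsto _).comp h3

/-- Every arrow lies in an open `G`-set. -/
theorem exists_mem (x : Arr X) : ∃ s : OpenBisection X, x ∈ s.carrier := by
  obtain ⟨e, hx, he⟩ := isLocalHomeomorph_src x
  obtain ⟨e', hx', he'⟩ := isLocalHomeomorph_tgt x
  refine ⟨⟨e.source ∩ e'.source, e.open_source.inter e'.open_source, ?_, ?_⟩, hx, hx'⟩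
  · rw [he]; exact e.injOn.mono Set.inter_subset_left
  · rw [he']; exact e'.injOn.mono Set.inter_subset_right

/-- `st = {xy : x ∈ s, y ∈ t, d(x) = r(y)}`. -/
def mulSet (s t : OpenBisection X) : Set (Arr X) :=
  {z | ∃ (v : X) (x : v ⟶ z.tgt) (y : z.src ⟶ v), ⟨v, z.tgt, x⟩ ∈ s.carrier ∧
    ⟨z.src, v, y⟩ ∈ t.carrier ∧ y ≫ x = z.hom}

theorem mulSet_eq (s t : OpenBisection X) : mulSet s t =
    {z | ∃ p : Composable X, p.left ∈ s.carrier ∧ p.right ∈ t.carrier ∧ p.prod = z} := by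
  ext z
  constructor
  · rintro ⟨v, x, y, hx, hy, h⟩
    exact ⟨⟨z.src, v, z.tgt, x, y⟩, hx, hy, by rw [Composable.prod, h]⟩
  · rintro ⟨⟨u, v, w, x, y⟩, hx, hy, rfl⟩
    exact ⟨v, x, y, hx, hy, rfl⟩

theorem isOpen_mulSet (s t : OpenBisection X) : IsOpen (mulSet s t) := by
  rw [isOpen_iff_mem_nhds]
  rintro ⟨u, w, z⟩ ⟨v, x, y, hx, hy, h⟩
  dsimp only at x y hx hy h
  subst h
  set N : Set (Arr X) := Arr.src ⁻¹' t.dSet with hN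
  have hNo : IsOpen N := t.isOpen_dSet.preimage continuous_src
  have hzN : (⟨u, w, y ≫ x⟩ : Arr X) ∈ N := ⟨_, hy, rfl⟩
  have hex : ∀ z : N, ∃ q : Composable X, q.left = z ∧ q.right.inv ∈ t.carrier := by
    rintro ⟨⟨u', w', z'⟩, ⟨⟨u'', v'', y'⟩, hy', hu⟩⟩
    obtain rfl : u'' = u' := hu
    refine ⟨⟨v'', u'', w', z', Groupoid.inv y'⟩, rfl, ?_⟩
    simpa [Arr.inv] using hy'
  choose q hq1 hq2 using hex
  let q₀ : Composable X := ⟨v, u, w, y ≫ x, Groupoid.inv y⟩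
  have hq₀ : q₀.right.inv = ⟨u, v, y⟩ := by simp [q₀, Arr.inv]
  have T1 : Tendsto (fun z => (q z).left) (𝓝 (⟨_, hzN⟩ : N)) (𝓝 q₀.left) := by
    simp only [hq1]
    exact continuous_subtype_val.tendsto _
  have T2 : Tendsto (fun z => (q z).right.inv) (𝓝 (⟨_, hzN⟩ : N)) (𝓝 q₀.right.inv) := by
    refine t.tendsto_of_src hq2 (by rw [hq₀]; exact hy) ?_
    have T0 : Tendsto (fun z => (q z).left.src) (𝓝 (⟨_, hzN⟩ : N)) (𝓝 q₀.left.src) :=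
      (continuous_src.tendsto q₀.left).comp T1
    have e : ∀ p : Composable X, p.right.inv.src = p.left.src := fun p => rfl
    simpa only [e] using T0
  have T3 : Tendsto (fun z => (q z).right) (𝓝 (⟨_, hzN⟩ : N)) (𝓝 q₀.right) := by
    have := tendsto_inv T2
    simpa only [Arr.inv_inv] using this
  have T4 := tendsto_composable T1 T3
  have hp : q₀.prod ∈ s.carrier := by simpa [q₀, Composable.prod] using hx
  have h5 : ∀ᶠ z : N in 𝓝 (⟨_, hzN⟩ : N), (z : Arr X) ∈ mulSet s t := by
    filter_upwards [T4.eventually (s.isOpen.mem_nhds hp)] with z hz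
    rw [mulSet_eq]
    have h1 := hq1 z
    have h2 := hq2 z
    generalize q z = q' at hz h1 h2
    obtain ⟨a, b, c, f, g⟩ := q'
    refine ⟨⟨b, a, c, g ≫ f, Groupoid.inv g⟩, hz, h2, ?_⟩
    rw [← h1]
    simp [Composable.prod]
  have h6 := (hNo.isOpenEmbedding_subtypeVal.map_nhds_eq ⟨_, hzN⟩)
  rw [← h6]
  exact h5

instance : Mul (OpenBisection X) where
  mul s t :=
    { carrier := mulSet s t
      isOpen := isOpen_mulSet s t
      src_injOn := by
        rintro ⟨u, w, z⟩ ⟨v, x, y, hx, hy, h⟩ ⟨u', w', z'⟩ ⟨v', x', y', hx', hy', h'⟩ huu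
        dsimp only at x y x' y' hx hy h hx' hy' h' huu
        obtain rfl := huu
        obtain rfl := h
        obtain rfl := h'
        have e1 := t.src_injOn hy hy' rfl
        cases e1
        have e2 := s.src_injOn hx hx' rfl
        cases e2
        rfl
      tgt_injOn := by
        rintro ⟨u, w, z⟩ ⟨v, x, y, hx, hy, h⟩ ⟨u', w', z'⟩ ⟨v', x', y', hx', hy', h'⟩ huu
        dsimp only at x y x' y' hx hy h hx' hy' h' huu
        obtain rfl := huu
        obtain rfl := h
        obtain rfl := h'
        have e2 := s.tgt_injOn hx hx' rfl
        cases e2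
        have e1 := t.tgt_injOn hy hy' rfl
        cases e1
        rfl }

theorem mem_mul {s t : OpenBisection X} {z : Arr X} : z ∈ (s * t).carrier ↔
    ∃ (v : X) (x : v ⟶ z.tgt) (y : z.src ⟶ v), ⟨v, z.tgt, x⟩ ∈ s.carrier ∧
      ⟨z.src, v, y⟩ ∈ t.carrier ∧ y ≫ x = z.hom := Iff.rfl

/-- `s* = {x⁻¹ : x ∈ s}`. -/
instance : Star (OpenBisection X) where
  star s :=
    { carrier := {x | x.inv ∈ s.carrier}
      isOpen := s.isOpen.preimage RDiscreteGroupoid.continuous_inv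
      src_injOn := fun x hx y hy h => by
        have := s.tgt_injOn hx hy h
        rw [← x.inv_inv, this, y.inv_inv]
      tgt_injOn := fun x hx y hy h => by
        have := s.src_injOn hx hy h
        rw [← x.inv_inv, this, y.inv_inv] }

theorem mem_star {s : OpenBisection X} {x : Arr X} : x ∈ (star s).carrier ↔ x.inv ∈ s.carrier :=
  Iff.rfl

theorem isUnit_of_idem {e : OpenBisection X} (he : IsIdempotentElem e) {x : Arr X}
    (hx : x ∈ e.carrier) : x = Arr.unit x.src := by
  have hx' := hx
  rw [← he.eq] at hx'
  obtain ⟨u, w, z⟩ := x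
  obtain ⟨v, x, y, h1, h2, h⟩ := hx'
  dsimp only at x y h1 h2 h
  subst h
  have e1 := e.src_injOn h2 hx rfl
  have e2 := e.tgt_injOn h1 hx rfl
  obtain rfl : v = w := congrArg Arr.tgt e1
  obtain rfl : v = u := congrArg Arr.src e2
  simp only [Arr.mk.injEq, heq_eq_eq, true_and] at e1 e2
  have e3 : x = 𝟙 v := by
    rw [← cancel_epi y, Category.comp_id, ← e1]
  rw [← e2, e3]

theorem mem_mul_idem {e f : OpenBisection X} (he : IsIdempotentElem e) (hf : IsIdempotentElem f)
    {x : Arr X} : x ∈ (e * f).carrier ↔ x ∈ e.carrier ∧ x ∈ f.carrier := by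
  constructor
  · obtain ⟨u, w, z⟩ := x
    rintro ⟨v, x, y, h1, h2, h⟩
    dsimp only at x y h1 h2 h
    subst h
    have e1 := isUnit_of_idem he h1
    have e2 := isUnit_of_idem hf h2
    obtain rfl : w = v := congrArg Arr.tgt e1
    obtain rfl : w = u := congrArg Arr.tgt e2
    simp only [Arr.mk.injEq, heq_eq_eq, true_and] at e1 e2
    subst e1 e2
    rw [Category.comp_id]
    exact ⟨h1, h2⟩
  · rintro ⟨h1, h2⟩
    have h := isUnit_of_idem he h1
    rw [h] at h1 h2 ⊢
    exact ⟨x.src, 𝟙 _, 𝟙 _, h1, h2, Category.comp_id _⟩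

instance : InverseSemigroup (OpenBisection X) where
  mul_assoc s t r := by
    apply OpenBisection.ext
    ext ⟨u, w, z⟩
    simp only [mem_mul]
    constructor
    · rintro ⟨v, x, y, ⟨v', x', y', hx', hy', rfl⟩, hy, rfl⟩
      exact ⟨v', x', y ≫ y', hx', ⟨v, y', y, hy', hy, rfl⟩, by simp⟩
    · rintro ⟨v, x, y, hx, ⟨v', x', y', hx', hy', rfl⟩, rfl⟩
      exact ⟨v', x' ≫ x, y', ⟨v, x, x', hx, hx', rfl⟩, hy', by simp⟩
  star_involutive s := by
    apply OpenBisection.ext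
    ext x
    simp only [mem_star, Arr.inv_inv]
  star_mul s t := by
    apply OpenBisection.ext
    ext ⟨u, w, z⟩
    simp only [mem_mul, mem_star]
    constructor
    · rintro ⟨v, x, y, hx, hy, h⟩
      refine ⟨v, Groupoid.inv y, Groupoid.inv x, by simpa [Arr.inv] using hy, by simpa [Arr.inv] using hx, ?_⟩
      rw [← cancel_mono y, ← cancel_mono x]
      simp [h]
    · rintro ⟨v, x, y, hx, hy, rfl⟩
      refine ⟨v, Groupoid.inv y, Groupoid.inv x, hy, hx, ?_⟩
      simp
  mul_star_mul s := by
    apply OpenBisection.ext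
    ext ⟨u, w, z⟩
    simp only [mem_mul, mem_star]
    constructor
    · rintro ⟨v, x, y, ⟨v', x', y', hx', hy', rfl⟩, hy, rfl⟩
      have e1 := s.src_injOn hx' hy' rfl
      cases e1
      have e2 := s.tgt_injOn hy' hy rfl
      cases e2
      simpa using hx'
    · intro hz
      exact ⟨w, 𝟙 w, z, ⟨u, z, Groupoid.inv z, hz, by simpa [Arr.inv] using hz, by simp⟩, hz, by simp⟩
  idem_comm e f he hf := by
    apply OpenBisection.ext
    ext x
    rw [mem_mul_idem he hf, mem_mul_idem hf he, and_comm]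

end OpenBisection

end Groupoid

/-- Inverse subsemigroups of an inverse semigroup. -/
structure InverseSubsemigroup (T : Type*) [InverseSemigroup T] extends Subsemigroup T where
  star_mem' : ∀ {s : T}, s ∈ carrier → star s ∈ carrier

namespace InverseSubsemigroup

variable {T : Type*} [InverseSemigroup T]

/-- The elements of an inverse subsemigroup. -/
def Elem (S : InverseSubsemigroup T) : Type _ := {s : T // s ∈ S.carrier}

instance : CoeSort (InverseSubsemigroup T) (Type _) := ⟨Elem⟩

instance (S : InverseSubsemigroup T) : InverseSemigroup S where
  mul s t := ⟨s.1 * t.1, S.mul_mem' s.2 t.2⟩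
  star s := ⟨star s.1, S.star_mem' s.2⟩
  mul_assoc s t r := Subtype.ext (mul_assoc s.1 t.1 r.1)
  star_involutive s := Subtype.ext (star_star s.1)
  star_mul s t := Subtype.ext (star_mul s.1 t.1)
  mul_star_mul s := Subtype.ext (InverseSemigroup.mul_star_mul s.1)
  idem_comm e f he hf := Subtype.ext
    (InverseSemigroup.idem_comm e.1 f.1 (congrArg Subtype.val he) (congrArg Subtype.val hf))

theorem idem_val {S : InverseSubsemigroup T} {e : S} (he : IsIdempotentElem e) :
    IsIdempotentElem e.1 := congrArg Subtype.val he

/-- An inverse semigroup of open `G`-sets is full if it is a base for the topology of `G` and every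
two of its idempotents have a common upper bound among its idempotents. -/
structure IsFull {X : Type*} [Groupoid X] [TopologicalSpace X] [TopologicalSpace (Arr X)]
    [RDiscreteGroupoid X] (S : InverseSubsemigroup (OpenBisection X)) : Prop where
  isBasis : TopologicalSpace.IsTopologicalBasis {V : Set (Arr X) | ∃ s : S, s.1.carrier = V}
  directed : ∀ e f : S, IsIdempotentElem e → IsIdempotentElem f →
    ∃ g : S, IsIdempotentElem g ∧ InverseSemigroup.natLE e g ∧ InverseSemigroup.natLE f g

end InverseSubsemigroup

end

end GpdCStar

namespace GpdCStar

open Topology Filter CategoryTheory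
open scoped ENNReal

set_option linter.unusedSectionVars false

noncomputable section

/-! ## Upper semicontinuous `C*`-bundles -/

/-- The total space of a family of fibres. -/
structure Tot {X : Type*} (A : X → Type*) where
  base : X
  val : A base

/-- The fibre product of the total space with itself over the base space. -/
structure Tot2 {X : Type*} (A : X → Type*) where
  base : X
  fst : A base
  snd : A base

/-- The fibre product has the topology of a subspace of the product. -/
instance {X : Type*} (A : X → Type*) [TopologicalSpace (Tot A)] : TopologicalSpace (Tot2 A) :=
  TopologicalSpace.induced (fun p => ((⟨p.base, p.fst⟩ : Tot A), (⟨p.base, p.snd⟩ : Tot A)))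
    inferInstance

/-- Upper semicontinuous `C*`-bundles over `X` (Dupré and Gillette): a topology on the disjoint
union of the `C*`-algebras `A u`, `u ∈ X`, such that the projection is continuous and open, the norm
is upper semicontinuous, the algebraic operations are continuous, and `a_i → 0_u` whenever the base
points of `a_i` converge to `u` and `‖a_i‖ → 0`. -/
class USCBundle {X : Type*} [TopologicalSpace X] (A : X → Type*) [∀ u, NonUnitalCStarAlgebra (A u)]
    [TopologicalSpace (Tot A)] : Prop where
  continuous_base : Continuous (Tot.base : Tot A → X)
  isOpenMap_base : IsOpenMap (Tot.base : Tot A → X)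
  upperSemicontinuous_norm : UpperSemicontinuous fun a : Tot A => ‖a.val‖
  continuous_add : Continuous fun p : Tot2 A => (⟨p.base, p.fst + p.snd⟩ : Tot A)
  continuous_mul : Continuous fun p : Tot2 A => (⟨p.base, p.fst * p.snd⟩ : Tot A)
  continuous_smul : ∀ c : ℂ, Continuous fun a : Tot A => (⟨a.base, c • a.val⟩ : Tot A)
  continuous_star : Continuous fun a : Tot A => (⟨a.base, star a.val⟩ : Tot A)
  le_nhds_zero : ∀ u : X,
    comap (Tot.base : Tot A → X) (𝓝 u) ⊓ comap (fun a : Tot A => ‖a.val‖) (𝓝 0) ≤ 𝓝 ⟨u, 0⟩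

section Bundle

variable {X : Type*} [TopologicalSpace X] {A : X → Type*} [∀ u, NonUnitalCStarAlgebra (A u)]
  [TopologicalSpace (Tot A)] [USCBundle A]

namespace USCBundle

variable {ι : Type*} {l : Filter ι} {q : ι → X} {f g : ∀ i, A (q i)} {u : X} {a b : A u}

theorem tendsto_base (hf : Tendsto (fun i => (⟨q i, f i⟩ : Tot A)) l (𝓝 ⟨u, a⟩)) :
    Tendsto q l (𝓝 u) :=
  (continuous_base.tendsto (⟨u, a⟩ : Tot A)).comp hf

theorem tendsto_zero (hq : Tendsto q l (𝓝 u)) (hf : Tendsto (fun i => ‖f i‖) l (𝓝 0)) :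
    Tendsto (fun i => (⟨q i, f i⟩ : Tot A)) l (𝓝 ⟨u, 0⟩) := by
  refine Tendsto.mono_right ?_ (le_nhds_zero u)
  rw [tendsto_inf, tendsto_comap_iff, tendsto_comap_iff]
  exact ⟨hq, hf⟩

theorem tendsto_pair (hf : Tendsto (fun i => (⟨q i, f i⟩ : Tot A)) l (𝓝 ⟨u, a⟩))
    (hg : Tendsto (fun i => (⟨q i, g i⟩ : Tot A)) l (𝓝 ⟨u, b⟩)) :
    Tendsto (fun i => (⟨q i, f i, g i⟩ : Tot2 A)) l (𝓝 ⟨u, a, b⟩) := by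
  rw [nhds_induced, tendsto_comap_iff]
  exact hf.prodMk_nhds hg

theorem tendsto_add (hf : Tendsto (fun i => (⟨q i, f i⟩ : Tot A)) l (𝓝 ⟨u, a⟩))
    (hg : Tendsto (fun i => (⟨q i, g i⟩ : Tot A)) l (𝓝 ⟨u, b⟩)) :
    Tendsto (fun i => (⟨q i, f i + g i⟩ : Tot A)) l (𝓝 ⟨u, a + b⟩) :=
  (continuous_add.tendsto (⟨u, a, b⟩ : Tot2 A)).comp (tendsto_pair hf hg)

theorem tendsto_mul (hf : Tendsto (fun i => (⟨q i, f i⟩ : Tot A)) l (𝓝 ⟨u, a⟩))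
    (hg : Tendsto (fun i => (⟨q i, g i⟩ : Tot A)) l (𝓝 ⟨u, b⟩)) :
    Tendsto (fun i => (⟨q i, f i * g i⟩ : Tot A)) l (𝓝 ⟨u, a * b⟩) :=
  (continuous_mul.tendsto (⟨u, a, b⟩ : Tot2 A)).comp (tendsto_pair hf hg)

theorem tendsto_star (hf : Tendsto (fun i => (⟨q i, f i⟩ : Tot A)) l (𝓝 ⟨u, a⟩)) :
    Tendsto (fun i => (⟨q i, star (f i)⟩ : Tot A)) l (𝓝 ⟨u, star a⟩) :=
  (continuous_star.tendsto (⟨u, a⟩ : Tot A)).comp hf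

theorem tendsto_const_smul (c : ℂ) (hf : Tendsto (fun i => (⟨q i, f i⟩ : Tot A)) l (𝓝 ⟨u, a⟩)) :
    Tendsto (fun i => (⟨q i, c • f i⟩ : Tot A)) l (𝓝 ⟨u, c • a⟩) :=
  ((continuous_smul c).tendsto (⟨u, a⟩ : Tot A)).comp hf

theorem eventually_norm_lt (hf : Tendsto (fun i => (⟨q i, f i⟩ : Tot A)) l (𝓝 ⟨u, a⟩)) {M : ℝ}
    (hM : ‖a‖ < M) : ∀ᶠ i in l, ‖f i‖ < M :=
  hf.eventually (upperSemicontinuous_norm (A := A) ⟨u, a⟩ M hM)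

theorem tendsto_smul {c : ι → ℂ} {c₀ : ℂ} (hc : Tendsto c l (𝓝 c₀))
    (hf : Tendsto (fun i => (⟨q i, f i⟩ : Tot A)) l (𝓝 ⟨u, a⟩)) :
    Tendsto (fun i => (⟨q i, c i • f i⟩ : Tot A)) l (𝓝 ⟨u, c₀ • a⟩) := by
  have h1 := tendsto_const_smul c₀ hf
  have h2 : Tendsto (fun i => ‖(c i - c₀) • f i‖) l (𝓝 0) := by
    have h3 : Tendsto (fun i => ‖c i - c₀‖ * (‖a‖ + 1)) l (𝓝 0) := by
      have := (tendsto_iff_norm_sub_tendsto_zero.1 hc).mul_const (‖a‖ + 1)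
      simpa using this
    refine squeeze_zero' (Eventually.of_forall fun i => norm_nonneg _) ?_ h3
    filter_upwards [eventually_norm_lt hf (lt_add_one ‖a‖)] with i hi
    rw [norm_smul]
    exact mul_le_mul_of_nonneg_left hi.le (norm_nonneg _)
  have h4 := tendsto_add h1 (tendsto_zero (tendsto_base hf) h2)
  simpa [← add_smul] using h4

variable {Y : Type*} [TopologicalSpace Y] {p : Y → X} {F : ∀ y, A (p y)}

theorem isClosed_norm_ge (hF : Continuous fun y => (⟨p y, F y⟩ : Tot A)) (ε : ℝ) :
    IsClosed {y | ε ≤ ‖F y‖} := by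
  rw [← isOpen_compl_iff, isOpen_iff_mem_nhds]
  intro y hy
  simp only [Set.mem_compl_iff, Set.mem_ofPred_eq, not_le] at hy
  filter_upwards [eventually_norm_lt (hF.tendsto y) hy] with z hz
  simpa using hz

theorem continuous_zero (hp : Continuous p) :
    Continuous fun y => (⟨p y, (0 : A (p y))⟩ : Tot A) := by
  rw [continuous_iff_continuousAt]
  intro y
  exact tendsto_zero (hp.tendsto y) (by simp)

end USCBundle

open USCBundle

variable (A) in
/-- The continuous sections vanishing at infinity, as a `*`-subalgebra of the `C*`-algebra of all
bounded families with the supremum norm. Such sections are automatically bounded, see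
`Gamma0.mk`. -/
def gamma0Sub : NonUnitalStarSubalgebra ℂ (lp A ∞) where
  carrier := {f | Continuous (fun u => (⟨u, f u⟩ : Tot A)) ∧
    ∀ ε : ℝ, 0 < ε → IsCompact {u | ε ≤ ‖f u‖}}
  zero_mem' := by
    refine ⟨continuous_zero (A := A) continuous_id, fun ε hε => ?_⟩
    have : {u : X | ε ≤ ‖(0 : lp A ∞) u‖} = ∅ := by
      ext u; simp [hε]
    rw [this]; exact isCompact_empty
  add_mem' := by
    rintro f g ⟨hf, hf'⟩ ⟨hg, hg'⟩
    have hc : Continuous (fun u => (⟨u, f u + g u⟩ : Tot A)) :=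
      continuous_iff_continuousAt.2 fun u => tendsto_add (hf.tendsto u) (hg.tendsto u)
    refine ⟨hc, fun ε hε => ?_⟩
    refine ((hf' (ε / 2) (half_pos hε)).union (hg' (ε / 2) (half_pos hε))).of_isClosed_subset
      (isClosed_norm_ge hc ε) ?_
    intro u hu
    simp only [Set.mem_ofPred_eq, Set.mem_union] at hu ⊢
    by_contra! h
    have h2 : ε ≤ ‖f u + g u‖ := hu
    have := norm_add_le (f u) (g u)
    linarith [h.1, h.2]
  mul_mem' := by
    rintro f g ⟨hf, hf'⟩ ⟨hg, hg'⟩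
    have hc : Continuous (fun u => (⟨u, f u * g u⟩ : Tot A)) :=
      continuous_iff_continuousAt.2 fun u => tendsto_mul (hf.tendsto u) (hg.tendsto u)
    refine ⟨hc, fun ε hε => ?_⟩
    have hM : 0 < ‖g‖ + 1 := by positivity
    refine (hf' (ε / (‖g‖ + 1)) (div_pos hε hM)).of_isClosed_subset
      (isClosed_norm_ge hc ε) ?_
    intro u hu
    simp only [Set.mem_ofPred_eq] at hu ⊢
    rw [div_le_iff₀ hM]
    refine hu.trans ((norm_mul_le _ _).trans ?_)
    refine mul_le_mul_of_nonneg_left ?_ (norm_nonneg _)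
    exact (lp.norm_apply_le_norm ENNReal.top_ne_zero g u).trans (by linarith)
  smul_mem' := by
    rintro c f ⟨hf, hf'⟩
    have hc : Continuous (fun u => (⟨u, c • f u⟩ : Tot A)) :=
      continuous_iff_continuousAt.2 fun u => tendsto_const_smul c (hf.tendsto u)
    refine ⟨hc, fun ε hε => ?_⟩
    have hM : 0 < ‖c‖ + 1 := by positivity
    refine (hf' (ε / (‖c‖ + 1)) (div_pos hε hM)).of_isClosed_subset
      (isClosed_norm_ge hc ε) ?_
    intro u hu
    simp only [Set.mem_ofPred_eq] at hu ⊢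
    rw [div_le_iff₀ hM]
    have h2 : ε ≤ ‖c • f u‖ := hu
    rw [norm_smul] at h2
    nlinarith [norm_nonneg (f u)]
  star_mem' := by
    rintro f ⟨hf, hf'⟩
    refine ⟨continuous_iff_continuousAt.2 fun u => tendsto_star (hf.tendsto u), fun ε hε => ?_⟩
    simpa using hf' ε hε

theorem lp_norm_apply_le (f : lp A ∞) (u : X) : ‖f u‖ ≤ ‖f‖ :=
  lp.norm_apply_le_norm ENNReal.top_ne_zero f u

/-- `Γ_0(𝒜)` is complete. -/
instance isClosed_gamma0Sub : IsClosed (gamma0Sub A : Set (lp A ∞)) := by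
  rw [← closure_subset_iff_isClosed]
  intro f hf
  rw [Metric.mem_closure_iff] at hf
  have hf' : ∀ ε : ℝ, 0 < ε → ∃ g ∈ gamma0Sub A, ∀ u, ‖f u - g u‖ < ε := by
    intro ε hε
    obtain ⟨g, hg, hd⟩ := hf ε hε
    refine ⟨g, hg, fun u => lt_of_le_of_lt ?_ hd⟩
    rw [dist_eq_norm]
    exact lp_norm_apply_le (f - g) u
  have hc : Continuous fun u => (⟨u, f u⟩ : Tot A) := by
    rw [continuous_iff_continuousAt]
    intro u
    rw [ContinuousAt, tendsto_def]
    intro V hV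
    -- neighbourhoods of `f u` and of `0_u` whose sum lies in `V`
    have h1 : Tendsto (fun p : Tot2 A => (⟨p.base, p.fst + p.snd⟩ : Tot A))
        (𝓝 ⟨u, f u, 0⟩) (𝓝 ⟨u, f u + 0⟩) := continuous_add.tendsto (⟨u, f u, 0⟩ : Tot2 A)
    rw [add_zero] at h1
    have h2 := h1 hV
    rw [nhds_induced] at h2
    obtain ⟨W, hW, hWV⟩ := h2
    rw [nhds_prod_eq] at hW
    obtain ⟨W₁, hW₁, W₂, hW₂, hW⟩ := mem_prod_iff.1 hW
    have h3 := le_nhds_zero (A := A) u hW₂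
    obtain ⟨P, ⟨P', hP', hPP⟩, Q, ⟨Q', hQ', hQQ⟩, hPQ⟩ := mem_inf_iff.1 h3
    obtain ⟨ε, hε, hQε⟩ := Metric.mem_nhds_iff.1 hQ'
    have hsmall : ∀ (v : X) (a : A v), v ∈ P' → ‖a‖ < ε → (⟨v, a⟩ : Tot A) ∈ W₂ := by
      intro v a hv ha
      rw [hPQ]
      exact ⟨hPP hv, hQQ (hQε (by simpa using ha))⟩
    -- approximants converge in the fibre
    have h4 : ∃ g ∈ gamma0Sub A, (∀ v, ‖f v - g v‖ < ε) ∧ W₁ ∈ 𝓝 (⟨u, g u⟩ : Tot A) := by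
      have hg : ∀ n : ℕ, ∃ g ∈ gamma0Sub A, ∀ v, ‖f v - g v‖ < 1 / ((n : ℝ) + 1) := fun n =>
        hf' _ (by positivity)
      choose g hg1 hg2 using hg
      have h5 : Tendsto (fun n => ‖g n u - f u‖) atTop (𝓝 0) := by
        refine squeeze_zero (fun _ => norm_nonneg _) (fun n => ?_)
          tendsto_one_div_add_atTop_nhds_zero_nat
        rw [norm_sub_rev]
        exact (hg2 n u).le
      have hcst : Tendsto (fun _ : ℕ => (⟨u, f u⟩ : Tot A)) atTop (𝓝 ⟨u, f u⟩) :=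
        tendsto_const_nhds
      have h6 : Tendsto (fun n : ℕ => (⟨u, f u + (g n u - f u)⟩ : Tot A)) atTop
          (𝓝 ⟨u, f u + 0⟩) := tendsto_add hcst (tendsto_zero tendsto_const_nhds h5)
      simp only [add_sub_cancel, add_zero] at h6
      have h7 := tendsto_one_div_add_atTop_nhds_zero_nat.eventually (gt_mem_nhds hε)
      obtain ⟨n, hn1, hn2⟩ := ((h6.eventually (eventually_mem_nhds_iff.2 hW₁)).and h7).exists
      exact ⟨g n, hg1 n, fun v => (hg2 n v).trans hn2, hn1⟩
    obtain ⟨g, hg, hfg, hgu⟩ := h4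
    filter_upwards [(hg.1.tendsto u) hgu, hP'] with v hv1 hv2
    have h8 := hW (Set.mk_mem_prod hv1 (hsmall v (f v - g v) hv2 (hfg v)))
    have h9 : (⟨v, g v, f v - g v⟩ : Tot2 A) ∈ _ := hWV h8
    simpa using h9
  refine ⟨hc, fun ε hε => ?_⟩
  obtain ⟨g, hg, hfg⟩ := hf' (ε / 2) (half_pos hε)
  refine (hg.2 (ε / 2) (half_pos hε)).of_isClosed_subset (isClosed_norm_ge hc ε) ?_
  intro u hu
  simp only [Set.mem_ofPred_eq] at hu ⊢
  have h1 := hfg u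
  have h2 : ‖f u‖ ≤ ‖f u - g u‖ + ‖g u‖ := by
    simpa using norm_add_le (f u - g u) (g u)
  linarith

variable (A) in
/-- The `C*`-algebra `Γ_0(𝒜)` of continuous sections vanishing at infinity, with the supremum
norm. -/
def Gamma0 : Type _ := gamma0Sub A

namespace Gamma0

instance : NonUnitalCStarAlgebra (Gamma0 A) :=
  inferInstanceAs (NonUnitalCStarAlgebra (gamma0Sub A))

instance : DFunLike (Gamma0 A) X A where
  coe f := f.1.1
  coe_injective _ _ h := Subtype.ext (lp.ext h)

@[simp] theorem zero_apply (u : X) : (0 : Gamma0 A) u = 0 := rfl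
@[simp] theorem add_apply (f g : Gamma0 A) (u : X) : (f + g) u = f u + g u := rfl
@[simp] theorem sub_apply (f g : Gamma0 A) (u : X) : (f - g) u = f u - g u := rfl
@[simp] theorem mul_apply (f g : Gamma0 A) (u : X) : (f * g) u = f u * g u := rfl
@[simp] theorem smul_apply (c : ℂ) (f : Gamma0 A) (u : X) : (c • f) u = c • f u := rfl
@[simp] theorem star_apply (f : Gamma0 A) (u : X) : (star f) u = star (f u) := rfl

theorem norm_apply_le (f : Gamma0 A) (u : X) : ‖f u‖ ≤ ‖f‖ := lp_norm_apply_le f.1 u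

theorem norm_le_of_forall_le (f : Gamma0 A) {M : ℝ} (hM : 0 ≤ M) (h : ∀ u, ‖f u‖ ≤ M) : ‖f‖ ≤ M :=
  lp.norm_le_of_forall_le hM h


theorem continuous (f : Gamma0 A) : Continuous fun u => (⟨u, f u⟩ : Tot A) := f.2.1

theorem isCompact_norm_ge (f : Gamma0 A) {ε : ℝ} (hε : 0 < ε) :
    IsCompact {u | ε ≤ ‖f u‖} := f.2.2 ε hε

/-- Every continuous section vanishing at infinity is an element of `Γ_0(𝒜)`. -/
def mk (f : ∀ u, A u) (hc : Continuous fun u => (⟨u, f u⟩ : Tot A))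
    (hf : ∀ ε : ℝ, 0 < ε → IsCompact {u | ε ≤ ‖f u‖}) : Gamma0 A :=
  ⟨⟨f, memℓp_infty (by
    have husc : UpperSemicontinuousOn (fun u => ‖f u‖) {u | 1 ≤ ‖f u‖} := by
      intro u _ M hM
      exact (eventually_norm_lt (hc.tendsto u) hM).filter_mono nhdsWithin_le_nhds
    obtain ⟨M, hM⟩ := husc.bddAbove_of_isCompact (hf 1 one_pos)
    refine ⟨max M 1, ?_⟩
    rintro _ ⟨u, rfl⟩
    by_cases h : 1 ≤ ‖f u‖
    · exact (hM ⟨u, h, rfl⟩).trans (le_max_left _ _)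
    · exact (not_le.1 h).le.trans (le_max_right _ _))⟩, hc, hf⟩

@[simp] theorem mk_apply (f : ∀ u, A u) (hc hf) (u : X) :
    (mk f hc hf : Gamma0 A) u = f u := rfl

theorem ext {f g : Gamma0 A} (h : ∀ u, f u = g u) : f = g :=
  DFunLike.ext f g h

/-- The ideal `{f ∈ Γ_0(𝒜) : f = 0 off V}`. -/
def vanishing (V : Set X) : NonUnitalStarSubalgebra ℂ (Gamma0 A) where
  carrier := {f | ∀ u, u ∉ V → f u = 0}
  zero_mem' _ _ := rfl
  add_mem' {f g} hf hg u hu := by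
    rw [add_apply, hf u hu, hg u hu, add_zero]
  mul_mem' {f g} hf hg u hu := by
    rw [mul_apply, hf u hu, zero_mul]
  smul_mem' c f hf u hu := by
    rw [smul_apply, hf u hu, smul_zero]
  star_mem' {f} hf u hu := by
    rw [star_apply, hf u hu, star_zero]

theorem mem_vanishing {V : Set X} {f : Gamma0 A} :
    f ∈ vanishing V ↔ ∀ u, u ∉ V → f u = 0 := Iff.rfl

theorem vanishing_isClosedIdeal (V : Set X) :
    IsClosedIdeal (vanishing V : NonUnitalStarSubalgebra ℂ (Gamma0 A)) where
  isClosed := by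
    rw [← closure_subset_iff_isClosed]
    intro f hf u hu
    rw [Metric.mem_closure_iff] at hf
    by_contra h
    obtain ⟨g, hg, hd⟩ := hf ‖f u‖ (norm_pos_iff.2 h)
    have h1 := norm_apply_le (f - g) u
    rw [sub_apply, hg u hu, sub_zero] at h1
    rw [dist_eq_norm] at hd
    exact absurd hd (not_lt.2 h1)
  mul_mem_left f {g} hg u hu := by
    rw [mul_apply, hg u hu, mul_zero]
  mul_mem_right {f} g hf u hu := by
    rw [mul_apply, hf u hu, zero_mul]

/-- Multiplication of a section by a continuous function with values in `[0, 1]`. -/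
theorem exists_cutoff (f : Gamma0 A) (φ : C(X, ℝ)) (hφ : ∀ u, φ u ∈ Set.Icc (0 : ℝ) 1) :
    ∃ g : Gamma0 A, ∀ u, g u = (φ u : ℂ) • f u := by
  have hc : Continuous fun u => (⟨u, (φ u : ℂ) • f u⟩ : Tot A) :=
    continuous_iff_continuousAt.2 fun u =>
      tendsto_smul ((Complex.continuous_ofReal.comp φ.continuous).tendsto u)
        (f.continuous.tendsto u)
  refine ⟨mk (fun u => (φ u : ℂ) • f u) hc fun ε hε => ?_, fun u => rfl⟩
  refine (f.isCompact_norm_ge hε).of_isClosed_subset (isClosed_norm_ge hc ε) ?_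
  intro u hu
  simp only [Set.mem_ofPred_eq] at hu ⊢
  refine hu.trans ?_
  rw [norm_smul, Complex.norm_real, Real.norm_of_nonneg (hφ u).1]
  exact mul_le_of_le_one_left (norm_nonneg _) (hφ u).2

end Gamma0

end Bundle

/-! ## Groupoid actions and the associated inverse semigroup actions -/

/-- The pull-back `d^*𝒜 = {(x, a) : a ∈ A_{d(x)}}`. -/
structure SrcPullback {X : Type*} [Quiver X] (A : X → Type*) where
  src : X
  tgt : X
  hom : src ⟶ tgt
  val : A src

/-- `d^*𝒜` has the topology of a subspace of `G × 𝒜`. -/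
instance {X : Type*} [Quiver X] (A : X → Type*) [TopologicalSpace (Arr X)]
    [TopologicalSpace (Tot A)] : TopologicalSpace (SrcPullback A) :=
  TopologicalSpace.induced
    (fun p => ((⟨p.src, p.tgt, p.hom⟩ : Arr X), (⟨p.src, p.val⟩ : Tot A))) inferInstance

section Action

variable {X : Type*} [Groupoid X] [TopologicalSpace X] [TopologicalSpace (Arr X)]

/-- An action of the groupoid `G` on the bundle `𝒜`: a functor `x ↦ α_x : A_{d(x)} → A_{r(x)}` into
`C*`-algebras and `*`-homomorphisms such that `(x, a) ↦ α_x(a)` is a continuous map from `d^*𝒜`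
to `𝒜`. -/
structure GroupoidAction (A : X → Type*) [∀ u, NonUnitalCStarAlgebra (A u)]
    [TopologicalSpace (Tot A)] where
  map : ∀ {u v : X}, (u ⟶ v) → (A u →⋆ₙₐ[ℂ] A v)
  map_id : ∀ (u : X) (a : A u), map (𝟙 u) a = a
  map_comp : ∀ {u v w : X} (y : u ⟶ v) (x : v ⟶ w) (a : A u), map (y ≫ x) a = map x (map y a)
  continuous : Continuous fun p : SrcPullback A => (⟨p.tgt, map p.hom p.val⟩ : Tot A)

variable [RDiscreteGroupoid X] {A : X → Type*} [∀ u, NonUnitalCStarAlgebra (A u)]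
  [TopologicalSpace (Tot A)] [USCBundle A] (α : GroupoidAction A)

open USCBundle RDiscreteGroupoid

namespace GroupoidAction

@[simp] theorem map_inv_map {u v : X} (x : u ⟶ v) (a : A u) :
    α.map (Groupoid.inv x) (α.map x a) = a := by
  rw [← α.map_comp, Groupoid.comp_inv, α.map_id]

@[simp] theorem map_map_inv {u v : X} (x : u ⟶ v) (a : A v) :
    α.map x (α.map (Groupoid.inv x) a) = a := by
  rw [← α.map_comp, Groupoid.inv_comp, α.map_id]

theorem norm_map {u v : X} (x : u ⟶ v) (a : A u) : ‖α.map x a‖ = ‖a‖ := by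
  refine le_antisymm (NonUnitalStarAlgHom.norm_apply_le _ a) ?_
  have h := NonUnitalStarAlgHom.norm_apply_le (α.map (Groupoid.inv x)) (α.map x a)
  rwa [α.map_inv_map] at h

theorem tendsto_map {ι : Type*} {l : Filter ι} {x : ι → Arr X} {x₀ : Arr X}
    {f : ∀ i, A (x i).src} {a : A x₀.src} (hx : Tendsto x l (𝓝 x₀))
    (hf : Tendsto (fun i => (⟨(x i).src, f i⟩ : Tot A)) l (𝓝 ⟨x₀.src, a⟩)) :
    Tendsto (fun i => (⟨(x i).tgt, α.map (x i).hom (f i)⟩ : Tot A)) l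
      (𝓝 ⟨x₀.tgt, α.map x₀.hom a⟩) := by
  have h : Tendsto (fun i => (⟨(x i).src, (x i).tgt, (x i).hom, f i⟩ : SrcPullback A)) l
      (𝓝 ⟨x₀.src, x₀.tgt, x₀.hom, a⟩) := by
    rw [nhds_induced, tendsto_comap_iff]
    exact hx.prodMk_nhds hf
  exact (α.continuous.tendsto (⟨x₀.src, x₀.tgt, x₀.hom, a⟩ : SrcPullback A)).comp h

/-- The arrows with range `v`. -/
abbrev Into (v : X) : Type _ := Σ u : X, (u ⟶ v)

/-- An arrow with range `v`, as an element of `G`. -/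
abbrev Into.arr {v : X} (y : Into v) : Arr X := ⟨y.1, v, y.2⟩

open Classical in
/-- The section `v ↦ α_{vs}(f(s^*vs))` for `v ∈ r(s)`, and `0` elsewhere; here `vs` is the unique
arrow `x ∈ s` with `r(x) = v`, and `s^*vs = d(x)`. -/
def transport (s : OpenBisection X) (f : ∀ u, A u) (v : X) : A v :=
  if h : ∃ y : Into v, y.arr ∈ s.carrier then α.map h.choose.2 (f h.choose.1) else 0

theorem transport_of_mem (s : OpenBisection X) (f : ∀ u, A u) {u v : X} {x : u ⟶ v}
    (hx : (⟨u, v, x⟩ : Arr X) ∈ s.carrier) : α.transport s f v = α.map x (f u) := by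
  have h : ∃ y : Into v, y.arr ∈ s.carrier := ⟨⟨u, x⟩, hx⟩
  rw [transport, dif_pos h]
  have h2 := s.tgt_injOn h.choose_spec hx rfl
  have h3 : h.choose = ⟨u, x⟩ := by
    generalize h.choose = y at h2
    obtain ⟨w, y⟩ := y
    cases h2
    rfl
  rw [h3]

theorem transport_of_notMem (s : OpenBisection X) (f : ∀ u, A u) {v : X} (hv : v ∉ s.rSet) :
    α.transport s f v = 0 := by
  rw [transport, dif_neg]
  rintro ⟨y, hy⟩
  exact hv ⟨_, hy, rfl⟩

theorem transport_norm_set (s : OpenBisection X) (f : Gamma0 A)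
    (hf : f ∈ Gamma0.vanishing s.dSet) {ε : ℝ} (hε : 0 < ε) :
    IsCompact {v | ε ≤ ‖α.transport s f v‖} := by
  have h0 : IsLocalHomeomorph (Arr.src ∘ (Subtype.val : s.carrier → Arr X)) :=
    isLocalHomeomorph_src.comp s.isOpen.isOpenEmbedding_subtypeVal.isLocalHomeomorph
  have h1 := h0.isOpenEmbedding_of_injective (s.src_injOn.injective)
  have h2 : IsCompact ((Arr.src ∘ (Subtype.val : s.carrier → Arr X)) ⁻¹' {u | ε ≤ ‖f u‖}) := by
    refine h1.isInducing.isCompact_preimage' (f.isCompact_norm_ge hε) ?_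
    intro u hu
    have : u ∈ s.dSet := by
      by_contra hu'
      simp only [Set.mem_ofPred_eq] at hu
      rw [hf u hu', norm_zero] at hu
      exact absurd hε (not_lt.2 hu)
    obtain ⟨x, hx, rfl⟩ := this
    exact ⟨⟨x, hx⟩, rfl⟩
  have h3 := h2.image (continuous_tgt.comp continuous_subtype_val)
  convert h3 using 1
  ext v
  constructor
  · intro hv
    simp only [Set.mem_ofPred_eq] at hv
    have : v ∈ s.rSet := by
      by_contra hv'
      rw [α.transport_of_notMem s f hv', norm_zero] at hv
      exact absurd hε (not_lt.2 hv)
    obtain ⟨⟨u, v', x⟩, hx, rfl⟩ := this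
    rw [α.transport_of_mem s f hx, α.norm_map] at hv
    exact ⟨⟨_, hx⟩, hv, rfl⟩
  · rintro ⟨⟨⟨u, v', x⟩, hx⟩, hv, rfl⟩
    simp only [Set.mem_ofPred_eq, Function.comp_apply]
    rw [α.transport_of_mem s f hx, α.norm_map]
    exact hv

theorem transport_continuous (s : OpenBisection X) (f : Gamma0 A)
    (hf : f ∈ Gamma0.vanishing s.dSet) :
    Continuous fun v => (⟨v, α.transport s f v⟩ : Tot A) := by
  rw [continuous_iff_continuousAt]
  intro v
  by_cases hv : v ∈ s.rSet
  · have hN := s.isOpen_rSet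
    rw [ContinuousAt, ← hN.isOpenEmbedding_subtypeVal.map_nhds_eq ⟨v, hv⟩, tendsto_map'_iff]
    have hex : ∀ w : s.rSet, ∃ y : Arr X, y ∈ s.carrier ∧ y.tgt = w := by
      rintro ⟨w, y, hy, rfl⟩; exact ⟨y, hy, rfl⟩
    choose y hy1 hy2 using hex
    have T1 : Tendsto y (𝓝 ⟨v, hv⟩) (𝓝 (y ⟨v, hv⟩)) := by
      refine s.tendsto_of_tgt hy1 (hy1 _) ?_
      simp only [hy2]
      exact continuous_subtype_val.tendsto _
    have T2 := α.tendsto_map T1 ((f.continuous.tendsto _).comp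
      ((continuous_src.tendsto _).comp T1))
    have e : ∀ w : s.rSet, (⟨(y w).tgt, α.map (y w).hom (f (y w).src)⟩ : Tot A) =
        ⟨w, α.transport s f w⟩ := by
      intro w
      rw [← α.transport_of_mem s f (x := (y w).hom) (hy1 w), hy2 w]
    have T3 : Tendsto (fun w => (⟨(y w).tgt, α.map (y w).hom (f (y w).src)⟩ : Tot A))
      (𝓝 (⟨v, hv⟩ : s.rSet))
      (𝓝 ⟨(y ⟨v, hv⟩).tgt, α.map (y ⟨v, hv⟩).hom (f (y ⟨v, hv⟩).src)⟩) := T2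
    simp only [e] at T3
    exact T3
  · rw [ContinuousAt, α.transport_of_notMem s f hv]
    refine tendsto_zero tendsto_id ?_
    rw [Metric.tendsto_nhds]
    intro ε hε
    have hcl := (α.transport_norm_set s f hf hε).isClosed
    have : v ∈ {v | ε ≤ ‖α.transport s f v‖}ᶜ := by
      simp [α.transport_of_notMem s f hv, hε]
    filter_upwards [hcl.isOpen_compl.mem_nhds this] with w hw
    simpa using hw

/-- `β_s(f)` for `f ∈ B_{d(s)}`. -/
def betaFun (s : OpenBisection X)
    (f : (Gamma0.vanishing s.dSet : NonUnitalStarSubalgebra ℂ (Gamma0 A))) :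
    (Gamma0.vanishing s.rSet : NonUnitalStarSubalgebra ℂ (Gamma0 A)) :=
  ⟨Gamma0.mk (α.transport s f.1) (α.transport_continuous s f.1 f.2)
    (fun _ => α.transport_norm_set s f.1 f.2), fun _ hv => α.transport_of_notMem s _ hv⟩

theorem betaFun_of_mem (s : OpenBisection X)
    (f : (Gamma0.vanishing s.dSet : NonUnitalStarSubalgebra ℂ (Gamma0 A))) {u v : X} {x : u ⟶ v}
    (hx : (⟨u, v, x⟩ : Arr X) ∈ s.carrier) : (α.betaFun s f).1 v = α.map x (f.1 u) :=
  α.transport_of_mem s f.1 hx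

theorem ext_rSet {s : OpenBisection X}
    {f g : (Gamma0.vanishing s.rSet : NonUnitalStarSubalgebra ℂ (Gamma0 A))}
    (h : ∀ (u v : X) (x : u ⟶ v), (⟨u, v, x⟩ : Arr X) ∈ s.carrier → f.1 v = g.1 v) : f = g := by
  refine Subtype.ext (Gamma0.ext fun v => ?_)
  by_cases hv : v ∈ s.rSet
  · obtain ⟨⟨u, v, x⟩, hx, rfl⟩ := hv
    exact h u v x hx
  · rw [f.2 v hv, g.2 v hv]

theorem ext_dSet {s : OpenBisection X}
    {f g : (Gamma0.vanishing s.dSet : NonUnitalStarSubalgebra ℂ (Gamma0 A))}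
    (h : ∀ (u v : X) (x : u ⟶ v), (⟨u, v, x⟩ : Arr X) ∈ s.carrier → f.1 u = g.1 u) : f = g := by
  refine Subtype.ext (Gamma0.ext fun v => ?_)
  by_cases hv : v ∈ s.dSet
  · obtain ⟨⟨u, v, x⟩, hx, rfl⟩ := hv
    exact h u v x hx
  · rw [f.2 v hv, g.2 v hv]

theorem rSet_star (s : OpenBisection X) : (star s).rSet = s.dSet := by
  ext u
  constructor
  · rintro ⟨x, hx, rfl⟩; exact ⟨x.inv, hx, rfl⟩
  · rintro ⟨x, hx, rfl⟩
    exact ⟨x.inv, by rw [OpenBisection.mem_star, Arr.inv_inv]; exact hx, rfl⟩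

theorem dSet_star (s : OpenBisection X) : (star s).dSet = s.rSet := by
  rw [← rSet_star, star_star]

/-- The partial automorphism `β_s` of `Γ_0(𝒜)`: the isomorphism from `B_{d(s)}` onto `B_{r(s)}` with
`β_s(f)(r(x)) = α_x(f(d(x)))` for `x ∈ s`. -/
def beta (s : OpenBisection X) : PartialAut (Gamma0 A) where
  dom := Gamma0.vanishing s.dSet
  ran := Gamma0.vanishing s.rSet
  dom_ideal := Gamma0.vanishing_isClosedIdeal _
  ran_ideal := Gamma0.vanishing_isClosedIdeal _
  equiv :=
    { toFun := α.betaFun s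
      invFun := fun g => ⟨(α.betaFun (star s) ⟨g.1, by rw [dSet_star]; exact g.2⟩).1, by
        rw [← rSet_star]; exact (α.betaFun (star s) _).2⟩
      left_inv := fun f => ext_dSet fun u v x hx => by
        have hx' : (⟨v, u, Groupoid.inv x⟩ : Arr X) ∈ (star s).carrier := by
          simpa [OpenBisection.mem_star, Arr.inv] using hx
        change (α.betaFun (star s) ⟨(α.betaFun s f).1, _⟩).1 u = _
        rw [α.betaFun_of_mem (star s) _ hx', α.betaFun_of_mem s f hx, α.map_inv_map]
      right_inv := fun g => ext_rSet fun u v x hx => by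
        have hx' : (⟨v, u, Groupoid.inv x⟩ : Arr X) ∈ (star s).carrier := by
          simpa [OpenBisection.mem_star, Arr.inv] using hx
        rw [α.betaFun_of_mem s _ hx]
        change α.map x ((α.betaFun (star s) ⟨g.1, _⟩).1 u) = _
        rw [α.betaFun_of_mem (star s) _ hx', α.map_map_inv]
      map_mul' := fun f g => ext_rSet fun u v x hx => by
        change _ = (α.betaFun s f).1 v * (α.betaFun s g).1 v
        rw [α.betaFun_of_mem s _ hx, α.betaFun_of_mem s _ hx, α.betaFun_of_mem s _ hx]
        exact map_mul (α.map x) (f.1 u) (g.1 u)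
      map_add' := fun f g => ext_rSet fun u v x hx => by
        change _ = (α.betaFun s f).1 v + (α.betaFun s g).1 v
        rw [α.betaFun_of_mem s _ hx, α.betaFun_of_mem s _ hx, α.betaFun_of_mem s _ hx]
        exact map_add (α.map x) (f.1 u) (g.1 u)
      map_star' := fun f => ext_rSet fun u v x hx => by
        change _ = star ((α.betaFun s f).1 v)
        rw [α.betaFun_of_mem s _ hx, α.betaFun_of_mem s _ hx]
        exact map_star (α.map x) (f.1 u)
      map_smul' := fun c f => ext_rSet fun u v x hx => by
        change _ = c • ((α.betaFun s f).1 v)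
        rw [α.betaFun_of_mem s _ hx, α.betaFun_of_mem s _ hx]
        exact map_smul (α.map x) c (f.1 u) }

theorem beta_rel_iff {s : OpenBisection X} {f g : Gamma0 A} : (α.beta s).Rel f g ↔
    f ∈ Gamma0.vanishing s.dSet ∧ g ∈ Gamma0.vanishing s.rSet ∧
      ∀ (u v : X) (x : u ⟶ v), (⟨u, v, x⟩ : Arr X) ∈ s.carrier → g v = α.map x (f u) := by
  constructor
  · rintro ⟨h, rfl⟩
    exact ⟨h, (α.betaFun s ⟨f, h⟩).2, fun u v x hx => α.betaFun_of_mem s ⟨f, h⟩ hx⟩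
  · rintro ⟨hf, hg, h⟩
    refine ⟨hf, ?_⟩
    have : α.betaFun s ⟨f, hf⟩ = ⟨g, hg⟩ := ext_rSet fun u v x hx => by
      rw [α.betaFun_of_mem s _ hx, h u v x hx]
    exact congrArg Subtype.val this

theorem beta_mul (s t : OpenBisection X) (f g : Gamma0 A) :
    (α.beta (s * t)).Rel f g ↔ ∃ h, (α.beta t).Rel f h ∧ (α.beta s).Rel h g := by
  simp only [beta_rel_iff]
  constructor
  · rintro ⟨hf, hg, h⟩
    have hft : f ∈ Gamma0.vanishing t.dSet := by
      intro u hu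
      refine hf u fun hu' => hu ?_
      obtain ⟨⟨u, w, z⟩, ⟨v, x, y, hx, hy, -⟩, rfl⟩ := hu'
      exact ⟨_, hy, rfl⟩
    refine ⟨(α.betaFun t ⟨f, hft⟩).1, ⟨hft, (α.betaFun t ⟨f, hft⟩).2,
      fun u v x hx => α.betaFun_of_mem t ⟨f, hft⟩ hx⟩, ?_, ?_, ?_⟩
    · intro v hv
      by_cases hv' : v ∈ t.rSet
      · obtain ⟨⟨u, v, y⟩, hy, rfl⟩ := hv'
        rw [α.betaFun_of_mem t _ hy]
        change α.map y (f u) = 0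
        rw [hf u, map_zero]
        rintro ⟨⟨u', w, z⟩, ⟨v', x, y', hx, hy', -⟩, hu⟩
        obtain rfl : u' = u := hu
        have e := t.src_injOn hy hy' rfl
        cases e
        exact hv ⟨_, hx, rfl⟩
      · exact (α.betaFun t ⟨f, hft⟩).2 v hv'
    · intro w hw
      refine hg w fun hw' => hw ?_
      obtain ⟨⟨u, w, z⟩, ⟨v, x, y, hx, hy, -⟩, rfl⟩ := hw'
      exact ⟨_, hx, rfl⟩
    · intro v w x hx
      by_cases hv : v ∈ t.rSet
      · obtain ⟨⟨u, v, y⟩, hy, rfl⟩ := hv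
        rw [α.betaFun_of_mem t _ hy]
        change _ = α.map x (α.map y (f u))
        rw [h u w (y ≫ x) ⟨v, x, y, hx, hy, rfl⟩, α.map_comp]
      · rw [(α.betaFun t ⟨f, hft⟩).2 v hv, map_zero]
        refine hg w ?_
        rintro ⟨⟨u, w', z⟩, ⟨v', x', y, hx', hy, -⟩, hw⟩
        obtain rfl : w' = w := hw
        have e := s.tgt_injOn hx hx' rfl
        cases e
        exact hv ⟨_, hy, rfl⟩
  · rintro ⟨k, ⟨hf, hk, h1⟩, hk', hg, h2⟩
    refine ⟨?_, ?_, ?_⟩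
    · intro u hu
      by_cases hu' : u ∈ t.dSet
      · obtain ⟨⟨u, v, y⟩, hy, rfl⟩ := hu'
        have h3 := h1 u v y hy
        rw [hk' v] at h3
        · rw [← α.map_inv_map y (f u), ← h3, map_zero]
        · rintro ⟨⟨v', w, x⟩, hx, hv⟩
          obtain rfl : v' = v := hv
          exact hu ⟨⟨u, w, y ≫ x⟩, ⟨v', x, y, hx, hy, rfl⟩, rfl⟩
      · exact hf u hu'
    · intro w hw
      by_cases hw' : w ∈ s.rSet
      · obtain ⟨⟨v, w, x⟩, hx, rfl⟩ := hw'
        change g w = 0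
        rw [h2 v w x hx, hk v, map_zero]
        rintro ⟨⟨u, v', y⟩, hy, hv⟩
        obtain rfl : v' = v := hv
        exact hw ⟨⟨u, w, y ≫ x⟩, ⟨v', x, y, hx, hy, rfl⟩, rfl⟩
      · exact hg w hw'
    · rintro u w z ⟨v, x, y, hx, hy, h⟩
      dsimp only at x y hx hy h
      subst h
      rw [h2 v w x hx, h1 u v y hy, α.map_comp]

end GroupoidAction

namespace InverseSubsemigroup.IsFull

variable {S : InverseSubsemigroup (OpenBisection X)}

theorem exists_mem (hS : S.IsFull) (x : Arr X) : ∃ s : S, x ∈ s.1.carrier := by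
  obtain ⟨_, ⟨s, rfl⟩, hx, -⟩ := hS.isBasis.exists_subset_of_mem_open (Set.mem_univ x) isOpen_univ
  exact ⟨s, hx⟩

theorem directed_dSet (hS : S.IsFull) (s t : S) :
    ∃ g : S, s.1.dSet ⊆ g.1.dSet ∧ t.1.dSet ⊆ g.1.dSet := by
  obtain ⟨g, -, h1, h2⟩ := hS.directed _ _ (InverseSemigroup.idem_star_mul s)
    (InverseSemigroup.idem_star_mul t)
  have key : ∀ s : S, InverseSemigroup.natLE (star s * s) g → s.1.dSet ⊆ g.1.dSet := by
    rintro s h _ ⟨⟨u, v, x⟩, hx, rfl⟩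
    have h3 : Arr.unit u ∈ (star s.1 * s.1).carrier :=
      ⟨v, Groupoid.inv x, x, by simpa [OpenBisection.mem_star, Arr.inv] using hx, hx, by simp⟩
    have h4 : (star s.1 * s.1) = (star s.1 * s.1) * star (star s.1 * s.1) * g.1 :=
      congrArg Subtype.val h
    rw [h4] at h3
    obtain ⟨w, -, y, -, hy, -⟩ := h3
    exact ⟨_, hy, rfl⟩
  exact ⟨g, key s h1, key t h2⟩

end InverseSubsemigroup.IsFull

/-- The action `β` of a full inverse semigroup `S` of open `G`-sets on `Γ_0(𝒜)` associated with a
groupoid action `α`. -/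
def GroupoidAction.assoc (S : InverseSubsemigroup (OpenBisection X)) (hS : S.IsFull) :
    InvAction S (Gamma0 A) where
  toFun s := α.beta s.1
  map_comp s t f g := α.beta_mul s.1 t.1 f g
  directed s t := by
    obtain ⟨g, h1, h2⟩ := hS.directed_dSet s t
    exact ⟨g, fun f hf u hu => hf u fun h => hu (h1 h), fun f hf u hu => hf u fun h => hu (h2 h)⟩
  dense_span := by
    intro f
    rw [Metric.mem_closure_iff]
    intro ε hε
    have hK := f.isCompact_norm_ge (half_pos hε)
    have main : ∃ g ∈ Submodule.span ℂ (⋃ s : S, ((α.beta s.1).dom : Set (Gamma0 A))),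
        ∀ u, ‖(f - g) u‖ ≤ ε / 2 := by
      rcases Set.eq_empty_or_nonempty {u | ε / 2 ≤ ‖f u‖} with hE | ⟨u₀, -⟩
      · refine ⟨0, Submodule.zero_mem _, fun u => ?_⟩
        rw [sub_zero]
        have : u ∉ {u | ε / 2 ≤ ‖f u‖} := by rw [hE]; simp
        simp only [Set.mem_ofPred_eq, not_le] at this
        exact this.le
      · obtain ⟨s₀, -⟩ := hS.exists_mem (Arr.unit u₀)
        have : Nonempty S := ⟨s₀⟩
        obtain ⟨s, hs⟩ := hK.elim_directed_cover (fun s : S => s.1.dSet)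
          (fun s => s.1.isOpen_dSet)
          (fun u _ => by
            obtain ⟨s, hs⟩ := hS.exists_mem (Arr.unit u)
            exact Set.mem_iUnion.2 ⟨s, _, hs, rfl⟩)
          (fun s t => hS.directed_dSet s t)
        obtain ⟨φ, h1, h0, -, h01⟩ := exists_continuous_one_zero_of_isCompact hK
          s.1.isOpen_dSet.isClosed_compl (Set.disjoint_compl_right_iff_subset.2 hs)
        obtain ⟨g, hg⟩ := f.exists_cutoff φ h01
        refine ⟨g, Submodule.subset_span (Set.mem_iUnion.2 ⟨s, fun u hu => ?_⟩), fun u => ?_⟩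
        · rw [hg, h0 hu]; simp
        · have e : (f - g) u = f u - (φ u : ℂ) • f u := by
            rw [Gamma0.sub_apply, hg]
          rw [e]
          by_cases hu : u ∈ {u | ε / 2 ≤ ‖f u‖}
          · rw [h1 hu]
            simpa using (half_pos hε).le
          · simp only [Set.mem_ofPred_eq, not_le] at hu
            have e2 : f u - (φ u : ℂ) • f u = ((1 - φ u : ℝ) : ℂ) • f u := by
              push_cast
              rw [sub_smul, one_smul]
            rw [e2, norm_smul, Complex.norm_real,
              Real.norm_of_nonneg (sub_nonneg.2 (h01 u).2)]
            refine le_trans (mul_le_of_le_one_left (norm_nonneg _) ?_) hu.le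
            linarith [(h01 u).1]
    obtain ⟨g, hg, hfg⟩ := main
    refine ⟨g, hg, ?_⟩
    rw [dist_eq_norm]
    refine lt_of_le_of_lt ?_ (half_lt_self hε)
    exact Gamma0.norm_le_of_forall_le _ (half_pos hε).le hfg

end Action

end

end GpdCStar

namespace GpdCStar

open Topology Filter CategoryTheory DirectSum

set_option linter.unusedSectionVars false

noncomputable section

/-! ## The `*`-algebra `Γ_c(r^*𝒜)` -/

theorem finsum_comm_of_finite {ι κ M : Type*} [AddCommMonoid M] (T : ι → κ → M) {F : Set ι}
    (hF : F.Finite) {E : Set κ} (hE : E.Finite) (h : ∀ i k, T i k ≠ 0 → i ∈ F ∧ k ∈ E) :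
    ∑ᶠ i, ∑ᶠ k, T i k = ∑ᶠ k, ∑ᶠ i, T i k := by
  have h1 : ∀ i, ∑ᶠ k, T i k = ∑ k ∈ hE.toFinset, T i k := fun i =>
    finsum_eq_sum_of_support_subset _ fun k hk => by simpa using (h i k hk).2
  have h2 : ∀ k, ∑ᶠ i, T i k = ∑ i ∈ hF.toFinset, T i k := fun k =>
    finsum_eq_sum_of_support_subset _ fun i hi => by simpa using (h i k hi).1
  simp only [h1, h2]
  rw [finsum_eq_sum_of_support_subset (s := hF.toFinset), finsum_eq_sum_of_support_subset
    (s := hE.toFinset), Finset.sum_comm]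
  · intro k hk
    obtain ⟨i, -, hi⟩ := Finset.exists_ne_zero_of_sum_ne_zero hk
    simpa using (h i k hi).2
  · intro i hi
    obtain ⟨k, -, hk⟩ := Finset.exists_ne_zero_of_sum_ne_zero hi
    simpa using (h i k hk).1

section Convolution

variable {X : Type*} [Groupoid X] [TopologicalSpace X] [TopologicalSpace (Arr X)]
  [RDiscreteGroupoid X] {A : X → Type*} [∀ u, NonUnitalCStarAlgebra (A u)]
  [TopologicalSpace (Tot A)] [USCBundle A]

open USCBundle RDiscreteGroupoid

theorem isCompact_closure_of_vanish {Y : Type*} [TopologicalSpace Y] [T2Space Y] {K : Set Y}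
    (hK : IsCompact K) {B : Y → Type*} [∀ y, Zero (B y)] {f : ∀ y, B y} (h : ∀ y, y ∉ K → f y = 0) :
    closure {y | f y ≠ 0} ⊆ K ∧ IsCompact (closure {y | f y ≠ 0}) := by
  have h1 : closure {y | f y ≠ 0} ⊆ K :=
    closure_minimal (fun y hy => by by_contra hy'; exact hy (h y hy')) hK.isClosed
  exact ⟨h1, hK.of_isClosed_subset isClosed_closure h1⟩

theorem vanish_of_notMem_closure {Y : Type*} [TopologicalSpace Y] {B : Y → Type*} [∀ y, Zero (B y)]
    {f : ∀ y, B y} {y : Y} (h : y ∉ closure {y | f y ≠ 0}) : f y = 0 := by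
  by_contra hy
  exact h (subset_closure hy)

variable (A) in
/-- The space `Γ_c(r^*𝒜)` of compactly supported continuous sections of the pull-back `r^*𝒜`. -/
def GammaC : Submodule ℂ (∀ x : Arr X, A x.tgt) where
  carrier := {f | Continuous (fun x => (⟨x.tgt, f x⟩ : Tot A)) ∧ IsCompact (closure {x | f x ≠ 0})}
  zero_mem' := ⟨continuous_zero (A := A) continuous_tgt, by simp⟩
  add_mem' := by
    rintro f g ⟨hf, hf'⟩ ⟨hg, hg'⟩
    refine ⟨continuous_iff_continuousAt.2 fun x => tendsto_add (hf.tendsto x) (hg.tendsto x), ?_⟩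
    refine (isCompact_closure_of_vanish (hf'.union hg') fun x hx => ?_).2
    simp only [Set.mem_union, not_or] at hx
    rw [Pi.add_apply, vanish_of_notMem_closure hx.1, vanish_of_notMem_closure hx.2, add_zero]
  smul_mem' := by
    rintro c f ⟨hf, hf'⟩
    refine ⟨continuous_iff_continuousAt.2 fun x => tendsto_const_smul c (hf.tendsto x), ?_⟩
    refine (isCompact_closure_of_vanish hf' fun x hx => ?_).2
    rw [Pi.smul_apply, vanish_of_notMem_closure hx, smul_zero]

namespace GammaC

theorem mem_of_vanish {f : ∀ x : Arr X, A x.tgt}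
    (hf : Continuous (fun x => (⟨x.tgt, f x⟩ : Tot A))) {K : Set (Arr X)} (hK : IsCompact K)
    (h : ∀ x, x ∉ K → f x = 0) : f ∈ GammaC A :=
  ⟨hf, (isCompact_closure_of_vanish hK h).2⟩

theorem exists_compact {f : ∀ x : Arr X, A x.tgt} (hf : f ∈ GammaC A) :
    ∃ K, IsCompact K ∧ ∀ x, x ∉ K → f x = 0 :=
  ⟨_, hf.2, fun _ h => vanish_of_notMem_closure h⟩

open GroupoidAction in
/-- Compactly supported sections have finite support on each fibre of the range map. -/
theorem finite_fibre {f : ∀ x : Arr X, A x.tgt} (hf : f ∈ GammaC A) (v : X) :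
    {y : Into v | f y.arr ≠ 0}.Finite := by
  obtain ⟨K, hK, hfK⟩ := exists_compact hf
  obtain ⟨t, ht⟩ := hK.elim_finite_subcover (fun s : OpenBisection X => s.carrier)
    (fun s => s.isOpen) (fun x _ => by
      obtain ⟨s, hs⟩ := OpenBisection.exists_mem x
      exact Set.mem_iUnion.2 ⟨s, hs⟩)
  have h1 : {y : Into v | f y.arr ≠ 0} ⊆ ⋃ s ∈ t, {y : Into v | y.arr ∈ s.carrier} := by
    intro y hy
    have : y.arr ∈ K := by
      by_contra h
      exact hy (hfK _ h)
    simpa using ht this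
  refine Set.Finite.subset (t.finite_toSet.biUnion fun s _ => ?_) h1
  refine Set.Subsingleton.finite ?_
  rintro ⟨u, y⟩ hy ⟨u', y'⟩ hy'
  have e := s.tgt_injOn hy hy' rfl
  cases e
  rfl

/-- Every element of `Γ_c(r^*𝒜)` is a finite sum of elements supported in open `G`-sets. -/
theorem induction {P : (∀ x : Arr X, A x.tgt) → Prop} (zero : P 0)
    (add : ∀ f g, f ∈ GammaC A → g ∈ GammaC A → P f → P g → P (f + g))
    (bis : ∀ (s : OpenBisection X) (K : Set (Arr X)) (f : ∀ x : Arr X, A x.tgt), f ∈ GammaC A →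
      IsCompact K → K ⊆ s.carrier → (∀ x, x ∉ K → f x = 0) → P f)
    {f : ∀ x : Arr X, A x.tgt} (hf : f ∈ GammaC A) : P f := by
  obtain ⟨K, hK, hfK⟩ := exists_compact hf
  obtain ⟨t, ht⟩ := hK.elim_finite_subcover (fun s : OpenBisection X => s.carrier)
    (fun s => s.isOpen) (fun x _ => by
      obtain ⟨s, hs⟩ := OpenBisection.exists_mem x
      exact Set.mem_iUnion.2 ⟨s, hs⟩)
  let e := t.equivFin.symm
  have hcov : K ⊆ ⋃ i, (e i).1.carrier := by
    intro x hx
    obtain ⟨s, hs, hxs⟩ := Set.mem_iUnion₂.1 (ht hx)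
    exact Set.mem_iUnion.2 ⟨e.symm ⟨s, hs⟩, by simpa using hxs⟩
  obtain ⟨φ, h1, h2, -, h4⟩ := exists_continuous_sum_one_of_isOpen_isCompact
    (fun i => (e i).1.isOpen) hK hcov
  have hmem : ∀ i, (fun x => (φ i x : ℂ) • f x) ∈ GammaC A := fun i =>
    mem_of_vanish (continuous_iff_continuousAt.2 fun x =>
      tendsto_smul ((Complex.continuous_ofReal.comp (φ i).continuous).tendsto x) (hf.1.tendsto x))
      hK (fun x hx => by rw [hfK x hx, smul_zero])
  have hP : ∀ i, P (fun x => (φ i x : ℂ) • f x) := fun i =>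
    bis (e i).1 (tsupport (φ i)) _ (hmem i) (h4 i) (h1 i) (fun x hx => by
      rw [image_eq_zero_of_notMem_tsupport hx]; simp)
  have hsum : f = ∑ i, fun x => (φ i x : ℂ) • f x := by
    funext x
    rw [Finset.sum_apply, ← Finset.sum_smul]
    by_cases hx : x ∈ K
    · have h3 := h2 hx
      simp only [Finset.sum_apply, Pi.one_apply] at h3
      rw [← Complex.ofReal_sum]
      have h5 : ∑ i, φ i x = 1 := by simpa using h3
      rw [h5, Complex.ofReal_one, one_smul]
    · rw [hfK x hx, smul_zero]
  have key : ∀ F : Finset (Fin t.card), (∑ i ∈ F, fun x => (φ i x : ℂ) • f x) ∈ GammaC A ∧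
      P (∑ i ∈ F, fun x => (φ i x : ℂ) • f x) := by
    intro F
    classical
    induction F using Finset.induction_on with
    | empty => exact ⟨Submodule.zero_mem _, zero⟩
    | insert i F hi ih =>
      rw [Finset.sum_insert hi]
      exact ⟨Submodule.add_mem _ (hmem i) ih.1, add _ _ (hmem i) ih.1 (hP i) ih.2⟩
  rw [hsum]
  exact (key Finset.univ).2

end GammaC

namespace GroupoidAction

variable (α : GroupoidAction A)

/-- The convolution product `(fg)(x) = ∑_{r(y) = r(x)} f(y) α_y(g(y⁻¹x))`. -/
def conv (f g : ∀ x : Arr X, A x.tgt) (x : Arr X) : A x.tgt :=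
  ∑ᶠ y : Into x.tgt, f y.arr * α.map y.2 (g ⟨x.src, y.1, x.hom ≫ Groupoid.inv y.2⟩)

/-- The involution `f*(x) = α_x(f(x⁻¹))*`. -/
def invol (f : ∀ x : Arr X, A x.tgt) (x : Arr X) : A x.tgt :=
  star (α.map x.hom (f x.inv))

variable {f g h : ∀ x : Arr X, A x.tgt}

theorem conv_support (hf : f ∈ GammaC A) (g : ∀ x : Arr X, A x.tgt) (x : Arr X) :
    (Function.support (M := A x.tgt) fun y : Into x.tgt =>
      (f y.arr * α.map y.2 (g ⟨x.src, y.1, x.hom ≫ Groupoid.inv y.2⟩) : A x.tgt)).Finite := by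
  refine (GammaC.finite_fibre hf x.tgt).subset fun y hy => ?_
  intro h0
  exact hy (by simp [h0])

theorem conv_add_left (hf : f ∈ GammaC A) (hg : g ∈ GammaC A) :
    α.conv (f + g) h = α.conv f h + α.conv g h := by
  funext x
  simp only [conv, Pi.add_apply, add_mul]
  exact finsum_add_distrib (α.conv_support hf h x) (α.conv_support hg h x)

theorem conv_add_right (hf : f ∈ GammaC A) : α.conv f (g + h) = α.conv f g + α.conv f h := by
  funext x
  simp only [conv, Pi.add_apply, map_add, mul_add]
  exact finsum_add_distrib (α.conv_support hf g x) (α.conv_support hf h x)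

theorem conv_smul_left (c : ℂ) (hf : f ∈ GammaC A) : α.conv (c • f) g = c • α.conv f g := by
  funext x
  simp only [conv, Pi.smul_apply, smul_mul_assoc]
  exact (smul_finsum' c (α.conv_support hf g x)).symm

theorem conv_smul_right (c : ℂ) (hf : f ∈ GammaC A) : α.conv f (c • g) = c • α.conv f g := by
  funext x
  simp only [conv, Pi.smul_apply, map_smul, mul_smul_comm]
  exact (smul_finsum' c (α.conv_support hf g x)).symm

/-- The fibrewise translation `y ↦ z⁻¹y`. -/
theorem bijective_translate {u v : X} (z : u ⟶ v) :
    Function.Bijective fun y : Into v => (⟨y.1, y.2 ≫ Groupoid.inv z⟩ : Into u) := by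
  refine Function.bijective_iff_has_inverse.2 ⟨fun w => ⟨w.1, w.2 ≫ z⟩, ?_, ?_⟩
  · rintro ⟨w, y⟩; simp
  · rintro ⟨w, y⟩; simp

theorem conv_assoc (hf : f ∈ GammaC A) (hg : g ∈ GammaC A) :
    α.conv (α.conv f g) h = α.conv f (α.conv g h) := by
  funext x
  obtain ⟨u, v, x⟩ := x
  have hL : α.conv (α.conv f g) h ⟨u, v, x⟩ = ∑ᶠ y : Into v, ∑ᶠ z : Into v,
      f z.arr * α.map z.2 (g ⟨y.1, z.1, y.2 ≫ Groupoid.inv z.2⟩) *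
        α.map y.2 (h ⟨u, y.1, x ≫ Groupoid.inv y.2⟩) := by
    refine finsum_congr fun y => ?_
    exact finsum_mul' _ _ (α.conv_support hf g y.arr)
  have hR : α.conv f (α.conv g h) ⟨u, v, x⟩ = ∑ᶠ z : Into v, ∑ᶠ y : Into v,
      f z.arr * α.map z.2 (g ⟨y.1, z.1, y.2 ≫ Groupoid.inv z.2⟩) *
        α.map y.2 (h ⟨u, y.1, x ≫ Groupoid.inv y.2⟩) := by
    refine finsum_congr fun z => ?_
    have h1 : α.map z.2 (α.conv g h ⟨u, z.1, x ≫ Groupoid.inv z.2⟩) =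
        ∑ᶠ w : Into z.1, α.map z.2 (g w.arr * α.map w.2
          (h ⟨u, w.1, (x ≫ Groupoid.inv z.2) ≫ Groupoid.inv w.2⟩)) :=
      map_finsum (α.map z.2) (α.conv_support hg h ⟨u, z.1, x ≫ Groupoid.inv z.2⟩)
    have h2 : (Function.support fun w : Into z.1 => α.map z.2 (g w.arr * α.map w.2
        (h ⟨u, w.1, (x ≫ Groupoid.inv z.2) ≫ Groupoid.inv w.2⟩))).Finite := by
      refine (α.conv_support hg h ⟨u, z.1, x ≫ Groupoid.inv z.2⟩).subset fun w hw => ?_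
      intro h0
      exact hw ((congrArg (α.map z.2) h0).trans (map_zero _))
    change f z.arr * α.map z.2 (α.conv g h ⟨u, z.1, x ≫ Groupoid.inv z.2⟩) = _
    rw [h1, mul_finsum' _ _ h2, ← finsum_comp _ (bijective_translate z.2)]
    refine finsum_congr fun y => ?_
    have e1 : (y.2 ≫ Groupoid.inv z.2) ≫ z.2 = y.2 := by simp
    have e2 : (x ≫ Groupoid.inv z.2) ≫ Groupoid.inv (y.2 ≫ Groupoid.inv z.2) =
      x ≫ Groupoid.inv y.2 := by simp
    simp only [map_mul, ← α.map_comp, mul_assoc, e1]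
    exact congrArg (fun t => f z.arr * (α.map z.2 (g ⟨y.1, z.1, y.2 ≫ Groupoid.inv z.2⟩) *
      α.map y.2 (h ⟨u, y.1, t⟩))) e2
  rw [hL, hR]
  have hfin : (⋃ z ∈ {z : Into v | f z.arr ≠ 0}, {y : Into v |
      g ⟨y.1, z.1, y.2 ≫ Groupoid.inv z.2⟩ ≠ 0}).Finite := by
    refine (GammaC.finite_fibre hf v).biUnion fun z _ => ?_
    exact (GammaC.finite_fibre hg z.1).preimage (bijective_translate z.2).injective.injOn
  refine finsum_comm_of_finite _ hfin (GammaC.finite_fibre hf v) fun y z hyz => ?_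
  have h1 : f z.arr ≠ 0 := fun h0 => hyz (by simp [h0])
  refine ⟨Set.mem_biUnion h1 fun h0 => hyz ?_, h1⟩
  simp [h0]

theorem invol_conv (hf : f ∈ GammaC A) :
    α.invol (α.conv f g) = α.conv (α.invol g) (α.invol f) := by
  funext x
  obtain ⟨u, v, x⟩ := x
  have h1 : α.map x (α.conv f g ⟨v, u, Groupoid.inv x⟩) = ∑ᶠ y : Into u,
      α.map x (f y.arr * α.map y.2 (g ⟨v, y.1, Groupoid.inv x ≫ Groupoid.inv y.2⟩)) :=
    map_finsum (α.map x) (α.conv_support hf g ⟨v, u, Groupoid.inv x⟩)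
  have h2 : (Function.support fun y : Into u => α.map x (f y.arr * α.map y.2
      (g ⟨v, y.1, Groupoid.inv x ≫ Groupoid.inv y.2⟩))).Finite := by
    refine (α.conv_support hf g ⟨v, u, Groupoid.inv x⟩).subset fun w hw => ?_
    intro h0
    exact hw ((congrArg (α.map x) h0).trans (map_zero _))
  change star (α.map x (α.conv f g ⟨v, u, Groupoid.inv x⟩)) = _
  rw [h1]
  have h3 := (starAddEquiv : A v ≃+ A v).toAddMonoidHom.map_finsum h2
  refine Eq.trans h3 ?_
  rw [← finsum_comp _ (bijective_translate x)]
  refine finsum_congr fun z => ?_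
  change star (α.map x _) = star (α.map z.2 (g ⟨v, z.1, Groupoid.inv z.2⟩)) *
    α.map z.2 (star (α.map (x ≫ Groupoid.inv z.2) (f ⟨z.1, u, Groupoid.inv (x ≫ Groupoid.inv z.2)⟩)))
  have e1 : (x ≫ Groupoid.inv z.2) ≫ z.2 = x := by simp
  have e2 : Groupoid.inv x ≫ Groupoid.inv (z.2 ≫ Groupoid.inv x) = Groupoid.inv z.2 := by simp
  have e3 : Groupoid.inv (x ≫ Groupoid.inv z.2) = z.2 ≫ Groupoid.inv x := by simp
  have e4 : (z.2 ≫ Groupoid.inv x) ≫ x = z.2 := by simp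
  rw [map_mul, star_mul, map_star, ← α.map_comp, ← α.map_comp, e1, e2, e3, e4]

theorem invol_invol (f : ∀ x : Arr X, A x.tgt) : α.invol (α.invol f) = f := by
  funext x
  obtain ⟨u, v, x⟩ := x
  change star (α.map x (star (α.map (Groupoid.inv x) (f ⟨u, v, Groupoid.inv (Groupoid.inv x)⟩)))) = _
  rw [map_star, star_star, α.map_map_inv]
  congr 1
  simp

theorem invol_mem (hf : f ∈ GammaC A) : α.invol f ∈ GammaC A := by
  obtain ⟨K, hK, hfK⟩ := GammaC.exists_compact hf
  refine GammaC.mem_of_vanish (continuous_iff_continuousAt.2 fun x => ?_)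
    (hK.image RDiscreteGroupoid.continuous_inv) fun x hx => ?_
  · refine tendsto_star (α.tendsto_map (x := fun x => x) tendsto_id ?_)
    exact (hf.1.tendsto x.inv).comp (RDiscreteGroupoid.continuous_inv.tendsto x)
  · rw [invol, hfK x.inv fun h => hx ⟨_, h, x.inv_inv⟩, map_zero, star_zero]

theorem conv_single {s : OpenBisection X} (hs : ∀ x, x ∉ s.carrier → f x = 0)
    (r : Composable X) (hr : r.left.inv ∈ s.carrier) :
    α.conv f g r.right = f r.left.inv * α.map (Groupoid.inv r.fst) (g r.prod) := by
  obtain ⟨u, w, v, y, z⟩ := r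
  change (∑ᶠ y : Into w, _) = _
  rw [finsum_eq_single _ (⟨v, Groupoid.inv y⟩ : Into w)]
  · change f ⟨v, w, Groupoid.inv y⟩ * α.map (Groupoid.inv y)
      (g ⟨u, v, z ≫ Groupoid.inv (Groupoid.inv y)⟩) = _
    congr 3
    simp [Composable.prod]
  · rintro ⟨v', y'⟩ hne
    rw [hs, zero_mul]
    intro hy'
    have e := s.tgt_injOn hy' hr rfl
    cases e
    exact hne rfl

theorem conv_continuous (hf : f ∈ GammaC A) (hg : g ∈ GammaC A) :
    Continuous fun x => (⟨x.tgt, α.conv f g x⟩ : Tot A) := by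
  refine GammaC.induction (P := fun f => Continuous fun x => (⟨x.tgt, α.conv f g x⟩ : Tot A))
    ?_ ?_ ?_ hf
  · have : α.conv 0 g = 0 := by
      funext x
      simp [conv]
    rw [this]
    exact continuous_zero (A := A) continuous_tgt
  · intro f f' hf hf' h1 h2
    rw [α.conv_add_left hf hf']
    exact continuous_iff_continuousAt.2 fun x => tendsto_add (h1.tendsto x) (h2.tendsto x)
  · intro s K f hf hK hKs hfK
    have hfs : ∀ x, x ∉ s.carrier → f x = 0 := fun x hx => hfK x fun h => hx (hKs h)
    rw [continuous_iff_continuousAt]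
    intro x
    by_cases hx : x.tgt ∈ s.rSet
    · set N : Set (Arr X) := Arr.tgt ⁻¹' s.rSet with hN
      have hNo : IsOpen N := s.isOpen_rSet.preimage continuous_tgt
      rw [ContinuousAt, ← hNo.isOpenEmbedding_subtypeVal.map_nhds_eq ⟨x, hx⟩, tendsto_map'_iff]
      have hex : ∀ z : N, ∃ r : Composable X, r.right = z ∧ r.left.inv ∈ s.carrier := by
        rintro ⟨⟨u, w, z⟩, ⟨⟨v, w', y⟩, hy, hw⟩⟩
        obtain rfl : w' = w := hw
        exact ⟨⟨u, w', v, Groupoid.inv y, z⟩, rfl, by simpa [Arr.inv] using hy⟩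
      choose r hr1 hr2 using hex
      set x' : N := ⟨x, hx⟩ with hx'
      have T1 : Tendsto (fun z => (r z).right) (𝓝 x') (𝓝 (r x').right) := by
        simp only [hr1]
        exact continuous_subtype_val.tendsto _
      have T2 : Tendsto (fun z => (r z).left.inv) (𝓝 x') (𝓝 (r x').left.inv) := by
        refine s.tendsto_of_tgt hr2 (hr2 _) ?_
        have T0 : Tendsto (fun z => (r z).right.tgt) (𝓝 x') (𝓝 (r x').right.tgt) :=
          (continuous_tgt.tendsto _).comp T1
        exact T0
      have T3 : Tendsto (fun z => (r z).left) (𝓝 x') (𝓝 (r x').left) := by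
        simpa only [Arr.inv_inv] using tendsto_inv T2
      have T4 := tendsto_composable T3 T1
      have T5 : Tendsto (fun z => (⟨(r z).tgt, g (r z).prod⟩ : Tot A)) (𝓝 x')
          (𝓝 ⟨(r x').tgt, g (r x').prod⟩) := (hg.1.tendsto _).comp T4
      have T6 := α.tendsto_map (x := fun z => (r z).left.inv) (x₀ := (r x').left.inv) T2 T5
      have T7 : Tendsto (fun z => (⟨(r z).mid, f (r z).left.inv⟩ : Tot A)) (𝓝 x')
          (𝓝 ⟨(r x').mid, f (r x').left.inv⟩) := (hf.1.tendsto _).comp T2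
      have T8 := tendsto_mul T7 T6
      have e : ∀ z : N, (⟨(r z).mid, f (r z).left.inv *
          α.map (Groupoid.inv (r z).fst) (g (r z).prod)⟩ : Tot A) =
          ⟨z.1.tgt, α.conv f g z.1⟩ := by
        intro z
        rw [← α.conv_single hfs (r z) (hr2 z), ← hr1 z]
      have T9 : Tendsto (fun z => (⟨(r z).mid, f (r z).left.inv *
          α.map (Groupoid.inv (r z).fst) (g (r z).prod)⟩ : Tot A)) (𝓝 x')
          (𝓝 ⟨(r x').mid, f (r x').left.inv *
            α.map (Groupoid.inv (r x').fst) (g (r x').prod)⟩) := T8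
      simp only [e] at T9
      exact T9
    · have hV : IsOpen (Arr.tgt ⁻¹' (Arr.tgt '' K))ᶜ :=
        ((hK.image continuous_tgt).isClosed.preimage continuous_tgt).isOpen_compl
      have hxV : x ∈ (Arr.tgt ⁻¹' (Arr.tgt '' K))ᶜ := by
        rintro ⟨y, hy, hyx⟩
        exact hx ⟨y, hKs hy, hyx⟩
      have h0 : ∀ z ∈ (Arr.tgt ⁻¹' (Arr.tgt '' K))ᶜ, α.conv f g z = 0 := by
        intro z hz
        have : ∀ y : Into z.tgt, f y.arr = 0 := fun y => hfK _ fun hy => hz ⟨_, hy, rfl⟩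
        simp [conv, this]
      rw [ContinuousAt, h0 x hxV]
      refine ((continuous_zero (A := A) continuous_tgt).tendsto x).congr' ?_
      filter_upwards [hV.mem_nhds hxV] with z hz
      rw [h0 z hz]

theorem conv_mem (hf : f ∈ GammaC A) (hg : g ∈ GammaC A) : α.conv f g ∈ GammaC A := by
  obtain ⟨K, hK, hfK⟩ := GammaC.exists_compact hf
  obtain ⟨L, hL, hgL⟩ := GammaC.exists_compact hg
  have h1 := isClosedEmbedding_composable.isCompact_preimage (hK.prod hL)
  refine GammaC.mem_of_vanish (α.conv_continuous hf hg)
    (h1.image RDiscreteGroupoid.continuous_prod) fun x hx => ?_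
  obtain ⟨u, v, x⟩ := x
  refine (finsum_congr fun y => ?_).trans finsum_zero
  obtain ⟨w, y⟩ := y
  by_contra hne
  refine hx ⟨⟨u, w, v, y, x ≫ Groupoid.inv y⟩, ⟨?_, ?_⟩, ?_⟩
  · by_contra h0
    exact hne (by rw [hfK _ h0, zero_mul])
  · by_contra h0
    refine hne ?_
    change _ * α.map y (g ⟨u, w, x ≫ Groupoid.inv y⟩) = 0
    rw [hgL _ h0, map_zero, mul_zero]
  · simp [Composable.prod]

/-- The `*`-algebra `Γ_c(r^*𝒜)` with the operations determined by the action `α`. -/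
def ConvAlg (_α : GroupoidAction A) : Type _ := GammaC A

namespace ConvAlg

instance : AddCommGroup α.ConvAlg := inferInstanceAs (AddCommGroup (GammaC A))
instance : Module ℂ α.ConvAlg := inferInstanceAs (Module ℂ (GammaC A))

instance : Mul α.ConvAlg := ⟨fun f g => ⟨α.conv f.1 g.1, α.conv_mem f.2 g.2⟩⟩
instance : Star α.ConvAlg := ⟨fun f => ⟨α.invol f.1, α.invol_mem f.2⟩⟩

instance : NonUnitalRing α.ConvAlg :=
  { (inferInstance : AddCommGroup α.ConvAlg), (inferInstance : Mul α.ConvAlg) with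
    left_distrib := fun f _ _ => Subtype.ext (α.conv_add_right f.2)
    right_distrib := fun f g _ => Subtype.ext (α.conv_add_left f.2 g.2)
    zero_mul := fun f => Subtype.ext (by
      funext x
      change α.conv 0 f.1 x = 0
      simp [conv])
    mul_zero := fun f => Subtype.ext (by
      funext x
      change α.conv f.1 0 x = 0
      simp [conv])
    mul_assoc := fun f g _ => Subtype.ext (α.conv_assoc f.2 g.2) }

instance : IsScalarTower ℂ α.ConvAlg α.ConvAlg :=
  ⟨fun c f _ => Subtype.ext (α.conv_smul_left c f.2)⟩

instance : SMulCommClass ℂ α.ConvAlg α.ConvAlg :=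
  ⟨fun c f _ => Subtype.ext (α.conv_smul_right c f.2).symm⟩

instance : StarRing α.ConvAlg where
  star_involutive f := Subtype.ext (α.invol_invol f.1)
  star_mul f g := Subtype.ext (α.invol_conv f.2)
  star_add f g := Subtype.ext (by
    funext x
    change star (α.map x.hom (f.1 x.inv + g.1 x.inv)) = star (α.map x.hom (f.1 x.inv)) +
      star (α.map x.hom (g.1 x.inv))
    rw [map_add, star_add])

instance : StarModule ℂ α.ConvAlg where
  star_smul c f := Subtype.ext (by
    funext x
    change star (α.map x.hom (c • f.1 x.inv)) = star c • star (α.map x.hom (f.1 x.inv))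
    rw [map_smul, star_smul])

end ConvAlg

end GroupoidAction

/-! ## The map `Ψ` -/

/-- The space of compactly supported continuous sections of `𝒜` with support contained in `V`. -/
def gammaSupp (A : X → Type*) [∀ u, NonUnitalCStarAlgebra (A u)] [TopologicalSpace (Tot A)]
    [USCBundle A] (V : Set X) : Submodule ℂ (Gamma0 A) where
  carrier := {f | IsCompact (closure {u | f u ≠ 0}) ∧ closure {u | f u ≠ 0} ⊆ V}
  zero_mem' := by simp
  add_mem' := by
    rintro f g ⟨hf, hf'⟩ ⟨hg, hg'⟩
    have := isCompact_closure_of_vanish (f := fun u => (f + g) u) (hf.union hg) fun u hu => by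
      simp only [Set.mem_union, not_or] at hu
      rw [Gamma0.add_apply, vanish_of_notMem_closure (f := fun u => f u) hu.1,
        vanish_of_notMem_closure (f := fun u => g u) hu.2, add_zero]
    exact ⟨this.2, this.1.trans (Set.union_subset hf' hg')⟩
  smul_mem' := by
    rintro c f ⟨hf, hf'⟩
    have := isCompact_closure_of_vanish (f := fun u => (c • f) u) hf fun u hu => by
      rw [Gamma0.smul_apply, vanish_of_notMem_closure (f := fun u => f u) hu, smul_zero]
    exact ⟨this.2, this.1.trans hf'⟩

namespace GroupoidAction

variable (α : GroupoidAction A)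

open Classical in
/-- `Ψ(b, s)`: the function with value `b(r(x))` for `x ∈ s`, and `0` elsewhere. -/
def psiFun (s : OpenBisection X) (b : Gamma0 A) (x : Arr X) : A x.tgt :=
  if x ∈ s.carrier then b x.tgt else 0

theorem psiFun_mem (s : OpenBisection X) (b : Gamma0 A) (hb : b ∈ gammaSupp A s.rSet) :
    psiFun s b ∈ GammaC A := by
  have h0 : IsLocalHomeomorph (Arr.tgt ∘ (Subtype.val : s.carrier → Arr X)) :=
    isLocalHomeomorph_tgt.comp s.isOpen.isOpenEmbedding_subtypeVal.isLocalHomeomorph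
  have h1 := h0.isOpenEmbedding_of_injective (s.tgt_injOn.injective)
  have h2 : IsCompact ((Arr.tgt ∘ (Subtype.val : s.carrier → Arr X)) ⁻¹'
      closure {u | b u ≠ 0}) := by
    refine h1.isInducing.isCompact_preimage' hb.1 ?_
    intro u hu
    obtain ⟨x, hx, rfl⟩ := hb.2 hu
    exact ⟨⟨x, hx⟩, rfl⟩
  have h3 := h2.image continuous_subtype_val
  have hvan : ∀ x, x ∉ Subtype.val '' ((Arr.tgt ∘ (Subtype.val : s.carrier → Arr X)) ⁻¹'
      closure {u | b u ≠ 0}) → psiFun s b x = 0 := by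
    intro x hx
    by_cases hxs : x ∈ s.carrier
    · rw [psiFun, if_pos hxs]
      exact vanish_of_notMem_closure (f := fun u => b u) fun h => hx ⟨⟨x, hxs⟩, h, rfl⟩
    · rw [psiFun, if_neg hxs]
  refine GammaC.mem_of_vanish (continuous_iff_continuousAt.2 fun x => ?_) h3 hvan
  by_cases hxs : x ∈ s.carrier
  · rw [ContinuousAt]
    have e : ∀ z ∈ s.carrier, psiFun s b z = b z.tgt := fun z hz => by rw [psiFun, if_pos hz]
    rw [e x hxs]
    refine ((b.continuous.comp continuous_tgt).tendsto x).congr' ?_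
    filter_upwards [s.isOpen.mem_nhds hxs] with z hz
    rw [e z hz]
    rfl
  · have hx' : x ∈ (Subtype.val '' ((Arr.tgt ∘ (Subtype.val : s.carrier → Arr X)) ⁻¹'
        closure {u | b u ≠ 0}))ᶜ := by
      rintro ⟨y, -, rfl⟩
      exact hxs y.2
    rw [ContinuousAt, hvan x hx']
    refine ((continuous_zero (A := A) continuous_tgt).tendsto x).congr' ?_
    filter_upwards [h3.isClosed.isOpen_compl.mem_nhds hx'] with z hz
    rw [hvan z hz]

/-- `b ↦ Ψ(b, s)` as a linear map. -/
def psiFib (s : OpenBisection X) : gammaSupp A s.rSet →ₗ[ℂ] α.ConvAlg where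
  toFun b := ⟨psiFun s b.1, psiFun_mem s b.1 b.2⟩
  map_add' b c := Subtype.ext (by
    funext x
    change psiFun s (b.1 + c.1) x = psiFun s b.1 x + psiFun s c.1 x
    by_cases hx : x ∈ s.carrier <;> simp [psiFun, hx])
  map_smul' r b := Subtype.ext (by
    funext x
    change psiFun s (r • b.1) x = r • psiFun s b.1 x
    by_cases hx : x ∈ s.carrier <;> simp [psiFun, hx])

variable (S : InverseSubsemigroup (OpenBisection X))

/-- `Γ_c(𝒞)`: the finitely supported sections of the bundle over `S` with fibres
`C_s = {b ∈ Γ_c(𝒜) : supp b ⊆ r(s)}`. -/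
abbrev SecC (_α : GroupoidAction A) : Type _ := ⨁ s : S, gammaSupp A s.1.rSet

open Classical in
/-- The map `Ψ : Γ_c(𝒞) → Γ_c(r^*𝒜)`, given on generators by `psiFib`. -/
def Psi : α.SecC S →ₗ[ℂ] α.ConvAlg :=
  DirectSum.toModule ℂ S α.ConvAlg fun s => α.psiFib s.1

/-- The inclusion of the fibre `C_s` into the fibre `B_{r(s)}`, the range of `β_s`. -/
def inclFib (hS : S.IsFull) (s : S) :
    gammaSupp A s.1.rSet →ₗ[ℂ] ((α.assoc S hS).toFun s).ran where
  toFun b := ⟨b.1, fun _ hu => vanish_of_notMem_closure (f := fun u => b.1 u) fun h => hu (b.2.2 h)⟩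
  map_add' _ _ := rfl
  map_smul' _ _ := rfl

open Classical in
/-- The inclusion of `Γ_c(𝒞)` into `Γ_c(r^*ℬ)`, which sends `(b, s)` to `(b, s)`. -/
def inclC (hS : S.IsFull) : α.SecC S →ₗ[ℂ] (α.assoc S hS).FinSec :=
  DirectSum.toModule ℂ S _ fun s =>
    (InvAction.FinSec.gen (β := α.assoc S hS) s).comp (α.inclFib S hS s)

end GroupoidAction

end Convolution

end

end GpdCStar

open GpdCStar

/-!
The map `Ψ` identifies the convolution algebra `Γ_c(r^*𝒜)` with the quotient of `Γ_c(𝒞)` by the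
relations `(b, r) = (b, s)` for `r ⊆ s`, and these relations hold in the crossed product. The two
`C*`-algebras are then completions of the same `*`-algebra, and the point is to see that the norms
agree.

Bound of the enveloping norm. For `f = Ψ(b, s)` the product `f f*` is the section `b b*` over the
unit space, and every `C*`-seminorm is dominated by the norm on the `C*`-algebra of sections that
vanish off the support of `b`. So every `C*`-seminorm is at most `‖b‖` at `Ψ(b, s)`
(`seminorm_psiFib_le`), and since the `Ψ(b, s)` span, the enveloping `C*`-algebra exists
(`hasEnveloping`). The same estimate extends `b ↦ Ψ(b, s)` from compactly supported sections to all
of `B_{r(s)}`, which gives a `*`-homomorphism of `Γ_c(r^*ℬ)` into the enveloping `C*`-algebra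
(`finSecHom`) that is given by a `*`-homomorphism of `Γ_0(𝒜)` on the fibres over idempotents
(`diagHom`).

From the crossed product to the enveloping algebra. A `*`-homomorphism of `Γ_c(r^*ℬ)` with dense
range that comes from a `*`-homomorphism of `B` on the fibres over idempotents is bounded by the
norm of the crossed product (`InvAction.norm_le_crossedSeminorm`). To see this, compose it with a
nondegenerate representation that attains the norm of a given element (`exists_representation`, a
GNS representation). The result `W` is the integrated form of a covariant representation `(π, U)`:
as `W(b, s)* W(b', s)` is determined by `π`, there is a partial isometry `U_s` with
`U_s π(a) = W(β_s(a), s)` that vanishes on the vectors killed by the domain of `β_s`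
(`ExtendsDiag.exists_U`, `ExtendsDiag.covariantRep`).

From the enveloping algebra to the crossed product. In a covariant representation
`π(b) U_r = π(b) U_s` for `r ≤ s` and `b ∈ B_{r(r)}` (`InvAction.toCrossed_gen_eq`). By a partition
of unity, a family of linear maps on the spaces `C_s` that is compatible with inclusions `r ⊆ s`
factors through `Ψ` (`exists_linearMap_of_compatible`). So `Ψ(b, s) ↦ [b, s]` is a well-defined
`*`-homomorphism (`exists_starAlgHom_toCrossed`), which extends to the enveloping `C*`-algebra.

The two homomorphisms are inverse to each other on the images of `Γ_c(𝒞)`, which are dense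
(`denseRange_toCrossed_inclC`); density also gives uniqueness.
-/

namespace GpdCStar

open Topology Filter CategoryTheory DirectSum

set_option linter.unusedSectionVars false

noncomputable section

/-! ### Representations of `C*`-algebras -/

section Representations

universe u

open scoped ComplexOrder InnerProductSpace

/-- Nonnegative elements span, and each of them is the square of its square root. -/
theorem mem_span_mul {C : Type*} [NonUnitalCStarAlgebra C] (x : C) :
    x ∈ Submodule.span ℂ {z : C | ∃ a b, z = a * b} := by
  let _ := CStarAlgebra.spectralOrder C
  let _ := CStarAlgebra.spectralOrderedRing C
  have h : x ∈ Submodule.span ℂ {a : C | 0 ≤ a} := by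
    rw [CStarAlgebra.span_nonneg]; trivial
  refine Submodule.span_mono ?_ h
  intro a ha
  exact ⟨CFC.sqrt a, CFC.sqrt a, (CFC.sqrt_mul_sqrt_self a ha).symm⟩

/-- A functional of norm at most one with `f 1 = 1` has nonnegative real part on nonnegative
elements, since `‖‖b‖ - b‖ ≤ ‖b‖` for `b ≥ 0`. -/
theorem re_nonneg_of_norm_le_one {C : Type*} [CStarAlgebra C] [PartialOrder C] [StarOrderedRing C]
    (f : StrongDual ℂ C) (hf : ‖f‖ ≤ 1) (h1 : f 1 = 1) {b : C} (hb : 0 ≤ b) : 0 ≤ (f b).re := by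
  have h2 : ‖algebraMap ℝ C ‖b‖ - b‖ ≤ ‖b‖ := by
    have h3 : 0 ≤ algebraMap ℝ C ‖b‖ - b :=
      sub_nonneg.2 (IsSelfAdjoint.le_algebraMap_norm_self (.of_nonneg hb))
    rw [CStarAlgebra.norm_le_iff_le_algebraMap _ (norm_nonneg b) h3]
    exact sub_le_self _ hb
  have h3 : ‖f (algebraMap ℝ C ‖b‖ - b)‖ ≤ ‖b‖ :=
    (f.le_opNorm _).trans ((mul_le_of_le_one_left (norm_nonneg _) hf).trans h2)
  have h4 : f (algebraMap ℝ C ‖b‖ - b) = ‖b‖ - f b := by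
    rw [map_sub, Algebra.algebraMap_eq_smul_one, ← Complex.coe_smul, map_smul, h1]
    simp
  rw [h4] at h3
  have h5 := (Complex.re_le_norm _).trans h3
  simp only [Complex.sub_re, Complex.ofReal_re] at h5
  linarith

/-- For a self-adjoint element `b` there is a functional `f` of norm at most one with `f 1 = 1`
that extends a character of the `C*`-algebra generated by `b` and attains the norm at `b²`. -/
theorem exists_functional {C : Type*} [CStarAlgebra C] [Nontrivial C] (b : C)
    (hb : IsSelfAdjoint b) :
    ∃ f : StrongDual ℂ C, ‖f‖ ≤ 1 ∧ f 1 = 1 ∧ f (b * b) = (‖b‖ : ℂ) ^ 2 := by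
  have : IsStarNormal b := hb.isStarNormal
  let E := StarAlgebra.elemental ℂ b
  let b' : E := ⟨b, StarAlgebra.elemental.self_mem ℂ b⟩
  have h1 : ‖WeakDual.gelfandTransform ℂ E b'‖ = ‖b'‖ :=
    (gelfandTransform_isometry E).norm_map_of_map_zero (map_zero _) b'
  obtain ⟨χ, hχ⟩ : ∃ χ : WeakDual.characterSpace ℂ E,
      ‖WeakDual.gelfandTransform ℂ E b' χ‖ = ‖b‖ := by
    obtain ⟨χ, -, hχ⟩ := isCompact_univ.exists_isMaxOn Set.univ_nonempty
      (WeakDual.gelfandTransform ℂ E b').continuous.norm.continuousOn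
    refine ⟨χ, le_antisymm ((ContinuousMap.norm_coe_le_norm _ χ).trans h1.le) ?_⟩
    exact h1.ge.trans ((ContinuousMap.norm_le _ (norm_nonneg _)).2 fun ψ => hχ (Set.mem_univ ψ))
  rw [WeakDual.gelfandTransform_apply_apply] at hχ
  let χ' : StrongDual ℂ E := WeakDual.toStrongDual χ.1
  obtain ⟨f, hf, hfn⟩ := exists_extension_norm_eq
    (Subalgebra.toSubmodule E.toSubalgebra) χ'
  refine ⟨f, ?_, ?_, ?_⟩
  · rw [hfn]
    exact WeakDual.CharacterSpace.norm_le_norm_one χ |>.trans (by simp)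
  · exact (hf (1 : E)).trans (map_one χ)
  · have h2 : star b' = b' := Subtype.ext hb
    have h3 : f (b * b) = χ (b' * b') := hf (b' * b')
    rw [h3, map_mul]
    have h4 : χ b' = star (χ b') := by
      conv_lhs => rw [← h2]
      exact map_star χ b'
    nth_rw 1 [h4]
    rw [← hχ, Complex.star_def, ← Complex.normSq_eq_conj_mul_self, Complex.normSq_eq_norm_sq]
    push_cast
    rfl

/-- For a self-adjoint element `b` there is a positive functional of norm at most one with value
`‖b‖²` at `b²`: the restriction of the functional of `exists_functional` on the unitization,
averaged with its adjoint so that it is real on self-adjoint elements. -/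
theorem exists_positive_functional {C : Type*} [NonUnitalCStarAlgebra C] [PartialOrder C]
    [StarOrderedRing C] (b : C) (hb : IsSelfAdjoint b) :
    ∃ φ : C →ₚ[ℂ] ℂ, (∀ c, ‖φ c‖ ≤ ‖c‖) ∧ φ (b * b) = (‖b‖ : ℂ) ^ 2 := by
  let _ := CStarAlgebra.spectralOrder (Unitization ℂ C)
  let _ := CStarAlgebra.spectralOrderedRing (Unitization ℂ C)
  obtain ⟨f, hf, h1, hfb⟩ := exists_functional (b : Unitization ℂ C) (by
    rw [IsSelfAdjoint, ← Unitization.inr_star, hb.star_eq])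
  rw [← Unitization.inr_mul, Unitization.norm_inr] at hfb
  let j : C →⋆ₙₐ[ℂ] Unitization ℂ C := Unitization.inrNonUnitalStarAlgHom ℂ C
  have hj : ∀ c, j c = (c : Unitization ℂ C) := fun _ => rfl
  let g : C →ₗ[ℂ] ℂ :=
    { toFun := fun c => (f (j c) + star (f (j (star c)))) / 2
      map_add' := fun c d => by simp only [map_add, star_add]; ring
      map_smul' := fun r c => by
        simp only [map_smul, star_smul, smul_eq_mul, star_mul', star_star, RingHom.id_apply]
        ring }
  have hg : ∀ c, g c = (f (j c) + star (f (j (star c)))) / 2 := fun _ => rfl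
  have hfle : ∀ c, ‖f (j c)‖ ≤ ‖c‖ := fun c => by
    refine (f.le_opNorm _).trans ((mul_le_of_le_one_left (norm_nonneg _) hf).trans ?_)
    rw [hj, Unitization.norm_inr]
  refine ⟨PositiveLinearMap.mk₀ g fun c hc => ?_, fun c => ?_, ?_⟩
  · have h2 : 0 ≤ (f (j c)).re := re_nonneg_of_norm_le_one f hf h1 (map_nonneg j hc)
    rw [hg, (IsSelfAdjoint.of_nonneg hc).star_eq, Complex.star_def, Complex.add_conj]
    rw [← Complex.ofReal_ofNat, ← Complex.ofReal_div, Complex.zero_le_real]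
    linarith
  · change ‖g c‖ ≤ _
    rw [hg, norm_div, Complex.norm_ofNat, div_le_iff₀ two_pos]
    refine (norm_add_le _ _).trans ?_
    rw [norm_star]
    have := hfle (star c)
    rw [norm_star] at this
    linarith [hfle c]
  · change g (b * b) = _
    rw [hg, star_mul, hb.star_eq, hj, hfb]
    simp [← Complex.ofReal_pow]

/-- The norm of an element of a `C*`-algebra is attained in a nondegenerate representation: the GNS
representation of a positive functional that attains the norm at `(x x*)²`, with the class of `x*`
as test vector. -/
theorem exists_representation {C : Type u} [NonUnitalCStarAlgebra C] (x : C) :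
    ∃ (H : Type u) (_ : NormedAddCommGroup H) (_ : InnerProductSpace ℂ H) (_ : CompleteSpace H)
      (ρ : C →⋆ₙₐ[ℂ] (H →L[ℂ] H)), (∀ η, (∀ c, ρ c η = 0) → η = 0) ∧ ‖x‖ ≤ ‖ρ x‖ := by
  let _ := CStarAlgebra.spectralOrder C
  let _ := CStarAlgebra.spectralOrderedRing C
  obtain ⟨φ, hφ, hφb⟩ := exists_positive_functional (x * star x) (.mul_star_self x)
  refine ⟨φ.GNS, inferInstance, inferInstance, inferInstance, φ.gnsNonUnitalStarAlgHom, ?_, ?_⟩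
  · intro η hη
    have h1 : ∀ z : C, ⟪η, (φ.toPreGNS z : φ.GNS)⟫_ℂ = 0 := by
      intro z
      induction mem_span_mul z using Submodule.span_induction with
      | zero => rw [map_zero, UniformSpace.Completion.coe_zero, inner_zero_right]
      | add y z _ _ hy hz => simp [UniformSpace.Completion.coe_add, inner_add_right, hy, hz]
      | smul c z _ hz => simp [UniformSpace.Completion.coe_smul, inner_smul_right, hz]
      | mem z hz =>
        obtain ⟨a, b, rfl⟩ := hz
        have h2 : (φ.toPreGNS (a * b) : φ.GNS) =
            φ.gnsNonUnitalStarAlgHom a (φ.toPreGNS b : φ.GNS) := by simp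
        have h3 := ContinuousLinearMap.adjoint_inner_left (φ.gnsNonUnitalStarAlgHom a)
          (φ.toPreGNS b : φ.GNS) η
        rw [← ContinuousLinearMap.star_eq_adjoint, ← map_star, hη, inner_zero_left] at h3
        rw [h2, ← h3]
    have h2 : ∀ ζ : φ.GNS, ⟪η, ζ⟫_ℂ = 0 := fun ζ =>
      UniformSpace.Completion.induction_on ζ (isClosed_eq (by fun_prop) continuous_const) h1
    exact inner_self_eq_zero.1 (h2 η)
  · set ξ : φ.GNS := (φ.toPreGNS (star x) : φ.GNS) with hξ
    have h1 : ‖ξ‖ ^ 2 ≤ ‖x‖ ^ 2 := by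
      have h2 := φ.preGNS_norm_sq (φ.toPreGNS (star x))
      rw [← UniformSpace.Completion.norm_coe, ← hξ, PositiveLinearMap.ofPreGNS_toPreGNS,
        star_star] at h2
      have h3 := hφ (x * star x)
      rw [← h2, CStarRing.norm_self_mul_star] at h3
      simpa [sq] using h3
    have h2 : ‖φ.gnsNonUnitalStarAlgHom x ξ‖ ^ 2 = (‖x‖ ^ 2) ^ 2 := by
      have h3 : φ.gnsNonUnitalStarAlgHom x ξ = (φ.toPreGNS (x * star x) : φ.GNS) := by
        simp [hξ]
      have h4 := φ.preGNS_norm_sq (φ.toPreGNS (x * star x))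
      rw [← UniformSpace.Completion.norm_coe, ← h3, PositiveLinearMap.ofPreGNS_toPreGNS,
        (IsSelfAdjoint.mul_star_self x).star_eq, hφb, CStarRing.norm_self_mul_star, ← sq] at h4
      exact_mod_cast h4
    have h3 := (φ.gnsNonUnitalStarAlgHom x).le_opNorm ξ
    have h4 : ‖ξ‖ ≤ ‖x‖ := (sq_le_sq₀ (norm_nonneg _) (norm_nonneg _)).1 h1
    have h5 : ‖φ.gnsNonUnitalStarAlgHom x ξ‖ = ‖x‖ ^ 2 :=
      (pow_left_inj₀ (norm_nonneg _) (sq_nonneg _) two_ne_zero).1 h2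
    rw [h5] at h3
    rcases (norm_nonneg x).eq_or_lt with h0 | h0
    · rw [← h0]; exact norm_nonneg _
    · have h6 := h3.trans (mul_le_mul_of_nonneg_left h4 (norm_nonneg _))
      rw [sq] at h6
      exact le_of_mul_le_mul_right h6 h0

end Representations

/-! ### Maps out of Hausdorff completions -/

section Lift

variable {D : Type*} [NonUnitalRing D] [StarRing D] [Module ℂ D] [IsScalarTower ℂ D D]
  [SMulCommClass ℂ D D] [StarModule ℂ D] {C : Type*} [NonUnitalCStarAlgebra C]

theorem CStarSeminorm.le_sup {P : Set (CStarSeminorm D)}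
    (hP : ∀ a : D, BddAbove ((fun p : CStarSeminorm D => p a) '' P)) {p : CStarSeminorm D}
    (hp : p ∈ P) (a : D) : p a ≤ CStarSeminorm.sup P hP a :=
  le_csSup (hP a) ⟨p, hp, rfl⟩

/-- The extension of a `*`-homomorphism that is bounded by the seminorm `p` to the Hausdorff
completion for `p`. -/
def HausdorffCompletion.lift (p : CStarSeminorm D) (φ : D →⋆ₙₐ[ℂ] C) (h : ∀ a, ‖φ a‖ ≤ p a) :
    HausdorffCompletion p →⋆ₙₐ[ℂ] C :=
  let F : HausdorffCompletion p →L[ℂ] C :=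
    LinearMap.extendOfNorm (φ : D →ₗ[ℂ] C) (toCompletion p : D →ₗ[ℂ] HausdorffCompletion p)
  have hF : ∀ a, F (toCompletion p a) = φ a :=
    LinearMap.extendOfNorm_eq (denseRange_toCompletion p)
      ⟨1, fun a => by
        change ‖φ a‖ ≤ 1 * ‖toCompletion p a‖
        rw [norm_toCompletion, one_mul]; exact h a⟩
  { F with
    map_zero' := map_zero F
    map_mul' := fun a b => by
      refine (denseRange_toCompletion p).induction_on₂
        (p := fun a b => F (a * b) = F a * F b) (isClosed_eq ?_ ?_) (fun a b => ?_) a b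
      · exact F.continuous.comp continuous_mul
      · exact (F.continuous.comp continuous_fst).mul (F.continuous.comp continuous_snd)
      · rw [← map_mul, hF, hF, hF, map_mul]
    map_star' := fun a => by
      refine (denseRange_toCompletion p).induction_on
        (p := fun a => F (star a) = star (F a)) a (isClosed_eq ?_ ?_) (fun a => ?_)
      · exact F.continuous.comp continuous_star
      · exact continuous_star.comp F.continuous
      · rw [← map_star, hF, hF, map_star] }

theorem HausdorffCompletion.lift_toCompletion (p : CStarSeminorm D) (φ : D →⋆ₙₐ[ℂ] C)
    (h : ∀ a, ‖φ a‖ ≤ p a) (a : D) :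
    HausdorffCompletion.lift p φ h (toCompletion p a) = φ a :=
  LinearMap.extendOfNorm_eq (f := (φ : D →ₗ[ℂ] C))
    (e := (toCompletion p : D →ₗ[ℂ] HausdorffCompletion p)) (denseRange_toCompletion p)
    ⟨1, fun a => by
      change ‖φ a‖ ≤ 1 * ‖toCompletion p a‖
      rw [norm_toCompletion, one_mul]; exact h a⟩ a

theorem continuous_starAlgHom {C' : Type*} [NonUnitalCStarAlgebra C'] (φ : C →⋆ₙₐ[ℂ] C') :
    Continuous φ :=
  AddMonoidHomClass.continuous_of_bound φ 1 fun a => by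
    rw [one_mul]; exact NonUnitalStarAlgHom.norm_apply_le φ a

end Lift

/-! ### Covariant representations from representations of finite sections -/

section Disintegration

open scoped InnerProductSpace

variable {H : Type*} [NormedAddCommGroup H] [InnerProductSpace ℂ H] [CompleteSpace H]

/-- Two families of vectors with the same Gram matrix are related by a partial isometry whose
initial and final spaces are the closed spans of the families. -/
theorem exists_partialIsometry {ι : Type*} (x y : ι → H) (h : ∀ i j, ⟪x i, x j⟫_ℂ = ⟪y i, y j⟫_ℂ) :
    ∃ U : H →L[ℂ] H, (∀ i, U (x i) = y i) ∧ (∀ η, (∀ i, ⟪x i, η⟫_ℂ = 0) → U η = 0) ∧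
      ∀ η ζ, (∀ i, ⟪y i, ζ⟫_ℂ = 0) → ⟪U η, ζ⟫_ℂ = 0 := by
  let f : (ι →₀ ℂ) →ₗ[ℂ] H := Finsupp.linearCombination ℂ x
  let g : (ι →₀ ℂ) →ₗ[ℂ] H := Finsupp.linearCombination ℂ y
  let K : Submodule ℂ H := (LinearMap.range f).topologicalClosure
  have hfK : ∀ c, f c ∈ K := fun c => Submodule.le_topologicalClosure _ (LinearMap.mem_range_self f c)
  let e : (ι →₀ ℂ) →ₗ[ℂ] K := f.codRestrict K hfK
  have hK : IsClosed (K : Set H) := Submodule.isClosed_topologicalClosure _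
  have : CompleteSpace K := hK.completeSpace_coe
  have he : DenseRange e := by
    intro z
    have hz : (z : H) ∈ closure (LinearMap.range f : Set H) := z.2
    rw [closure_subtype]
    refine closure_mono ?_ hz
    rintro _ ⟨c, rfl⟩
    exact ⟨_, ⟨c, rfl⟩, rfl⟩
  have hin : ∀ c, ‖g c‖ = ‖f c‖ := by
    intro c
    have h1 : ⟪f c, f c⟫_ℂ = ⟪g c, g c⟫_ℂ := by
      simp only [f, g, Finsupp.linearCombination_apply, Finsupp.sum]
      simp only [sum_inner, inner_sum, inner_smul_left, inner_smul_right, h]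
    rw [@norm_eq_sqrt_re_inner ℂ, @norm_eq_sqrt_re_inner ℂ, h1]
  have hb : ∃ C, ∀ c, ‖g c‖ ≤ C * ‖e c‖ := ⟨1, fun c => by rw [one_mul, hin]; rfl⟩
  let F : K →L[ℂ] H := g.extendOfNorm e
  have hF : ∀ c, F (e c) = g c := LinearMap.extendOfNorm_eq he hb
  have hU : ∀ η, (F ∘L K.orthogonalProjectionOnto) η = F (K.orthogonalProjectionOnto η) := fun _ => rfl
  refine ⟨F ∘L K.orthogonalProjectionOnto, fun i => ?_, fun η hη => ?_, fun η ζ hζ => ?_⟩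
  · have h1 : e (Finsupp.single i 1) = ⟨x i, by simpa [f] using hfK (Finsupp.single i 1)⟩ :=
      Subtype.ext (by simp [e, f])
    rw [hU, Submodule.orthogonalProjectionOnto_mem_subspace_eq_self (K := K)
      ⟨x i, by simpa [f] using hfK (Finsupp.single i 1)⟩, ← h1, hF]
    simp [g]
  · have h1 : η ∈ Kᗮ := by
      rw [Submodule.orthogonal_closure]
      rintro _ ⟨c, rfl⟩
      simp [f, Finsupp.linearCombination_apply, Finsupp.sum, sum_inner, inner_smul_left, hη]
    rw [hU, Submodule.orthogonalProjectionOnto_apply_of_mem_orthogonal h1, map_zero]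
  · rw [hU]
    refine he.induction_on (p := fun k => ⟪F k, ζ⟫_ℂ = 0) _
      (isClosed_eq (by fun_prop) continuous_const) fun c => ?_
    rw [hF]
    simp [g, Finsupp.linearCombination_apply, Finsupp.sum, hζ]

/-- A continuous linear map is determined by its values on a family of vectors and on the vectors
orthogonal to it. -/
theorem clm_ext_of_orthogonal {ι : Type*} (x : ι → H) {T T' : H →L[ℂ] H}
    (h1 : ∀ i, T (x i) = T' (x i)) (h2 : ∀ η, (∀ i, ⟪x i, η⟫_ℂ = 0) → T η = T' η) : T = T' := by
  let K : Submodule ℂ H := (Submodule.span ℂ (Set.range x)).topologicalClosure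
  have hK : IsClosed (K : Set H) := Submodule.isClosed_topologicalClosure _
  have : CompleteSpace K := hK.completeSpace_coe
  have h3 : ∀ k ∈ K, T k = T' k := by
    intro k hk
    have h4 : K ≤ LinearMap.eqLocus (T : H →ₗ[ℂ] H) (T' : H →ₗ[ℂ] H) := by
      refine Submodule.topologicalClosure_minimal _ (Submodule.span_le.2 ?_)
        (isClosed_eq T.continuous T'.continuous)
      rintro _ ⟨i, rfl⟩
      exact h1 i
    exact h4 hk
  ext η
  obtain ⟨k, hk, m, hm, rfl⟩ := K.exists_add_mem_mem_orthogonal η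
  rw [map_add, map_add, h3 k hk, h2 m]
  intro i
  exact hm _ (Submodule.le_topologicalClosure _ (Submodule.subset_span ⟨i, rfl⟩))

theorem dense_of_orthogonal_eq_zero {E : Submodule ℂ H}
    (h : ∀ η, (∀ ξ ∈ E, ⟪ξ, η⟫_ℂ = 0) → η = 0) : Dense (E : Set H) := by
  rw [Submodule.dense_iff_topologicalClosure_eq_top, Submodule.topologicalClosure_eq_top_iff,
    Submodule.eq_bot_iff]
  exact fun η hη => h η hη

variable {S : Type*} [InverseSemigroup S] {B : Type*} [NonUnitalCStarAlgebra B] {β : InvAction S B}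

namespace InvAction

open FinSec

theorem mem_ran_idem {e : S} (he : IsIdempotentElem e) {b : B} : b ∈ (β e).ran ↔ b ∈ (β e).dom := by
  constructor
  · intro h
    have h1 := (β e).rel_symm ⟨b, h⟩
    have h2 := β.rel_idem he h1
    simp only at h2
    rw [h2]
    exact h1.mem_dom
  · intro h
    have h1 := (β e).rel_equiv ⟨b, h⟩
    have h2 := β.rel_idem he h1
    simp only at h2
    rw [← h2]
    exact h1.mem_ran

theorem mem_ran_mul_star {s : S} {b : B} (h : b ∈ (β s).ran) : b ∈ (β (s * star s)).ran :=
  (mem_ran_idem (InverseSemigroup.idem_mul_star s)).2 (β.mem_ran_iff.1 h)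

theorem mem_ran_star_mul {s : S} {b : B} (h : b ∈ (β s).dom) : b ∈ (β (star s * s)).ran :=
  (mem_ran_idem (InverseSemigroup.idem_star_mul s)).2 (β.mem_dom_star_mul.2 h)

theorem rel_mul_star {s : S} {b : B} (h : b ∈ (β s).ran) : (β (s * star s)).Rel b b := by
  have h1 := (β _).rel_symm ⟨b, mem_ran_mul_star h⟩
  have h2 := β.rel_idem (InverseSemigroup.idem_mul_star s) h1
  simp only at h1 h2
  rwa [← h2] at h1

theorem rel_star_mul {s : S} {b : B} (h : b ∈ (β s).dom) : (β (star s * s)).Rel b b := by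
  have h1 := (β _).rel_symm ⟨b, mem_ran_star_mul h⟩
  have h2 := β.rel_idem (InverseSemigroup.idem_star_mul s) h1
  simp only at h1 h2
  rwa [← h2] at h1

/-- The product of generators, expressed through the graph of `β_s`. -/
theorem gen_mul_eq {s t r : S} (hr : s * t = r) {a b c d : B} (h1 : (β s).Rel a b)
    (hc : c ∈ (β t).ran) (h2 : (β s).Rel (a * c) d) (hd : d ∈ (β r).ran) :
    gen s ⟨b, h1.mem_ran⟩ * gen t ⟨c, hc⟩ = gen r ⟨d, hd⟩ := by
  rw [gen_mul_gen]
  refine gen_congr hr _ _ ?_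
  have h3 := mulVal_rel s t ⟨b, h1.mem_ran⟩ ⟨c, hc⟩
  have h4 := ((β s).rel_symm ⟨b, h1.mem_ran⟩).inj h1
  rw [h4] at h3
  exact h3.unique h2

/-- The adjoint of a generator, expressed through the graph of `β_s`. -/
theorem star_gen_eq {s : S} {a b : B} (h : (β s).Rel a b) :
    star (gen s ⟨b, h.mem_ran⟩) = gen (star s) ⟨star a, β.mem_ran_star.2 h.star.mem_dom⟩ := by
  rw [star_gen]
  exact gen_congr rfl _ _ ((starVal_rel s ⟨b, h.mem_ran⟩).inj h.star)

variable (W : β.FinSec →⋆ₙₐ[ℂ] (H →L[ℂ] H)) (π : B →⋆ₙₐ[ℂ] (H →L[ℂ] H))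

variable (β) in
/-- The restriction of the representation `W` of the finite sections to the fibres over idempotents
is given by the representation `π`. -/
def ExtendsDiag (W : β.FinSec →⋆ₙₐ[ℂ] (H →L[ℂ] H)) (π : B →⋆ₙₐ[ℂ] (H →L[ℂ] H)) : Prop :=
  ∀ (e : S), IsIdempotentElem e → ∀ b : (β e).ran, W (gen e b) = π b

variable {W π}

namespace ExtendsDiag

theorem W_idem (hW : β.ExtendsDiag W π) {e : S} (he : IsIdempotentElem e) {b : B}
    (hb : b ∈ (β e).ran) : W (gen e ⟨b, hb⟩) = π b := hW e he ⟨b, hb⟩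

theorem W_star {s : S} {a b : B} (h : (β s).Rel a b) :
    star (W (gen s ⟨b, h.mem_ran⟩)) =
      W (gen (star s) ⟨star a, β.mem_ran_star.2 h.star.mem_dom⟩) := by
  rw [← map_star, star_gen_eq h]

theorem W_mul_W {s t r : S} (hr : s * t = r) {a b c d : B} (h1 : (β s).Rel a b)
    (hc : c ∈ (β t).ran) (h2 : (β s).Rel (a * c) d) (hd : d ∈ (β r).ran) :
    W (gen s ⟨b, h1.mem_ran⟩) * W (gen t ⟨c, hc⟩) = W (gen r ⟨d, hd⟩) := by
  rw [← map_mul, gen_mul_eq hr h1 hc h2 hd]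

/-- `W(b, s) W(b, s)* = π(b b*)`. -/
theorem W_mul_star (hW : β.ExtendsDiag W π) {s : S} {b : B} (hb : b ∈ (β s).ran) :
    W (gen s ⟨b, hb⟩) * star (W (gen s ⟨b, hb⟩)) = π (b * star b) := by
  have h1 := (β s).rel_symm ⟨b, hb⟩
  rw [W_star h1, W_mul_W rfl h1 _ (h1.mul h1.star)
    (mem_ran_mul_star ((β s).ran_ideal.mul_mem_right _ hb)),
    hW.W_idem (InverseSemigroup.idem_mul_star s)]

/-- `W(b, s)* W(b, s) = π(a* a)` when `β_s(a) = b`. -/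
theorem star_mul_W (hW : β.ExtendsDiag W π) {s : S} {a a' b b' : B} (h : (β s).Rel a b)
    (h' : (β s).Rel a' b') :
    star (W (gen s ⟨b', h'.mem_ran⟩)) * W (gen s ⟨b, h.mem_ran⟩) = π (star a' * a) := by
  rw [W_star h', W_mul_W rfl (β.rel_star.2 h'.star) h.mem_ran (β.rel_star.2 (h'.star.mul h))
    (mem_ran_star_mul (h'.star.mul h).mem_dom), hW.W_idem (InverseSemigroup.idem_star_mul s)]

/-- `π(c) W(b, s) = W(cb, s)` for `c` in the range of `β_s`. -/
theorem π_mul_W (hW : β.ExtendsDiag W π) {s : S} {b c : B} (hb : b ∈ (β s).ran)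
    (hc : c ∈ (β s).ran) :
    π c * W (gen s ⟨b, hb⟩) = W (gen s ⟨c * b, mul_mem hc hb⟩) := by
  have h1 := rel_mul_star hc
  have h2 := rel_mul_star (mul_mem hc hb)
  rw [← hW.W_idem (InverseSemigroup.idem_mul_star s) h1.mem_ran]
  exact W_mul_W (InverseSemigroup.mul_star_mul s) h1 hb h2 _

/-- `W(b, s) π(c) = W(bβ_s(c), s)` for `c` in the domain of `β_s`. -/
theorem W_mul_π (hW : β.ExtendsDiag W π) {s : S} {b c d : B} (hb : b ∈ (β s).ran)
    (h : (β s).Rel c d) :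
    W (gen s ⟨b, hb⟩) * π c = W (gen s ⟨b * d, mul_mem hb h.mem_ran⟩) := by
  have h1 := (β s).rel_symm ⟨b, hb⟩
  have h2 := rel_star_mul h.mem_dom
  rw [← hW.W_idem (InverseSemigroup.idem_star_mul s) h2.mem_ran]
  exact W_mul_W (by rw [← mul_assoc, InverseSemigroup.mul_star_mul]) h1 _ (h1.mul h) _

theorem eq_zero_of_star_mul {T : H →L[ℂ] H} {η : H} (h : (star T * T) η = 0) : T η = 0 := by
  have h1 := ContinuousLinearMap.adjoint_inner_left T η (T η)
  rw [ContinuousLinearMap.star_eq_adjoint] at h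
  rw [mul_apply_eq_comp] at h
  rw [h, inner_zero_left] at h1
  exact inner_self_eq_zero.1 h1.symm

theorem W_apply_eq_zero (hW : β.ExtendsDiag W π) {s : S} {a b : B} (h : (β s).Rel a b) {η : H}
    (hη : π (star a * a) η = 0) : W (gen s ⟨b, h.mem_ran⟩) η = 0 := by
  refine eq_zero_of_star_mul ?_
  rw [hW.star_mul_W h h]
  exact hη

theorem star_W_apply_eq_zero (hW : β.ExtendsDiag W π) {s : S} {b : B} (hb : b ∈ (β s).ran) {η : H}
    (hη : π (b * star b) η = 0) : star (W (gen s ⟨b, hb⟩)) η = 0 := by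
  refine eq_zero_of_star_mul ?_
  rw [star_star, hW.W_mul_star hb]
  exact hη

theorem forall_inner_π {J : NonUnitalStarSubalgebra ℂ B} {η : H} :
    (∀ i : J × H, ⟪π i.1 i.2, η⟫_ℂ = 0) ↔ ∀ a ∈ J, π a η = 0 := by
  have h1 : ∀ (a : B) (ξ : H), ⟪π a ξ, η⟫_ℂ = ⟪ξ, π (star a) η⟫_ℂ := fun a ξ => by
    rw [map_star, ContinuousLinearMap.star_eq_adjoint, ContinuousLinearMap.adjoint_inner_right]
  constructor
  · intro h a ha
    refine inner_self_eq_zero (𝕜 := ℂ).1 ?_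
    have h2 := h (⟨star a, star_mem ha⟩, π a η)
    rwa [h1, star_star] at h2
  · rintro h ⟨⟨a, ha⟩, ξ⟩
    rw [h1, h _ (star_mem ha), inner_zero_right]

/-- An operator is determined by its values on the vectors `π(a) ξ`, with `a` in a `*`-subalgebra
`J`, and on the vectors killed by `π(J)`. -/
theorem clm_ext {J : NonUnitalStarSubalgebra ℂ B} {T T' : H →L[ℂ] H}
    (h1 : ∀ a ∈ J, T * π a = T' * π a) (h2 : ∀ η, (∀ a ∈ J, π a η = 0) → T η = T' η) : T = T' :=
  clm_ext_of_orthogonal (fun i : J × H => π i.1 i.2)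
    (fun i => DFunLike.congr_fun (h1 i.1 i.1.2) i.2) fun η hη => h2 η (forall_inner_π.1 hη)

/-- The partial isometry `U_s` with `U_s π(a) ξ = W(β_s(a), s) ξ` for `a` in the domain of `β_s`. -/
theorem exists_U (hW : β.ExtendsDiag W π) (s : S) : ∃ U : H →L[ℂ] H,
    (∀ (a b : B) (h : (β s).Rel a b), U * π a = W (gen s ⟨b, h.mem_ran⟩)) ∧
    (∀ η, (∀ a ∈ (β s).dom, π a η = 0) → U η = 0) ∧
    (∀ η, (∀ a ∈ (β s).ran, π a η = 0) → star U η = 0) := by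
  obtain ⟨U, h1, h2, h3⟩ := exists_partialIsometry
    (fun i : (β s).dom × H => π i.1 i.2) (fun i => W (gen s ((β s).equiv i.1)) i.2) (by
      rintro ⟨a, ξ⟩ ⟨a', ξ'⟩
      have h := hW.star_mul_W ((β s).rel_equiv a') ((β s).rel_equiv a)
      have h' := DFunLike.congr_fun h ξ'
      simp only [mul_apply_eq_comp, map_mul, map_star] at h'
      rw [← ContinuousLinearMap.adjoint_inner_right, ← ContinuousLinearMap.adjoint_inner_right,
        ← ContinuousLinearMap.star_eq_adjoint, ← ContinuousLinearMap.star_eq_adjoint, ← h'])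
  refine ⟨U, ?_, fun η hη => h2 η (forall_inner_π.2 hη), fun η hη => ?_⟩
  · rintro a _ ⟨ha, rfl⟩
    ext ξ
    exact h1 (⟨a, ha⟩, ξ)
  · refine inner_self_eq_zero (𝕜 := ℂ).1 ?_
    rw [ContinuousLinearMap.star_eq_adjoint, ContinuousLinearMap.adjoint_inner_right]
    refine h3 _ _ fun i => ?_
    have h4 := hW.star_W_apply_eq_zero ((β s).equiv i.1).2 (η := η)
      (hη _ ((β s).ran_ideal.mul_mem_right _ ((β s).equiv i.1).2))
    rw [← ContinuousLinearMap.adjoint_inner_right, ← ContinuousLinearMap.star_eq_adjoint, h4,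
      inner_zero_right]

variable (hW : β.ExtendsDiag W π)

/-- The partial isometry of `exists_U`. -/
def U (s : S) : H →L[ℂ] H := (hW.exists_U s).choose

theorem U_mul_π {s : S} {a b : B} (h : (β s).Rel a b) :
    hW.U s * π a = W (gen s ⟨b, h.mem_ran⟩) := (hW.exists_U s).choose_spec.1 a b h

theorem U_eq_zero {s : S} {η : H} (h : ∀ a ∈ (β s).dom, π a η = 0) : hW.U s η = 0 :=
  (hW.exists_U s).choose_spec.2.1 η h

theorem star_U_eq_zero {s : S} {η : H} (h : ∀ a ∈ (β s).ran, π a η = 0) : star (hW.U s) η = 0 :=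
  (hW.exists_U s).choose_spec.2.2 η h

/-- `π(b) U_s = W(b, s)`, so that `W` is the integrated form of `(π, U)`. -/
theorem π_mul_U {s : S} {b : B} (hb : b ∈ (β s).ran) : π b * hW.U s = W (gen s ⟨b, hb⟩) := by
  refine clm_ext (π := π) (J := (β s).dom) (fun a ha => ?_) fun η hη => ?_
  · have h := (β s).rel_equiv ⟨a, ha⟩
    rw [mul_assoc, hW.U_mul_π h, hW.π_mul_W h.mem_ran hb, hW.W_mul_π hb h]
  · have h := (β s).rel_symm ⟨b, hb⟩
    rw [mul_apply_eq_comp, hW.U_eq_zero hη, map_zero,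
      hW.W_apply_eq_zero h (hη _ ((β s).dom_ideal.mul_mem_left _ h.mem_dom))]

theorem U_star (s : S) : hW.U (star s) = star (hW.U s) := by
  refine clm_ext (π := π) (J := (β (star s)).dom) (fun a ha => ?_) fun η hη => ?_
  · have h := (β (star s)).rel_equiv ⟨a, ha⟩
    have h' := β.rel_star.1 h
    have h2 := congrArg star (hW.π_mul_U (star_mem h'.mem_ran))
    rw [star_mul, W_star h'.star, ← map_star] at h2
    have h3 : π (star (star a)) = π a := by rw [star_star]
    rw [hW.U_mul_π h, ← h3, h2]
    exact congrArg W (gen_congr rfl _ _ (star_star _).symm)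
  · rw [hW.U_eq_zero hη, hW.star_U_eq_zero]
    intro a ha
    refine hη a ?_
    rw [← star_star s] at ha
    exact β.mem_ran_star.1 ha

/-- The products `a₁ a₂` with `a₁`, `a₂` in an ideal span the ideal, so the identity follows from
`U_s W(a₁ a₂, t) = U_s π(a₁) W(a₂, t)`. -/
theorem U_mul_W {s t : S} {a b : B} (h : (β s).Rel a b) (ha : a ∈ (β t).ran)
    (hb : b ∈ (β (s * t)).ran) :
    hW.U s * W (gen t ⟨a, ha⟩) = W (gen (s * t) ⟨b, hb⟩) := by
  let J : NonUnitalStarSubalgebra ℂ B := (β s).dom ⊓ (β t).ran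
  have : IsClosed (J : Set B) := (β s).dom_ideal.isClosed.inter (β t).ran_ideal.isClosed
  suffices key : ∀ x : J, ∀ (b : B) (_ : (β s).Rel x b) (hb : b ∈ (β (s * t)).ran),
      hW.U s * W (gen t ⟨x, x.2.2⟩) = W (gen (s * t) ⟨b, hb⟩) from
    key ⟨a, h.mem_dom, ha⟩ b h hb
  intro x
  have hran : ∀ {a b : B}, a ∈ (β t).ran → (β s).Rel a b → b ∈ (β (s * t)).ran := by
    intro a b ha h
    exact ((β.map_comp s t _ _).2 ⟨_, (β t).rel_symm ⟨a, ha⟩, h⟩).mem_ran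
  induction mem_span_mul x using Submodule.span_induction with
  | zero =>
    intro b hb hb'
    obtain rfl : b = 0 := by
      obtain ⟨h, rfl⟩ := hb
      exact congrArg Subtype.val (map_zero (β s).equiv)
    have e1 : gen t ⟨((0 : J) : B), (0 : J).2.2⟩ = 0 := map_zero (gen t)
    have e2 : gen (s * t) ⟨(0 : B), hb'⟩ = 0 := map_zero (gen (s * t))
    rw [e1, e2, map_zero, mul_zero]
  | add x y _ _ hx hy =>
    intro b hb hb'
    have h1 := (β s).rel_equiv ⟨x, x.2.1⟩
    have h2 := (β s).rel_equiv ⟨y, y.2.1⟩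
    have h3 := hb.unique (h1.add h2)
    have e1 : gen t ⟨((x + y : J) : B), (x + y).2.2⟩ =
        gen (β := β) t ⟨(x : B), x.2.2⟩ + gen t ⟨(y : B), y.2.2⟩ :=
      map_add (gen t) ⟨(x : B), x.2.2⟩ ⟨(y : B), y.2.2⟩
    have e2 : gen (s * t) ⟨b, hb'⟩ = gen (s * t) ⟨_, hran x.2.2 h1⟩ +
        gen (s * t) ⟨_, hran y.2.2 h2⟩ := by
      rw [← map_add]
      exact gen_congr rfl _ _ h3
    rw [e1, e2, map_add, map_add, mul_add, hx _ h1, hy _ h2]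
  | smul c x _ hx =>
    intro b hb hb'
    have h1 := (β s).rel_equiv ⟨x, x.2.1⟩
    have h3 := hb.unique (h1.smul c)
    have e1 : gen t ⟨((c • x : J) : B), (c • x).2.2⟩ =
        c • gen (β := β) t ⟨(x : B), x.2.2⟩ :=
      map_smul (gen t) c ⟨(x : B), x.2.2⟩
    have e2 : gen (s * t) ⟨b, hb'⟩ = c • gen (s * t) ⟨_, hran x.2.2 h1⟩ := by
      rw [← map_smul]
      exact gen_congr rfl _ _ h3
    rw [e1, e2, map_smul, map_smul, mul_smul_comm, hx _ h1]
  | mem x hx =>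
    obtain ⟨y, z, rfl⟩ := hx
    intro b hb hb'
    have h1 := (β s).rel_equiv ⟨y, y.2.1⟩
    have e1 := hW.π_mul_W z.2.2 y.2.2
    have e2 : gen (β := β) t ⟨((y * z : J) : B), (y * z).2.2⟩ =
        gen t ⟨(y : B) * z, mul_mem y.2.2 z.2.2⟩ := rfl
    rw [e2, ← e1, ← mul_assoc, hW.U_mul_π h1]
    exact W_mul_W rfl h1 z.2.2 hb hb'

/-- Both sides agree on the vectors `π(a) ξ` for `a` in the domain of `β_{st}`, and vanish on the
vectors killed by this domain. -/
theorem U_mul (s t : S) : hW.U (s * t) = hW.U s * hW.U t := by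
  refine clm_ext (π := π) (J := (β (s * t)).dom) (fun a ha => ?_) fun η hη => ?_
  · have h := (β (s * t)).rel_equiv ⟨a, ha⟩
    obtain ⟨b, h1, h2⟩ := (β.map_comp _ _ _ _).1 h
    rw [hW.U_mul_π h, mul_assoc, hW.U_mul_π h1, hW.U_mul_W h2 h1.mem_ran h.mem_ran]
  · rw [hW.U_eq_zero hη, mul_apply_eq_comp, hW.U_eq_zero]
    intro a ha
    -- The range ideal of `t` kills `π(a* a) U_t η`, hence so does `U_t*`, and
    -- `‖π(a) U_t η‖² = ⟪η, U_t* π(a* a) U_t η⟫ = 0`.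
    have h1 : ∀ c ∈ (β t).ran, c ∈ (β s).dom → π c (hW.U t η) = 0 := by
      intro c hc hcs
      have h2 := (β t).rel_symm ⟨c, hc⟩
      have h3 := hW.W_apply_eq_zero h2 (η := η) (hη _ ?_)
      · rwa [← hW.π_mul_U hc] at h3
      · exact (β _).dom_ideal.mul_mem_left _
          ((β.map_comp s t _ _).2 ⟨c, h2, (β s).rel_equiv ⟨c, hcs⟩⟩).mem_dom
    have h4 : star (hW.U t) (π (star a) (π a (hW.U t η))) = 0 := by
      refine hW.star_U_eq_zero fun c hc => ?_
      have h5 := h1 (c * star a * a) ((β t).ran_ideal.mul_mem_right _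
        ((β t).ran_ideal.mul_mem_right _ hc)) ((β s).dom_ideal.mul_mem_left _ ha)
      simpa only [map_mul, mul_apply_eq_comp] using h5
    refine inner_self_eq_zero (𝕜 := ℂ).1 ?_
    rw [← ContinuousLinearMap.adjoint_inner_right, ← ContinuousLinearMap.star_eq_adjoint,
      ← map_star, ← ContinuousLinearMap.adjoint_inner_right,
      ← ContinuousLinearMap.star_eq_adjoint, h4, inner_zero_right]

variable (hπ : ∀ η, (∀ b, π b η = 0) → η = 0)

/-- The covariant representation given by a nondegenerate representation of the finite sections and
its restriction to the diagonal. -/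
def covariantRep : CovariantRep β H where
  π := π
  U := ⟨hW.U, hW.U_mul⟩
  U_star := hW.U_star
  π_nondegenerate := dense_of_orthogonal_eq_zero fun η hη => by
    refine hπ η fun b => inner_self_eq_zero (𝕜 := ℂ).1 ?_
    rw [← ContinuousLinearMap.adjoint_inner_left, ← ContinuousLinearMap.star_eq_adjoint, ← map_star]
    exact hη _ (Submodule.subset_span ⟨_, _, rfl⟩)
  U_dense := dense_of_orthogonal_eq_zero fun η hη => by
    have h1 : ∀ (s : S), ∀ b ∈ (β s).dom, π b η = 0 := fun s =>
      forall_inner_π.1 fun i => by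
        have h := rel_star_mul i.1.2
        have h2 : hW.U (star s * s) * π i.1 = π i.1 := by
          rw [hW.U_mul_π h, hW.W_idem (InverseSemigroup.idem_star_mul s)]
        rw [← h2]
        exact hη _ (Submodule.subset_span (Set.mem_iUnion.2 ⟨_, _, rfl⟩))
    refine hπ η fun b => ?_
    let K : Submodule ℂ B := LinearMap.ker
      (((ContinuousLinearMap.apply ℂ H η) : (H →L[ℂ] H) →ₗ[ℂ] H) ∘ₗ (π : B →ₗ[ℂ] (H →L[ℂ] H)))
    have hK : IsClosed (K : Set B) := isClosed_eq
      ((ContinuousLinearMap.apply ℂ H η).continuous.comp (continuous_starAlgHom π))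
      continuous_const
    have h2 : Submodule.span ℂ (⋃ s : S, ((β s).dom : Set B)) ≤ K :=
      Submodule.span_le.2 (Set.iUnion_subset fun s b hb => h1 s b hb)
    exact hK.closure_subset_iff.2 h2 (β.dense_span b)
  range_U e he := by
    let K : Submodule ℂ H :=
      (Submodule.span ℂ {x | ∃ b ∈ (β e).dom, ∃ ξ : H, π b ξ = x}).topologicalClosure
    have hK : IsClosed (K : Set H) := Submodule.isClosed_topologicalClosure _
    have : CompleteSpace K := hK.completeSpace_coe
    have hUK : ∀ k ∈ K, hW.U e k = k := by
      intro k hk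
      refine (isClosed_eq (hW.U e).continuous continuous_id).closure_subset_iff.2
        (fun x hx => ?_) hk
      induction hx using Submodule.span_induction with
      | zero => exact map_zero _
      | add x y _ _ hx hy => exact (map_add _ x y).trans (congrArg₂ _ hx hy)
      | smul c x _ hx => exact (map_smul _ c x).trans (congrArg _ hx)
      | mem x hx =>
        obtain ⟨b, hb, ξ, rfl⟩ := hx
        have h := (β e).rel_equiv ⟨b, hb⟩
        have h' := β.rel_idem he h
        have h2 : hW.U e * π b = π b := by
          rw [hW.U_mul_π h, hW.W_idem he, h']
        exact DFunLike.congr_fun h2 ξ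
    refine Set.Subset.antisymm ?_ fun k hk => ⟨k, hUK k hk⟩
    rintro _ ⟨η, rfl⟩
    obtain ⟨k, hk, m, hm, rfl⟩ := K.exists_add_mem_mem_orthogonal η
    change hW.U e (k + m) ∈ K
    rw [map_add, hUK k hk, hW.U_eq_zero (η := m), add_zero]
    · exact hk
    · exact forall_inner_π.1 fun i => hm _ (Submodule.le_topologicalClosure _
        (Submodule.subset_span ⟨i.1, i.1.2, i.2, rfl⟩))
  covariant s b := by
    have h := (β s).rel_equiv b
    change hW.U s * π b * star (hW.U s) = _
    rw [hW.U_mul_π h, ← hW.π_mul_U, mul_assoc, ← hW.U_star, ← hW.U_mul,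
      hW.π_mul_U (mem_ran_mul_star h.mem_ran), hW.W_idem (InverseSemigroup.idem_mul_star s)]

theorem covariantRep_integrated (f : β.FinSec) : (hW.covariantRep hπ).integrated f = W f := by
  rw [CovariantRep.integrated_apply]
  induction f using FinSec.induction with
  | zero => rw [map_zero, map_zero]
  | add f g hf hg => rw [map_add, map_add, hf, hg]
  | gen s b =>
    rw [CovariantRep.integratedLin_gen]
    exact hW.π_mul_U b.2

end ExtendsDiag

end InvAction

end Disintegration

/-! ### The norm of the crossed product -/

section Bound

universe u v

variable {S : Type u} [InverseSemigroup S] {B : Type v} [NonUnitalCStarAlgebra B]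
  {β : InvAction S B}

/-- A `*`-homomorphism `V` of the finite sections with dense range whose restriction to the fibres
over idempotents comes from a `*`-homomorphism `π` of `B` is bounded by the seminorm of the crossed
product: a representation of the target that attains the norm of `V f` is, after composition with
`V`, the integrated form of a covariant representation. -/
theorem InvAction.norm_le_crossedSeminorm {C : Type (max u v)} [NonUnitalCStarAlgebra C]
    (V : β.FinSec →⋆ₙₐ[ℂ] C) (hV : DenseRange V) (π : B →⋆ₙₐ[ℂ] C)
    (hVπ : ∀ e, IsIdempotentElem e → ∀ b : (β e).ran, V (FinSec.gen e b) = π b) (f : β.FinSec) :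
    ‖V f‖ ≤ β.crossedSeminorm f := by
  obtain ⟨H, _, _, _, ρ, hρ, hρf⟩ := exists_representation (V f)
  have hW : β.ExtendsDiag (ρ.comp V) (ρ.comp π) := fun e he b => congrArg ρ (hVπ e he b)
  have hπ : ∀ η, (∀ b, (ρ.comp π) b η = 0) → η = 0 := by
    intro η hη
    refine hρ η fun c => ?_
    refine hV.induction_on (p := fun c => ρ c η = 0) c
      (isClosed_eq ((ContinuousLinearMap.apply ℂ H η).continuous.comp (continuous_starAlgHom ρ))
        continuous_const) fun f => ?_
    induction f using FinSec.induction with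
    | zero => rw [map_zero, map_zero]; rfl
    | add f g hf hg => rw [map_add, map_add, _root_.add_apply, hf, hg, add_zero]
    | gen s b =>
      have h := (β s).rel_symm b
      exact hW.W_apply_eq_zero h (hη _)
  refine hρf.trans ?_
  have h1 : CStarSeminorm.ofHom (hW.covariantRep hπ).integrated ∈ β.integratedSeminorms :=
    ⟨H, _, _, _, _, rfl⟩
  have h2 := CStarSeminorm.le_sup β.bddAbove_integratedSeminorms h1 f
  rw [CStarSeminorm.ofHom_apply, hW.covariantRep_integrated hπ] at h2
  exact h2

end Bound

/-! ### Sections supported in open `G`-sets -/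

section Sections

variable {X : Type*} [Groupoid X] [TopologicalSpace X] [TopologicalSpace (Arr X)]
  [RDiscreteGroupoid X] {A : X → Type*} [∀ u, NonUnitalCStarAlgebra (A u)]
  [TopologicalSpace (Tot A)] [USCBundle A]

open USCBundle RDiscreteGroupoid

namespace OpenBisection

variable (X) in
/-- The unit space, an open `G`-set because `u ↦ 1_u` is a continuous section of a local
homeomorphism. -/
def units : OpenBisection X where
  carrier := Set.range fun u : X => Arr.unit u
  isOpen := by
    have h0 : IsLocalHomeomorph ((Arr.src : Arr X → X) ∘ fun u : X => Arr.unit u) :=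
      (Homeomorph.refl X).isLocalHomeomorph
    have h := IsLocalHomeomorph.of_comp h0 isLocalHomeomorph_src continuous_unit
    exact h.isOpenMap.isOpen_range
  src_injOn := by
    rintro _ ⟨u, rfl⟩ _ ⟨v, rfl⟩ (rfl : u = v)
    rfl
  tgt_injOn := by
    rintro _ ⟨u, rfl⟩ _ ⟨v, rfl⟩ (rfl : u = v)
    rfl

theorem unit_mem_units (u : X) : Arr.unit u ∈ (units X).carrier := ⟨u, rfl⟩

theorem mem_rSet_units (u : X) : u ∈ (units X).rSet := ⟨_, unit_mem_units u, rfl⟩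

theorem idem_le_units {e : OpenBisection X} (he : IsIdempotentElem e) :
    e.carrier ⊆ (units X).carrier := fun x hx => ⟨x.src, (isUnit_of_idem he hx).symm⟩

theorem units_idem : IsIdempotentElem (units X) := by
  apply OpenBisection.ext
  ext ⟨u, w, z⟩
  rw [mem_mul]
  constructor
  · rintro ⟨v, x, y, ⟨v', hx⟩, ⟨u', hy⟩, h⟩
    dsimp only at x y hx hy h
    subst h
    cases hx
    cases hy
    exact ⟨u, by simp⟩
  · rintro ⟨u', h⟩
    cases h
    exact ⟨u, 𝟙 u, 𝟙 u, ⟨u, rfl⟩, ⟨u, rfl⟩, by simp⟩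

theorem mul_star_le_units (s : OpenBisection X) : (s * star s).carrier ⊆ (units X).carrier :=
  idem_le_units (InverseSemigroup.idem_mul_star s)

theorem mem_mul_star {s : OpenBisection X} {u v : X} {x : u ⟶ v}
    (hx : (⟨u, v, x⟩ : Arr X) ∈ s.carrier) : Arr.unit v ∈ (s * star s).carrier :=
  ⟨u, x, Groupoid.inv x, hx, by simpa [mem_star, Arr.inv] using hx, by simp⟩

/-- The intersection of two open `G`-sets. -/
def inter (s t : OpenBisection X) : OpenBisection X where
  carrier := s.carrier ∩ t.carrier
  isOpen := s.isOpen.inter t.isOpen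
  src_injOn := s.src_injOn.mono Set.inter_subset_left
  tgt_injOn := s.tgt_injOn.mono Set.inter_subset_left

theorem rSet_mono {s t : OpenBisection X} (h : s.carrier ⊆ t.carrier) : s.rSet ⊆ t.rSet :=
  Set.image_mono h

end OpenBisection

theorem gammaSupp_mono {V V' : Set X} (h : V ⊆ V') : gammaSupp A V ≤ gammaSupp A V' :=
  fun _ hf => ⟨hf.1, hf.2.trans h⟩

theorem gammaSupp_of_vanish {V K : Set X} (hK : IsCompact K) (hKV : K ⊆ V) {b : Gamma0 A}
    (h : ∀ u, u ∉ K → b u = 0) : b ∈ gammaSupp A V :=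
  have h1 := isCompact_closure_of_vanish (f := fun u => b u) hK h
  ⟨h1.2, h1.1.trans hKV⟩

theorem gammaSupp_vanish {V : Set X} {b : Gamma0 A} (hb : b ∈ gammaSupp A V) {u : X} (hu : u ∉ V) :
    b u = 0 :=
  vanish_of_notMem_closure (f := fun u => b u) fun h => hu (hb.2 h)

/-- A section with compact support covered by the open sets `W i` is a sum of sections supported in
the `W i`, by a partition of unity. -/
theorem mem_iSup_gammaSupp {ι : Type*} {W : ι → Set X} (hW : ∀ i, IsOpen (W i)) {V : Set X}
    {b : Gamma0 A} (hb : b ∈ gammaSupp A V) (hcov : closure {u | b u ≠ 0} ⊆ ⋃ i, W i) :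
    b ∈ ⨆ i, gammaSupp A (W i) := by
  obtain ⟨t, ht⟩ := hb.1.elim_finite_subcover W hW hcov
  let e := t.equivFin.symm
  have hcov : closure {u | b u ≠ 0} ⊆ ⋃ i, W (e i).1 := by
    intro x hx
    obtain ⟨s, hs, hxs⟩ := Set.mem_iUnion₂.1 (ht hx)
    exact Set.mem_iUnion.2 ⟨e.symm ⟨s, hs⟩, by simpa using hxs⟩
  obtain ⟨φ, h1, h2, h3, h4⟩ := exists_continuous_sum_one_of_isOpen_isCompact
    (fun i => hW (e i).1) hb.1 hcov
  choose c hc using fun i => b.exists_cutoff (φ i) (h3 i)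
  have hsum : b = ∑ i, c i := by
    refine Gamma0.ext fun u => ?_
    have h5 : ∀ F : Finset (Fin t.card), (∑ i ∈ F, c i) u = ∑ i ∈ F, c i u := fun F => by
      classical
      induction F using Finset.induction_on with
      | empty => rfl
      | insert i F hi ih => rw [Finset.sum_insert hi, Finset.sum_insert hi, Gamma0.add_apply, ih]
    rw [h5]
    simp only [hc, ← Finset.sum_smul]
    by_cases hu : u ∈ closure {u | b u ≠ 0}
    · have h6 := h2 hu
      simp only [Finset.sum_apply, Pi.one_apply] at h6
      rw [← Complex.ofReal_sum]
      have h7 : ∑ i, φ i u = 1 := by simpa using h6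
      rw [h7, Complex.ofReal_one, one_smul]
    · rw [vanish_of_notMem_closure (f := fun u => b u) hu, smul_zero]
  rw [hsum]
  refine Submodule.sum_mem _ fun i _ => Submodule.mem_iSup_of_mem (e i).1 ?_
  refine gammaSupp_of_vanish (h4 i) (h1 i) fun u hu => ?_
  rw [hc, image_eq_zero_of_notMem_tsupport hu]
  simp

/-- Sections with compact support in an open set are dense among the sections vanishing off it. -/
theorem exists_gammaSupp_near {V : Set X} (hV : IsOpen V) {b : Gamma0 A}
    (hb : b ∈ Gamma0.vanishing V) {ε : ℝ} (hε : 0 < ε) :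
    ∃ c ∈ gammaSupp A V, ‖b - c‖ ≤ ε := by
  have hK := b.isCompact_norm_ge hε
  have hKV : {u | ε ≤ ‖b u‖} ⊆ V := by
    intro u hu
    by_contra h
    simp only [Set.mem_ofPred_eq] at hu
    rw [hb u h, norm_zero] at hu
    exact absurd hε (not_lt.2 hu)
  obtain ⟨L, hL, hKL, hLV⟩ := exists_compact_between hK hV hKV
  obtain ⟨φ, h1, h0, -, h01⟩ := exists_continuous_one_zero_of_isCompact hK
    isOpen_interior.isClosed_compl (Set.disjoint_compl_right_iff_subset.2 hKL)
  obtain ⟨g, hg⟩ := b.exists_cutoff φ h01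
  refine ⟨g, gammaSupp_of_vanish hL hLV fun u hu => ?_, ?_⟩
  · rw [hg, h0 (fun h => hu (interior_subset h))]; simp
  · refine Gamma0.norm_le_of_forall_le _ hε.le fun u => ?_
    have e : (b - g) u = b u - (φ u : ℂ) • b u := by rw [Gamma0.sub_apply, hg]
    rw [e]
    by_cases hu : u ∈ {u | ε ≤ ‖b u‖}
    · rw [h1 hu]
      simpa using hε.le
    · simp only [Set.mem_ofPred_eq, not_le] at hu
      have e2 : b u - (φ u : ℂ) • b u = ((1 - φ u : ℝ) : ℂ) • b u := by
        push_cast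
        rw [sub_smul, one_smul]
      rw [e2, norm_smul, Complex.norm_real, Real.norm_of_nonneg (sub_nonneg.2 (h01 u).2)]
      refine le_trans (mul_le_of_le_one_left (norm_nonneg _) ?_) hu.le
      linarith [(h01 u).1]

namespace GroupoidAction

theorem psiFun_of_mem {s : OpenBisection X} (b : Gamma0 A) {x : Arr X} (hx : x ∈ s.carrier) :
    psiFun s b x = b x.tgt := if_pos hx

theorem psiFun_of_notMem {s : OpenBisection X} (b : Gamma0 A) {x : Arr X} (hx : x ∉ s.carrier) :
    psiFun s b x = 0 := if_neg hx

theorem psiFun_mono {s t : OpenBisection X} (h : s.carrier ⊆ t.carrier) {b : Gamma0 A}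
    (hb : b ∈ gammaSupp A s.rSet) : psiFun s b = psiFun t b := by
  funext x
  by_cases hx : x ∈ s.carrier
  · rw [psiFun_of_mem b hx, psiFun_of_mem b (h hx)]
  · rw [psiFun_of_notMem b hx]
    by_cases hxt : x ∈ t.carrier
    · rw [psiFun_of_mem b hxt, gammaSupp_vanish hb]
      rintro ⟨y, hy, hyx⟩
      obtain rfl := t.tgt_injOn (h hy) hxt hyx
      exact hx hy
    · rw [psiFun_of_notMem b hxt]

theorem exists_compact_psiFun {s : OpenBisection X} {b : Gamma0 A} (hb : b ∈ gammaSupp A s.rSet) :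
    ∃ K ⊆ s.carrier, IsCompact K ∧ ∀ x, x ∉ K → psiFun s b x = 0 := by
  have h0 : IsLocalHomeomorph (Arr.tgt ∘ (Subtype.val : s.carrier → Arr X)) :=
    isLocalHomeomorph_tgt.comp s.isOpen.isOpenEmbedding_subtypeVal.isLocalHomeomorph
  have h1 := h0.isOpenEmbedding_of_injective (s.tgt_injOn.injective)
  have h2 : IsCompact ((Arr.tgt ∘ (Subtype.val : s.carrier → Arr X)) ⁻¹'
      closure {u | b u ≠ 0}) := by
    refine h1.isInducing.isCompact_preimage' hb.1 ?_
    intro u hu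
    obtain ⟨x, hx, rfl⟩ := hb.2 hu
    exact ⟨⟨x, hx⟩, rfl⟩
  refine ⟨_, ?_, h2.image continuous_subtype_val, fun x hx => ?_⟩
  · rintro _ ⟨x, -, rfl⟩
    exact x.2
  · by_cases hxs : x ∈ s.carrier
    · rw [psiFun_of_mem b hxs]
      exact vanish_of_notMem_closure (f := fun u => b u) fun h => hx ⟨⟨x, hxs⟩, h, rfl⟩
    · rw [psiFun_of_notMem b hxs]

/-- A section supported in a compact subset of an open `G`-set comes from a section over the range
of the `G`-set. -/
theorem exists_eq_psiFun (s : OpenBisection X) {f : ∀ x : Arr X, A x.tgt} (hf : f ∈ GammaC A)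
    {K : Set (Arr X)} (hK : IsCompact K) (hKs : K ⊆ s.carrier) (hfK : ∀ x, x ∉ K → f x = 0) :
    ∃ b ∈ gammaSupp A s.rSet, psiFun s b = f := by
  classical
  let b : ∀ v, A v := fun v =>
    if h : ∃ y : Into v, y.arr ∈ s.carrier then f h.choose.arr else 0
  have hb : ∀ x ∈ s.carrier, b x.tgt = f x := by
    rintro ⟨u, v, x⟩ hx
    have h : ∃ y : Into v, y.arr ∈ s.carrier := ⟨⟨u, x⟩, hx⟩
    have h2 := s.tgt_injOn h.choose_spec hx rfl
    have h3 : h.choose = ⟨u, x⟩ := by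
      generalize h.choose = y at h2
      obtain ⟨w, y⟩ := y
      cases h2
      rfl
    refine (dif_pos h).trans ?_
    rw [h3]
  have hb0 : ∀ v, v ∉ Arr.tgt '' K → b v = 0 := by
    intro v hv
    by_cases h : ∃ y : Into v, y.arr ∈ s.carrier
    · obtain ⟨y, hy⟩ := h
      exact (hb y.arr hy).trans (hfK _ fun h => hv ⟨_, h, rfl⟩)
    · exact dif_neg h
  have hKc : IsCompact (Arr.tgt '' K) := hK.image continuous_tgt
  have hc : Continuous fun v => (⟨v, b v⟩ : Tot A) := by
    rw [continuous_iff_continuousAt]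
    intro v
    by_cases hv : v ∈ s.rSet
    · have hN := s.isOpen_rSet
      rw [ContinuousAt, ← hN.isOpenEmbedding_subtypeVal.map_nhds_eq ⟨v, hv⟩, tendsto_map'_iff]
      have hex : ∀ w : s.rSet, ∃ y : Arr X, y ∈ s.carrier ∧ y.tgt = w := by
        rintro ⟨w, y, hy, rfl⟩; exact ⟨y, hy, rfl⟩
      choose y hy1 hy2 using hex
      have T1 : Tendsto y (𝓝 ⟨v, hv⟩) (𝓝 (y ⟨v, hv⟩)) := by
        refine s.tendsto_of_tgt hy1 (hy1 _) ?_
        simp only [hy2]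
        exact continuous_subtype_val.tendsto _
      have e : ∀ w : s.rSet, (⟨(y w).tgt, f (y w)⟩ : Tot A) = ⟨w, b w⟩ := by
        intro w
        rw [← hb _ (hy1 w), hy2 w]
      have T3 : Tendsto (fun w => (⟨(y w).tgt, f (y w)⟩ : Tot A)) (𝓝 (⟨v, hv⟩ : s.rSet))
          (𝓝 ⟨(y ⟨v, hv⟩).tgt, f (y ⟨v, hv⟩)⟩) := (hf.1.tendsto _).comp T1
      simp only [e] at T3
      exact T3
    · have hvK : v ∈ (Arr.tgt '' K)ᶜ := fun h => hv (Set.image_mono hKs h)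
      rw [ContinuousAt, hb0 v hvK]
      refine ((continuous_zero (A := A) continuous_id).tendsto v).congr' ?_
      filter_upwards [hKc.isClosed.isOpen_compl.mem_nhds hvK] with w hw
      rw [hb0 w hw]
      rfl
  refine ⟨Gamma0.mk b hc fun ε hε => ?_, gammaSupp_of_vanish hKc (Set.image_mono hKs) hb0, ?_⟩
  · refine hKc.of_isClosed_subset (isClosed_norm_ge hc ε) fun v hv => ?_
    by_contra h
    simp only [Set.mem_ofPred_eq] at hv
    rw [hb0 v h, norm_zero] at hv
    exact absurd hε (not_lt.2 hv)
  · funext x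
    by_cases hx : x ∈ s.carrier
    · rw [psiFun_of_mem _ hx]
      exact hb x hx
    · rw [psiFun_of_notMem _ hx, hfK x fun h => hx (hKs h)]

variable (α : GroupoidAction A)

theorem psiFib_mono {s t : OpenBisection X} (h : s.carrier ⊆ t.carrier) {b : Gamma0 A}
    (hs : b ∈ gammaSupp A s.rSet) (ht : b ∈ gammaSupp A t.rSet) :
    α.psiFib s ⟨b, hs⟩ = α.psiFib t ⟨b, ht⟩ := Subtype.ext (psiFun_mono h hs)

/-- `Ψ(b, s) Ψ(c, t) = Ψ(d, st)` with `d(r(x)) = b(r(x)) α_x(c(d(x)))` for `x ∈ s`. -/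
theorem psiFib_mul_psiFib {s t : OpenBisection X} (b : gammaSupp A s.rSet)
    (c : gammaSupp A t.rSet) : ∃ d : gammaSupp A (s * t).rSet,
      (∀ (u v : X) (x : u ⟶ v), (⟨u, v, x⟩ : Arr X) ∈ s.carrier →
        d.1 v = b.1 v * α.map x (c.1 u)) ∧
      α.psiFib s b * α.psiFib t c = α.psiFib (s * t) d := by
  obtain ⟨K, hKs, hK, hfK⟩ := exists_compact_psiFun b.2
  obtain ⟨L, hLt, hL, hgL⟩ := exists_compact_psiFun c.2
  have h1 := (isClosedEmbedding_composable.isCompact_preimage (hK.prod hL)).image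
    RDiscreteGroupoid.continuous_prod
  obtain ⟨d, hd, hdf⟩ := exists_eq_psiFun (s * t)
    (α.conv_mem (psiFun_mem s b.1 b.2) (psiFun_mem t c.1 c.2)) h1 (by
      rintro _ ⟨⟨u, v, w, x, y⟩, ⟨hx, hy⟩, rfl⟩
      exact ⟨v, x, y, hKs hx, hLt hy, rfl⟩) (by
      rintro ⟨u, v, x⟩ hx
      refine (finsum_congr fun y => ?_).trans finsum_zero
      obtain ⟨w, y⟩ := y
      by_contra hne
      refine hx ⟨⟨u, w, v, y, x ≫ Groupoid.inv y⟩, ⟨?_, ?_⟩, ?_⟩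
      · by_contra h0
        exact hne (by rw [hfK _ h0, zero_mul])
      · by_contra h0
        refine hne ?_
        change _ * α.map y (psiFun t c.1 ⟨u, w, x ≫ Groupoid.inv y⟩) = 0
        rw [hgL _ h0, map_zero, mul_zero]
      · simp [Composable.prod])
  refine ⟨⟨d, hd⟩, fun u v x hx => ?_, Subtype.ext hdf.symm⟩
  by_cases hu : u ∈ t.rSet
  · obtain ⟨⟨u', u, y⟩, hy, rfl⟩ := hu
    have hz : (⟨u', v, y ≫ x⟩ : Arr X) ∈ (s * t).carrier := ⟨u, x, y, hx, hy, rfl⟩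
    have h2 := congrFun hdf ⟨u', v, y ≫ x⟩
    rw [psiFun_of_mem d hz] at h2
    refine h2.trans ?_
    refine (finsum_eq_single _ (⟨u, x⟩ : Into v) ?_).trans ?_
    · rintro ⟨v', y'⟩ hne
      rw [psiFun_of_notMem, zero_mul]
      intro hy'
      have e : (⟨v', v, y'⟩ : Arr X) = ⟨u, v, x⟩ := s.tgt_injOn hy' hx rfl
      cases e
      exact hne rfl
    · change psiFun s b.1 ⟨u, v, x⟩ * α.map x
        (psiFun t c.1 ⟨u', u, (y ≫ x) ≫ Groupoid.inv x⟩) = _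
      have e1 : (y ≫ x) ≫ Groupoid.inv x = y := by simp
      rw [e1, psiFun_of_mem _ hx, psiFun_of_mem _ hy]
  · rw [gammaSupp_vanish c.2 hu, map_zero, mul_zero]
    refine gammaSupp_vanish hd ?_
    rintro ⟨⟨u', v', z⟩, ⟨w, x', y, hx', hy, -⟩, hv⟩
    obtain rfl : v' = v := hv
    have e := s.tgt_injOn hx' hx rfl
    cases e
    exact hu ⟨_, hy, rfl⟩

/-- `Ψ(b, s)* = Ψ(d, s*)` with `d(d(x)) = α_{x⁻¹}(b(r(x)))*` for `x ∈ s`. -/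
theorem star_psiFib {s : OpenBisection X} (b : gammaSupp A s.rSet) :
    ∃ d : gammaSupp A (star s).rSet,
      (∀ (u v : X) (x : u ⟶ v), (⟨u, v, x⟩ : Arr X) ∈ s.carrier →
        d.1 u = star (α.map (Groupoid.inv x) (b.1 v))) ∧
      star (α.psiFib s b) = α.psiFib (star s) d := by
  obtain ⟨K, hKs, hK, hfK⟩ := exists_compact_psiFun b.2
  obtain ⟨d, hd, hdf⟩ := exists_eq_psiFun (star s)
    (α.invol_mem (psiFun_mem s b.1 b.2)) (hK.image RDiscreteGroupoid.continuous_inv) (by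
      rintro _ ⟨x, hx, rfl⟩
      rw [OpenBisection.mem_star, Arr.inv_inv]
      exact hKs hx) (by
      intro x hx
      rw [invol, hfK x.inv fun h => hx ⟨_, h, x.inv_inv⟩, map_zero, star_zero])
  refine ⟨⟨d, hd⟩, fun u v x hx => ?_, Subtype.ext hdf.symm⟩
  have hx' : (⟨v, u, Groupoid.inv x⟩ : Arr X) ∈ (star s).carrier := by
    simpa [OpenBisection.mem_star, Arr.inv] using hx
  have h2 := congrFun hdf ⟨v, u, Groupoid.inv x⟩
  rw [psiFun_of_mem d hx'] at h2
  refine h2.trans ?_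
  change star (α.map (Groupoid.inv x) (psiFun s b.1 ⟨u, v, Groupoid.inv (Groupoid.inv x)⟩)) = _
  have e1 : Groupoid.inv (Groupoid.inv x) = x := by simp
  rw [e1, psiFun_of_mem _ hx]

end GroupoidAction

/-! ### Linear maps on compactly supported sections -/

namespace GroupoidAction

variable (α : GroupoidAction A) {S : InverseSubsemigroup (OpenBisection X)}

theorem Psi_of [DecidableEq S] (s : S) (b : gammaSupp A s.1.rSet) :
    α.Psi S (DirectSum.lof ℂ S (fun s => gammaSupp A s.1.rSet) s b) = α.psiFib s.1 b := by
  rw [Psi]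
  convert! DirectSum.toModule_lof (M := fun s : S => gammaSupp A s.1.rSet) ℂ s b

/-- The members of a full inverse semigroup contained in an open `G`-set cover it. -/
theorem subset_iUnion_rSet (hS : S.IsFull) (w : OpenBisection X) :
    w.rSet ⊆ ⋃ r : {r : S // r.1.carrier ⊆ w.carrier}, r.1.1.rSet := by
  rintro _ ⟨x, hx, rfl⟩
  obtain ⟨_, ⟨r, rfl⟩, hxr, hr⟩ := hS.isBasis.exists_subset_of_mem_open hx w.isOpen
  exact Set.mem_iUnion.2 ⟨⟨r, hr⟩, _, hxr, rfl⟩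

/-- A section with compact support in the range of an open `G`-set splits over the members of `S`
contained in the `G`-set. -/
theorem mem_iSup_gammaSupp_rSet (hS : S.IsFull) {w : OpenBisection X} {b : Gamma0 A}
    (hb : b ∈ gammaSupp A w.rSet) :
    b ∈ ⨆ r : {r : S // r.1.carrier ⊆ w.carrier}, gammaSupp A r.1.1.rSet :=
  mem_iSup_gammaSupp (fun r => r.1.1.isOpen_rSet) hb (hb.2.trans (subset_iUnion_rSet hS w))

/-- A function supported in an open `G`-set is `Ψ(b, s)` for an open `G`-set `s` that need not belong
to `S`; a partition of unity subordinate to the members of `S` contained in `s` splits it. -/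
theorem Psi_surjective (hS : S.IsFull) : Function.Surjective (α.Psi S) := by
  classical
  rintro ⟨f, hf⟩
  suffices h : ∃ ξ, (α.Psi S ξ).1 = f by
    obtain ⟨ξ, hξ⟩ := h
    exact ⟨ξ, Subtype.ext hξ⟩
  refine GammaC.induction (P := fun f => ∃ ξ, (α.Psi S ξ).1 = f) ?_ ?_ ?_ hf
  · exact ⟨0, by rw [map_zero]; rfl⟩
  · rintro _ _ _ _ ⟨ξ, rfl⟩ ⟨η, rfl⟩
    exact ⟨ξ + η, by rw [map_add]; rfl⟩
  · intro s K f hf hK hKs hfK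
    obtain ⟨b, hb, rfl⟩ := exists_eq_psiFun s hf hK hKs hfK
    suffices h : ∃ hb ξ, α.Psi S ξ = α.psiFib s ⟨b, hb⟩ by
      obtain ⟨_, ξ, h⟩ := h
      exact ⟨ξ, congrArg Subtype.val h⟩
    refine Submodule.iSup_induction _ (motive := fun b => ∃ hb ξ, α.Psi S ξ = α.psiFib s ⟨b, hb⟩)
      (mem_iSup_gammaSupp_rSet hS hb) ?_ ?_ ?_
    · intro r b hb
      exact ⟨gammaSupp_mono (OpenBisection.rSet_mono r.2) hb, _,
        (α.Psi_of r.1 ⟨b, hb⟩).trans (α.psiFib_mono r.2 _ _)⟩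
    · exact ⟨zero_mem _, 0, by rw [map_zero]; exact (map_zero (α.psiFib s)).symm⟩
    · rintro b c ⟨h1, ξ, h3⟩ ⟨h2, η, h4⟩
      refine ⟨add_mem h1 h2, ξ + η, ?_⟩
      rw [map_add, h3, h4, ← map_add]
      rfl

section Colimit

variable {M : Type*} [AddCommGroup M] [Module ℂ M]
  {τ : ∀ s : S, gammaSupp A s.1.rSet →ₗ[ℂ] M}

/-- On sections supported over `s ∩ t` the maps `τ s` and `τ t` agree, although `s ∩ t` need not
belong to `S`: it is covered by members of `S`. -/
theorem eq_of_mem_inter (hS : S.IsFull)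
    (hτ : ∀ (r s : S) (b : Gamma0 A) (hr : b ∈ gammaSupp A r.1.rSet)
      (hs : b ∈ gammaSupp A s.1.rSet), r.1.carrier ⊆ s.1.carrier → τ r ⟨b, hr⟩ = τ s ⟨b, hs⟩)
    {s t : S} {b : Gamma0 A} (hb : b ∈ gammaSupp A (s.1.inter t.1).rSet)
    (hs : b ∈ gammaSupp A s.1.rSet) (ht : b ∈ gammaSupp A t.1.rSet) :
    τ s ⟨b, hs⟩ = τ t ⟨b, ht⟩ := by
  suffices h : ∃ hs ht, τ s ⟨b, hs⟩ = τ t ⟨b, ht⟩ by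
    obtain ⟨_, _, h⟩ := h
    exact h
  refine Submodule.iSup_induction _ (motive := fun b => ∃ hs ht, τ s ⟨b, hs⟩ = τ t ⟨b, ht⟩)
    (mem_iSup_gammaSupp_rSet hS hb) ?_ ?_ ?_
  · intro r b hb
    have h1 : r.1.1.carrier ⊆ s.1.carrier := r.2.trans Set.inter_subset_left
    have h2 : r.1.1.carrier ⊆ t.1.carrier := r.2.trans Set.inter_subset_right
    exact ⟨gammaSupp_mono (OpenBisection.rSet_mono h1) hb,
      gammaSupp_mono (OpenBisection.rSet_mono h2) hb,
      (hτ _ _ _ hb _ h1).symm.trans (hτ _ _ _ hb _ h2)⟩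
  · exact ⟨zero_mem _, zero_mem _, (map_zero (τ s)).trans (map_zero (τ t)).symm⟩
  · rintro b c ⟨h1, h2, h3⟩ ⟨h4, h5, h6⟩
    exact ⟨add_mem h1 h4, add_mem h2 h5, (map_add (τ s) ⟨b, h1⟩ ⟨c, h4⟩).trans
      ((congrArg₂ _ h3 h6).trans (map_add (τ t) ⟨b, h2⟩ ⟨c, h5⟩).symm)⟩

/-- If `∑ Ψ(b_s, s) = 0` over a finite set, then one of the summands is supported in the union of
the other `G`-sets; splitting it by a partition of unity removes it from the sum. -/
theorem sum_eq_zero_of_sum_psiFib_eq_zero (hS : S.IsFull)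
    (hτ : ∀ (r s : S) (b : Gamma0 A) (hr : b ∈ gammaSupp A r.1.rSet)
      (hs : b ∈ gammaSupp A s.1.rSet), r.1.carrier ⊆ s.1.carrier → τ r ⟨b, hr⟩ = τ s ⟨b, hs⟩)
    (F : Finset S) (b : ∀ s : S, gammaSupp A s.1.rSet)
    (hb : ∑ s ∈ F, α.psiFib s.1 (b s) = 0) : ∑ s ∈ F, τ s (b s) = 0 := by
  classical
  induction F using Finset.induction_on generalizing b with
  | empty => simp
  | insert s F hs ih =>
    rw [Finset.sum_insert hs] at hb ⊢
    -- Where `Ψ(b_s, s)` does not vanish, some other summand does not vanish either.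
    have hcov : closure {u | (b s).1 u ≠ 0} ⊆
        ⋃ t : {t // t ∈ F}, (s.1.inter t.1.1).rSet := by
      choose K hK1 hK2 hK3 using fun t : S => exists_compact_psiFun (b t).2
      have hKF : IsCompact (⋃ t ∈ F, K t) := F.isCompact_biUnion fun t _ => hK2 t
      have h1 : IsCompact (Arr.tgt '' (K s ∩ ⋃ t ∈ F, K t)) :=
        ((hK2 s).inter hKF).image continuous_tgt
      have h2 : closure {u | (b s).1 u ≠ 0} ⊆ Arr.tgt '' (K s ∩ ⋃ t ∈ F, K t) := by
        refine closure_minimal (fun u hu => ?_) h1.isClosed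
        have hus : u ∈ s.1.rSet := by
          by_contra h
          exact hu (gammaSupp_vanish (b s).2 h)
        obtain ⟨x, hx, rfl⟩ := hus
        have h3 : psiFun s.1 (b s).1 x ≠ 0 := by
          rw [psiFun_of_mem _ hx]; exact hu
        refine ⟨x, ⟨?_, ?_⟩, rfl⟩
        · by_contra h
          exact h3 (hK3 s x h)
        · by_contra h
          simp only [Set.mem_iUnion, not_exists] at h
          have h4 : ∀ G : Finset S, G ⊆ F → (∑ t ∈ G, α.psiFib t.1 (b t)).1 x = 0 := by
            intro G
            induction G using Finset.induction_on with
            | empty => intro _; rfl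
            | insert t G ht ihG =>
              intro hG
              rw [Finset.sum_insert ht]
              change psiFun t.1 (b t).1 x + _ = 0
              rw [hK3 t x (h t (hG (Finset.mem_insert_self t G))), zero_add]
              exact ihG fun r hr => hG (Finset.mem_insert_of_mem hr)
          have h5 := congrArg (fun f : α.ConvAlg => f.1 x) hb
          change psiFun s.1 (b s).1 x + (∑ t ∈ F, α.psiFib t.1 (b t)).1 x = 0 at h5
          rw [h4 F subset_rfl, add_zero] at h5
          exact h3 h5
      intro u hu
      obtain ⟨x, ⟨hxs, hxF⟩, rfl⟩ := h2 hu
      obtain ⟨t, ht, hxt⟩ := Set.mem_iUnion₂.1 hxF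
      exact Set.mem_iUnion.2 ⟨⟨t, ht⟩, x, ⟨hK1 s hxs, hK1 t hxt⟩, rfl⟩
    have h1 := mem_iSup_gammaSupp (fun t => OpenBisection.isOpen_rSet _) (b s).2 hcov
    rw [iSup_subtype (f := fun t : {t // t ∈ F} => gammaSupp A (s.1.inter t.1.1).rSet)] at h1
    obtain ⟨μ, hμ⟩ := (Submodule.mem_iSup_finset_iff_exists_sum
      (fun t : S => gammaSupp A (s.1.inter t.1).rSet) _).1 h1
    have hμs : ∀ t, (μ t).1 ∈ gammaSupp A s.1.rSet := fun t =>
      gammaSupp_mono (OpenBisection.rSet_mono Set.inter_subset_left) (μ t).2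
    have hμt : ∀ t, (μ t).1 ∈ gammaSupp A t.1.rSet := fun t =>
      gammaSupp_mono (OpenBisection.rSet_mono Set.inter_subset_right) (μ t).2
    have hbs : b s = ∑ t ∈ F, ⟨(μ t).1, hμs t⟩ := Subtype.ext (by
      rw [← hμ, AddSubmonoidClass.coe_finsetSum])
    -- `b_s` is a sum of pieces `μ t` supported over `s ∩ t`; each is moved to the summand of `t`.
    have h2 := ih (fun t => b t + ⟨(μ t).1, hμt t⟩) (by
      rw [← hb, hbs, map_sum, add_comm, ← Finset.sum_add_distrib]
      refine Finset.sum_congr rfl fun t _ => ?_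
      rw [map_add, ← α.psiFib_mono (s := s.1.inter t.1) Set.inter_subset_right (μ t).2,
        ← α.psiFib_mono (s := s.1.inter t.1) Set.inter_subset_left (μ t).2])
    rw [← h2, hbs, map_sum, add_comm, ← Finset.sum_add_distrib]
    refine Finset.sum_congr rfl fun t _ => ?_
    rw [map_add, eq_of_mem_inter hS hτ (μ t).2 (hμs t) (hμt t)]

/-- `Γ_c(r^*𝒜)` is the colimit of the spaces of sections supported in the members of a full inverse
semigroup: linear maps `τ s` on these spaces that agree along inclusions `r ⊆ s` glue to a linear
map on `Γ_c(r^*𝒜)`. -/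
theorem exists_linearMap_of_compatible (hS : S.IsFull)
    (hτ : ∀ (r s : S) (b : Gamma0 A) (hr : b ∈ gammaSupp A r.1.rSet)
      (hs : b ∈ gammaSupp A s.1.rSet), r.1.carrier ⊆ s.1.carrier → τ r ⟨b, hr⟩ = τ s ⟨b, hs⟩) :
    ∃ T : α.ConvAlg →ₗ[ℂ] M, ∀ (s : S) (b : gammaSupp A s.1.rSet),
      T (α.psiFib s.1 b) = τ s b := by
  classical
  let τ' : α.SecC S →ₗ[ℂ] M := DirectSum.toModule ℂ S M τ
  have hτ' : ∀ (s : S) (b : gammaSupp A s.1.rSet),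
      τ' (DirectSum.lof ℂ S (fun s => gammaSupp A s.1.rSet) s b) = τ s b := fun s b =>
    DirectSum.toModule_lof (M := fun s : S => gammaSupp A s.1.rSet) ℂ s b
  have hker : LinearMap.ker (α.Psi S) ≤ LinearMap.ker τ' := by
    intro ξ hξ
    rw [LinearMap.mem_ker] at hξ ⊢
    have h1 := DirectSum.sum_support_of ξ
    rw [← h1, map_sum] at hξ ⊢
    have h2 : ∑ s ∈ DFinsupp.support ξ, α.psiFib s.1 (ξ s) = 0 :=
      (Finset.sum_congr rfl fun s _ => (α.Psi_of s (ξ s)).symm).trans hξ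
    exact (Finset.sum_congr rfl fun s _ => hτ' s (ξ s)).trans
      (α.sum_eq_zero_of_sum_psiFib_eq_zero hS hτ _ (fun s => ξ s) h2)
  refine ⟨(LinearMap.ker (α.Psi S)).liftQ τ' hker ∘ₗ
    ((α.Psi S).quotKerEquivOfSurjective (α.Psi_surjective hS)).symm.toLinearMap, fun s b => ?_⟩
  have h3 : ((α.Psi S).quotKerEquivOfSurjective (α.Psi_surjective hS)).symm (α.psiFib s.1 b) =
      Submodule.Quotient.mk (DirectSum.lof ℂ S (fun s => gammaSupp A s.1.rSet) s b) := by
    rw [LinearEquiv.symm_apply_eq]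
    exact (α.Psi_of s b).symm
  rw [LinearMap.comp_apply, LinearEquiv.coe_coe, h3, Submodule.liftQ_apply, hτ']

end Colimit

end GroupoidAction

end Sections

section Enveloping

variable {X : Type*} [Groupoid X] [TopologicalSpace X] [TopologicalSpace (Arr X)]
  [RDiscreteGroupoid X] {A : X → Type*} [∀ u, NonUnitalCStarAlgebra (A u)]
  [TopologicalSpace (Tot A)] [USCBundle A]

open USCBundle RDiscreteGroupoid OpenBisection

namespace GroupoidAction

variable (α : GroupoidAction A)

/-! ### The enveloping `C*`-algebra of the convolution algebra -/

theorem psiFib_congr {s t : OpenBisection X} (h : s.carrier ⊆ t.carrier)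
    {b : gammaSupp A s.rSet} {c : gammaSupp A t.rSet} (hbc : b.1 = c.1) :
    α.psiFib s b = α.psiFib t c := by
  obtain ⟨b, hb⟩ := b
  obtain ⟨c, hc⟩ := c
  obtain rfl : b = c := hbc
  exact α.psiFib_mono h hb hc

theorem map_unit (u : X) (a : A u) : α.map (Groupoid.inv (𝟙 u)) a = a := by
  have h : Groupoid.inv (𝟙 u) = 𝟙 u := by simp
  rw [h, α.map_id]

theorem mem_gammaSupp_units {K : Set X} (hK : IsCompact K) {b : Gamma0 A}
    (hb : b ∈ Gamma0.vanishing K) : b ∈ gammaSupp A (units X).rSet :=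
  gammaSupp_of_vanish hK (fun u _ => mem_rSet_units u) hb

/-- The `C*`-algebra of sections of `𝒜` that vanish off a compact set of units, as a `*`-subalgebra
of the convolution algebra. -/
def unitHom {K : Set X} (hK : IsCompact K) :
    (Gamma0.vanishing K : NonUnitalStarSubalgebra ℂ (Gamma0 A)) →⋆ₙₐ[ℂ] α.ConvAlg where
  toFun b := α.psiFib (units X) ⟨b.1, mem_gammaSupp_units hK b.2⟩
  map_smul' c b := map_smul (α.psiFib (units X)) c ⟨b.1, mem_gammaSupp_units hK b.2⟩
  map_zero' := map_zero (α.psiFib (units X))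
  map_add' b c := map_add (α.psiFib (units X)) ⟨b.1, mem_gammaSupp_units hK b.2⟩
    ⟨c.1, mem_gammaSupp_units hK c.2⟩
  map_mul' b c := by
    obtain ⟨d, hd, h⟩ := α.psiFib_mul_psiFib ⟨b.1, mem_gammaSupp_units hK b.2⟩
      ⟨c.1, mem_gammaSupp_units hK c.2⟩
    rw [h]
    refine (α.psiFib_congr (s := units X * units X) (t := units X) ?_ ?_).symm
    · rw [units_idem.eq]
    · refine Gamma0.ext fun u => ?_
      rw [hd u u (𝟙 u) (unit_mem_units u), α.map_id]
      rfl
  map_star' b := by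
    obtain ⟨d, hd, h⟩ := α.star_psiFib ⟨b.1, mem_gammaSupp_units hK b.2⟩
    rw [h]
    refine (α.psiFib_congr (s := star (units X)) (t := units X) ?_ ?_).symm
    · rintro x ⟨u, hu⟩
      exact ⟨u, by rw [← x.inv_inv, ← hu]; simp [Arr.inv]⟩
    · refine Gamma0.ext fun u => ?_
      rw [hd u u (𝟙 u) (unit_mem_units u), α.map_unit]
      rfl

/-- For `f = Ψ(b, s)` the product `f f*` is the section `b b*` over the unit space. A `C*`-seminorm
restricts to the `C*`-algebra of sections vanishing off the support of `b`, where it is dominated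
by the norm. -/
theorem seminorm_psiFib_le (p : CStarSeminorm α.ConvAlg) (s : OpenBisection X)
    (b : gammaSupp A s.rSet) : p (α.psiFib s b) ≤ ‖b.1‖ := by
  let K : Set X := closure {u | b.1 u ≠ 0}
  have hK : IsCompact K := b.2.1
  have hbK : b.1 * star b.1 ∈ (Gamma0.vanishing K : NonUnitalStarSubalgebra ℂ (Gamma0 A)) := by
    intro u hu
    rw [Gamma0.mul_apply, vanish_of_notMem_closure (f := fun u => b.1 u) hu, zero_mul]
  have : IsClosed ((Gamma0.vanishing K : NonUnitalStarSubalgebra ℂ (Gamma0 A)) : Set (Gamma0 A)) :=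
    (Gamma0.vanishing_isClosedIdeal K).isClosed
  obtain ⟨d, hd, h1⟩ := α.star_psiFib b
  obtain ⟨e, he, h2⟩ := α.psiFib_mul_psiFib b d
  have h3 : α.psiFib s b * star (α.psiFib s b) = α.unitHom hK ⟨b.1 * star b.1, hbK⟩ := by
    rw [h1, h2]
    refine α.psiFib_congr (t := units X) (mul_star_le_units s) (Gamma0.ext fun v => ?_)
    by_cases hv : v ∈ s.rSet
    · obtain ⟨⟨u, v, x⟩, hx, rfl⟩ := hv
      rw [he u v x hx, hd u v x hx, map_star, α.map_map_inv]
      rfl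
    · rw [gammaSupp_vanish e.2, Gamma0.mul_apply, gammaSupp_vanish b.2 hv, zero_mul]
      rintro ⟨⟨u', w, z⟩, ⟨w', x, y, hx, hy, -⟩, hv'⟩
      exact hv ⟨_, hx, hv'⟩
  have h4 : p (α.psiFib s b) ^ 2 ≤ ‖b.1‖ ^ 2 := by
    have h5 := p.star_mul_self (star (α.psiFib s b))
    rw [star_star, p.star_eq, h3] at h5
    rw [← h5, ← norm_toCompletion]
    refine (NonUnitalStarAlgHom.norm_apply_le ((toCompletion p).comp (α.unitHom hK))
      ⟨b.1 * star b.1, hbK⟩).trans ?_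
    change ‖b.1 * star b.1‖ ≤ _
    rw [CStarRing.norm_self_mul_star, sq]
  exact (sq_le_sq₀ (p.nonneg _) (norm_nonneg _)).1 h4

/-- Finite sums of the functions `Ψ(b, s)` exhaust `Γ_c(r^*𝒜)`, and every `C*`-seminorm is at most
`‖b‖` at `Ψ(b, s)`. -/
theorem hasEnveloping : HasEnveloping α.ConvAlg := by
  rintro ⟨f, hf⟩
  suffices h : ∀ hf : f ∈ GammaC A, ∃ M, ∀ p : CStarSeminorm α.ConvAlg, p ⟨f, hf⟩ ≤ M by
    obtain ⟨M, hM⟩ := h hf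
    exact ⟨M, by rintro _ ⟨p, -, rfl⟩; exact hM p⟩
  refine GammaC.induction (P := fun f => ∀ hf : f ∈ GammaC A, ∃ M,
    ∀ p : CStarSeminorm α.ConvAlg, p (⟨f, hf⟩ : α.ConvAlg) ≤ M) ?_ ?_ ?_ hf
  · exact fun hf => ⟨0, fun p => (map_zero p.toSeminorm).le⟩
  · intro f g hf hg h1 h2 hfg
    obtain ⟨M, hM⟩ := h1 hf
    obtain ⟨N, hN⟩ := h2 hg
    exact ⟨M + N, fun p => (map_add_le_add p.toSeminorm (⟨f, hf⟩ : α.ConvAlg) ⟨g, hg⟩).trans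
      (add_le_add (hM p) (hN p))⟩
  · intro s K f hf hK hKs hfK hf'
    obtain ⟨b, hb, rfl⟩ := exists_eq_psiFun s hf hK hKs hfK
    exact ⟨‖b‖, fun p => α.seminorm_psiFib_le p s ⟨b, hb⟩⟩

/-! ### Extension to sections vanishing at infinity -/

section Extension

variable {C : Type*} [NonUnitalCStarAlgebra C] (φ : α.ConvAlg →⋆ₙₐ[ℂ] C)

theorem norm_psiFib_le (s : OpenBisection X) (b : gammaSupp A s.rSet) :
    ‖φ (α.psiFib s b)‖ ≤ ‖b.1‖ := α.seminorm_psiFib_le (CStarSeminorm.ofHom φ) s b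

/-- The inclusion of the sections with compact support in `V` into the sections vanishing off
`V`. -/
def toVanishing (V : Set X) :
    gammaSupp A V →ₗ[ℂ] (Gamma0.vanishing V : NonUnitalStarSubalgebra ℂ (Gamma0 A)) where
  toFun b := ⟨b.1, fun _ hu => gammaSupp_vanish b.2 hu⟩
  map_add' _ _ := rfl
  map_smul' _ _ := rfl

theorem denseRange_toVanishing {V : Set X} (hV : IsOpen V) :
    DenseRange (toVanishing (A := A) V) := by
  rintro ⟨b, hb⟩
  rw [Metric.mem_closure_iff]
  intro ε hε
  obtain ⟨c, hc, hbc⟩ := exists_gammaSupp_near hV hb (half_pos hε)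
  refine ⟨_, ⟨⟨c, hc⟩, rfl⟩, lt_of_le_of_lt ?_ (half_lt_self hε)⟩
  rw [dist_eq_norm]
  exact hbc

/-- The extension of `b ↦ φ(Ψ(b, s))` from compactly supported sections to all sections vanishing
off the range of `s`. -/
def psiHat (s : OpenBisection X) :
    (Gamma0.vanishing s.rSet : NonUnitalStarSubalgebra ℂ (Gamma0 A)) →L[ℂ] C :=
  LinearMap.extendOfNorm ((φ : α.ConvAlg →ₗ[ℂ] C) ∘ₗ α.psiFib s) (toVanishing s.rSet)

theorem psiHat_toVanishing (s : OpenBisection X) (b : gammaSupp A s.rSet) :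
    α.psiHat φ s (toVanishing s.rSet b) = φ (α.psiFib s b) :=
  LinearMap.extendOfNorm_eq (f := (φ : α.ConvAlg →ₗ[ℂ] C) ∘ₗ α.psiFib s)
    (denseRange_toVanishing s.isOpen_rSet)
    ⟨1, fun b => by rw [one_mul]; exact α.norm_psiFib_le φ s b⟩ b

theorem exists_seq {s : OpenBisection X}
    (b : (Gamma0.vanishing s.rSet : NonUnitalStarSubalgebra ℂ (Gamma0 A))) :
    ∃ c : ℕ → gammaSupp A s.rSet, Tendsto (fun n => toVanishing s.rSet (c n)) atTop (𝓝 b) := by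
  obtain ⟨x, hx, hxb⟩ := mem_closure_iff_seq_limit.1 (denseRange_toVanishing s.isOpen_rSet b)
  choose c hc using hx
  exact ⟨c, by simpa only [hc] using hxb⟩

theorem tendsto_psiFib {s : OpenBisection X}
    {b : (Gamma0.vanishing s.rSet : NonUnitalStarSubalgebra ℂ (Gamma0 A))}
    {c : ℕ → gammaSupp A s.rSet} (h : Tendsto (fun n => toVanishing s.rSet (c n)) atTop (𝓝 b)) :
    Tendsto (fun n => φ (α.psiFib s (c n))) atTop (𝓝 (α.psiHat φ s b)) := by
  simp only [← psiHat_toVanishing]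
  exact ((α.psiHat φ s).continuous.tendsto b).comp h

theorem tendsto_toVanishing {V : Set X}
    {b : (Gamma0.vanishing V : NonUnitalStarSubalgebra ℂ (Gamma0 A))}
    {c : ℕ → gammaSupp A V} :
    Tendsto (fun n => toVanishing V (c n)) atTop (𝓝 b) ↔
      Tendsto (fun n => ‖(c n).1 - b.1‖) atTop (𝓝 0) := by
  rw [tendsto_iff_norm_sub_tendsto_zero]
  rfl

theorem psiHat_mono {s t : OpenBisection X} (h : s.carrier ⊆ t.carrier)
    {b : (Gamma0.vanishing s.rSet : NonUnitalStarSubalgebra ℂ (Gamma0 A))}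
    {c : (Gamma0.vanishing t.rSet : NonUnitalStarSubalgebra ℂ (Gamma0 A))} (hbc : b.1 = c.1) :
    α.psiHat φ s b = α.psiHat φ t c := by
  obtain ⟨d, hd⟩ := exists_seq b
  have h1 := α.tendsto_psiFib φ hd
  rw [tendsto_toVanishing, hbc] at hd
  have h2 := α.tendsto_psiFib φ (s := t) (b := c)
    (c := fun n => ⟨(d n).1, gammaSupp_mono (rSet_mono h) (d n).2⟩) (tendsto_toVanishing.2 hd)
  refine tendsto_nhds_unique h1 (h2.congr fun n => ?_)
  rw [α.psiFib_congr (b := d n) (c := ⟨(d n).1, gammaSupp_mono (rSet_mono h) (d n).2⟩) h rfl]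

/-- `psiHat` is multiplicative; the formula for compactly supported sections passes to limits. -/
theorem psiHat_mul {s t : OpenBisection X}
    (b : (Gamma0.vanishing s.rSet : NonUnitalStarSubalgebra ℂ (Gamma0 A)))
    (c : (Gamma0.vanishing t.rSet : NonUnitalStarSubalgebra ℂ (Gamma0 A)))
    (d : (Gamma0.vanishing (s * t).rSet : NonUnitalStarSubalgebra ℂ (Gamma0 A)))
    (hd : ∀ (u v : X) (x : u ⟶ v), (⟨u, v, x⟩ : Arr X) ∈ s.carrier →
      d.1 v = b.1 v * α.map x (c.1 u)) :
    α.psiHat φ s b * α.psiHat φ t c = α.psiHat φ (s * t) d := by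
  obtain ⟨b', hb'⟩ := exists_seq b
  obtain ⟨c', hc'⟩ := exists_seq c
  choose d' hd' hd'' using fun n => α.psiFib_mul_psiFib (b' n) (c' n)
  have h1 := (α.tendsto_psiFib φ hb').mul (α.tendsto_psiFib φ hc')
  simp only [← map_mul, hd''] at h1
  refine tendsto_nhds_unique h1 (α.tendsto_psiFib φ ?_)
  have hcn : Tendsto (fun n => ‖(c' n).1‖) atTop (𝓝 ‖c.1‖) := hc'.norm
  rw [tendsto_toVanishing] at hb' hc' ⊢
  have h2 : Tendsto (fun n => ‖(b' n).1 - b.1‖ * ‖(c' n).1‖ + ‖b.1‖ * ‖(c' n).1 - c.1‖) atTop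
      (𝓝 0) := by
    simpa using (hb'.mul hcn).add (hc'.const_mul ‖b.1‖)
  refine squeeze_zero (fun _ => norm_nonneg _) (fun n => ?_) h2
  refine Gamma0.norm_le_of_forall_le _ (by positivity) fun v => ?_
  rw [Gamma0.sub_apply]
  by_cases hv : v ∈ s.rSet
  · obtain ⟨⟨u, v, x⟩, hx, rfl⟩ := hv
    rw [hd' n u v x hx, hd u v x hx]
    have e : (b' n).1 v * α.map x ((c' n).1 u) - b.1 v * α.map x (c.1 u) =
        ((b' n).1 - b.1) v * α.map x ((c' n).1 u) + b.1 v * α.map x (((c' n).1 - c.1) u) := by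
      rw [Gamma0.sub_apply, Gamma0.sub_apply, map_sub, sub_mul, mul_sub]
      abel
    change ‖(b' n).1 v * α.map x ((c' n).1 u) - b.1 v * α.map x (c.1 u)‖ ≤ _
    rw [e]
    refine (norm_add_le _ _).trans (add_le_add ?_ ?_) <;>
    · refine (norm_mul_le _ _).trans ?_
      rw [α.norm_map]
      exact mul_le_mul (Gamma0.norm_apply_le _ _) (Gamma0.norm_apply_le _ _) (norm_nonneg _)
        (norm_nonneg _)
  · have hv' : v ∉ (s * t).rSet := by
      rintro ⟨⟨u', w, z⟩, ⟨w', x, y, hx, hy, -⟩, hv'⟩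
      exact hv ⟨_, hx, hv'⟩
    rw [gammaSupp_vanish (d' n).2 hv', d.2 v hv', sub_zero, norm_zero]
    positivity

/-- `psiHat` is `*`-preserving; the formula for compactly supported sections passes to limits. -/
theorem star_psiHat {s : OpenBisection X}
    (b : (Gamma0.vanishing s.rSet : NonUnitalStarSubalgebra ℂ (Gamma0 A)))
    (d : (Gamma0.vanishing (star s).rSet : NonUnitalStarSubalgebra ℂ (Gamma0 A)))
    (hd : ∀ (u v : X) (x : u ⟶ v), (⟨u, v, x⟩ : Arr X) ∈ s.carrier →
      d.1 u = star (α.map (Groupoid.inv x) (b.1 v))) :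
    star (α.psiHat φ s b) = α.psiHat φ (star s) d := by
  obtain ⟨b', hb'⟩ := exists_seq b
  choose d' hd' hd'' using fun n => α.star_psiFib (b' n)
  have h1 := (α.tendsto_psiFib φ hb').star
  simp only [← map_star, hd''] at h1
  refine tendsto_nhds_unique h1 (α.tendsto_psiFib φ ?_)
  rw [tendsto_toVanishing] at hb' ⊢
  refine squeeze_zero (fun _ => norm_nonneg _) (fun n => ?_) hb'
  refine Gamma0.norm_le_of_forall_le _ (norm_nonneg _) fun u => ?_
  rw [Gamma0.sub_apply]
  by_cases hu : u ∈ s.dSet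
  · obtain ⟨⟨u, v, x⟩, hx, rfl⟩ := hu
    rw [hd' n u v x hx, hd u v x hx]
    change ‖star (α.map (Groupoid.inv x) ((b' n).1 v)) - star (α.map (Groupoid.inv x) (b.1 v))‖ ≤ _
    rw [← star_sub, ← map_sub, norm_star, α.norm_map]
    exact Gamma0.norm_apply_le ((b' n).1 - b.1) v
  · rw [← rSet_star] at hu
    rw [gammaSupp_vanish (d' n).2 hu, d.2 u hu, sub_zero, norm_zero]
    exact norm_nonneg _

/-- The `*`-homomorphism of `Γ_0(𝒜)` that extends `φ` on the compactly supported sections over the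
unit space. -/
def diagHom : Gamma0 A →⋆ₙₐ[ℂ] C where
  toFun b := α.psiHat φ (units X) ⟨b, fun u hu => (hu (mem_rSet_units u)).elim⟩
  map_smul' c b := map_smul (α.psiHat φ (units X)) c ⟨b, _⟩
  map_zero' := map_zero (α.psiHat φ (units X))
  map_add' b c := map_add (α.psiHat φ (units X)) ⟨b, _⟩ ⟨c, _⟩
  map_mul' b c := by
    have hm : b * c ∈ (Gamma0.vanishing (units X * units X).rSet :
        NonUnitalStarSubalgebra ℂ (Gamma0 A)) := by
      rw [units_idem.eq]
      exact fun u hu => (hu (mem_rSet_units u)).elim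
    rw [α.psiHat_mul φ _ _ ⟨b * c, hm⟩]
    · exact (α.psiHat_mono φ (s := units X * units X) (t := units X) (b := ⟨b * c, hm⟩)
        (c := ⟨b * c, fun u hu => (hu (mem_rSet_units u)).elim⟩) (by rw [units_idem.eq]) rfl).symm
    · rintro u v x ⟨w, hw⟩
      cases hw
      rw [α.map_id]
      rfl
  map_star' b := by
    have hm : star b ∈ (Gamma0.vanishing (star (units X)).rSet :
        NonUnitalStarSubalgebra ℂ (Gamma0 A)) := by
      intro u hu
      refine (hu ⟨Arr.unit u, ⟨u, ?_⟩, rfl⟩).elim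
      simp [Arr.inv]
    rw [α.star_psiHat φ _ ⟨star b, hm⟩]
    · refine (α.psiHat_mono φ (s := star (units X)) (t := units X) (b := ⟨star b, hm⟩)
        (c := ⟨star b, fun u hu => (hu (mem_rSet_units u)).elim⟩) ?_ rfl).symm
      rintro x ⟨u, hu⟩
      exact ⟨u, by rw [← x.inv_inv, ← hu]; simp [Arr.inv]⟩
    · rintro u v x ⟨w, hw⟩
      cases hw
      rw [α.map_unit]
      rfl

variable (S : InverseSubsemigroup (OpenBisection X)) (hS : S.IsFull)

/-- The `*`-homomorphism of `Γ_c(r^*ℬ)` with values `psiHat` on the generators. -/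
def finSecHom : (α.assoc S hS).FinSec →⋆ₙₐ[ℂ] C :=
  let F : (α.assoc S hS).FinSec →ₗ[ℂ] C :=
    InvAction.FinSec.lift fun s => (α.psiHat φ s.1).toLinearMap
  have hF : ∀ s b, F (InvAction.FinSec.gen s b) = α.psiHat φ s.1 b := fun s b =>
    InvAction.FinSec.lift_gen _ s b
  { F with
    map_zero' := map_zero F
    map_mul' := fun f g => by
      change F (f * g) = F f * F g
      induction f using InvAction.FinSec.induction with
      | zero => rw [zero_mul, map_zero, zero_mul]
      | add f f' hf hf' => rw [add_mul, map_add, hf, hf', map_add, add_mul]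
      | gen s b =>
        induction g using InvAction.FinSec.induction with
        | zero => rw [mul_zero, map_zero, mul_zero]
        | add g g' hg hg' => rw [mul_add, map_add, hg, hg', map_add, mul_add]
        | gen t c =>
          rw [InvAction.FinSec.gen_mul_gen, hF, hF, hF]
          refine (α.psiHat_mul φ _ _ _ fun u v x hx => ?_).symm
          have h1 := (α.beta_rel_iff.1 (InvAction.FinSec.mulVal_rel s t b c)).2.2 u v x hx
          have h2 := (α.beta_rel_iff.1 (((α.assoc S hS) s).rel_symm b)).2.2 u v x hx
          rw [h2, ← map_mul]
          exact h1
    map_star' := fun f => by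
      change F (star f) = star (F f)
      induction f using InvAction.FinSec.induction with
      | zero => rw [star_zero, map_zero, star_zero]
      | add f f' hf hf' => rw [star_add, map_add, hf, hf', map_add, star_add]
      | gen s b =>
        rw [InvAction.FinSec.star_gen, hF, hF]
        refine (α.star_psiHat φ _ _ fun u v x hx => ?_).symm
        have h1 := (α.beta_rel_iff.1 (InvAction.FinSec.starVal_rel s b)).2.2 u v x hx
        have h2 := congrArg (α.map (Groupoid.inv x)) h1
        rw [α.map_inv_map] at h2
        rw [← h2, ← map_star]
        rfl }

theorem finSecHom_gen (s : S) (b : ((α.assoc S hS) s).ran) :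
    α.finSecHom φ S hS (InvAction.FinSec.gen s b) = α.psiHat φ s.1 b :=
  InvAction.FinSec.lift_gen _ s b

theorem inclC_of [inst : DecidableEq S] (s : S) (b : gammaSupp A s.1.rSet) :
    α.inclC S hS (DirectSum.lof ℂ S (fun s => gammaSupp A s.1.rSet) s b) =
      InvAction.FinSec.gen s (α.inclFib S hS s b) := by
  obtain rfl : inst = fun a b => Classical.propDecidable (a = b) := Subsingleton.elim _ _
  classical
  exact DirectSum.toModule_lof (M := fun s : S => gammaSupp A s.1.rSet)
    (φ := fun s => (InvAction.FinSec.gen (β := α.assoc S hS) s).comp (α.inclFib S hS s)) ℂ s b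

/-- On `Γ_c(𝒞)` the homomorphism `finSecHom φ` is `φ ∘ Ψ`. -/
theorem finSecHom_inclC (ξ : α.SecC S) : α.finSecHom φ S hS (α.inclC S hS ξ) = φ (α.Psi S ξ) := by
  classical
  induction ξ using DirectSum.induction_on with
  | zero => simp only [map_zero]
  | add ξ η hξ hη => simp only [map_add, hξ, hη]
  | of s b =>
    have h1 := α.inclC_of S hS s b
    have h2 := α.Psi_of s b
    rw [DirectSum.lof_eq_of] at h1 h2
    rw [h1, h2, finSecHom_gen]
    exact α.psiHat_toVanishing φ s.1 b

theorem finSecHom_idem {e : S} (he : IsIdempotentElem e) (b : ((α.assoc S hS) e).ran) :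
    α.finSecHom φ S hS (InvAction.FinSec.gen e b) = α.diagHom φ b.1 := by
  rw [finSecHom_gen]
  exact α.psiHat_mono φ (idem_le_units (InverseSubsemigroup.idem_val he)) rfl

end Extension

end GroupoidAction

end Enveloping

/-! ### The crossed product -/

namespace InvAction

universe u v

variable {S : Type u} [InverseSemigroup S] {B : Type v} [NonUnitalCStarAlgebra B]
  {β : InvAction S B}

theorem crossedSeminorm_le {f : β.FinSec} {M : ℝ} (hM : 0 ≤ M)
    (h : ∀ (H : Type (max u v)) [NormedAddCommGroup H] [InnerProductSpace ℂ H] [CompleteSpace H]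
      (ρ : CovariantRep β H), ‖ρ.integratedLin f‖ ≤ M) : β.crossedSeminorm f ≤ M := by
  refine Real.sSup_le ?_ hM
  rintro _ ⟨p, ⟨H, _, _, _, ρ, rfl⟩, rfl⟩
  exact h H ρ

theorem norm_toCrossed_gen_le (s : S) (b : (β s).ran) :
    ‖β.toCrossed (FinSec.gen s b)‖ ≤ ‖(b : B)‖ := by
  rw [norm_toCompletion]
  refine crossedSeminorm_le (norm_nonneg _) fun H _ _ _ ρ => ?_
  rw [CovariantRep.integratedLin_gen]
  refine (norm_mul_le _ _).trans ?_
  calc ‖ρ.π b‖ * ‖ρ.U s‖ ≤ ‖(b : B)‖ * 1 :=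
        mul_le_mul (NonUnitalStarAlgHom.norm_apply_le ρ.π _) (ρ.norm_U_le s) (norm_nonneg _)
          (norm_nonneg _)
    _ = ‖(b : B)‖ := mul_one _

/-- In the crossed product `(b, r) = (b, s)` for `r ≤ s`, because
`π(b) U_r = π(b) U_r U_r* U_s = π(b) U_s` in every covariant representation. -/
theorem toCrossed_gen_eq {r s : S} (h : r * star r * s = r) {b : B} (hr : b ∈ (β r).ran)
    (hs : b ∈ (β s).ran) :
    β.toCrossed (FinSec.gen r ⟨b, hr⟩) = β.toCrossed (FinSec.gen s ⟨b, hs⟩) := by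
  rw [← sub_eq_zero, ← map_sub, ← norm_le_zero_iff, norm_toCompletion]
  refine crossedSeminorm_le le_rfl fun H _ _ _ ρ => ?_
  have hb : b ∈ (β (star r)).dom := (β.rel_star.2 ((β r).rel_symm ⟨b, hr⟩)).mem_dom
  have h1 := ρ.π_mul_U hb
  rw [ρ.U_star, star_star, ← ρ.U_star, ← map_mul] at h1
  rw [map_sub, CovariantRep.integratedLin_gen, CovariantRep.integratedLin_gen, norm_le_zero_iff,
    sub_eq_zero]
  calc ρ.π b * ρ.U r = ρ.π b * ρ.U (r * star r) * ρ.U s := by rw [mul_assoc, ← map_mul, h]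
    _ = ρ.π b * ρ.U s := by rw [h1]

end InvAction

/-! ### The isomorphism -/

section Isomorphism

variable {X : Type*} [Groupoid X] [TopologicalSpace X] [TopologicalSpace (Arr X)]
  [RDiscreteGroupoid X] {A : X → Type*} [∀ u, NonUnitalCStarAlgebra (A u)]
  [TopologicalSpace (Tot A)] [USCBundle A]

open OpenBisection

/-- Inclusion of open `G`-sets implies the natural order. -/
theorem OpenBisection.mul_star_mul_of_subset {r s : OpenBisection X} (h : r.carrier ⊆ s.carrier) :
    r * star r * s = r := by
  apply OpenBisection.ext
  ext ⟨u, v, x⟩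
  rw [mem_mul]
  constructor
  · rintro ⟨w, y, z, hy, hz, e⟩
    dsimp only at w y z hy hz e
    have h1 := isUnit_of_idem (InverseSemigroup.idem_mul_star r) hy
    obtain rfl : v = w := congrArg Arr.tgt h1
    simp only [Arr.mk.injEq, heq_eq_eq, true_and] at h1
    obtain ⟨w', p, q, hp, -, -⟩ := hy
    have h2 := s.tgt_injOn (h hp) hz rfl
    rw [← e, h1, Category.comp_id, ← h2]
    exact hp
  · intro hx
    exact ⟨v, 𝟙 v, x, mem_mul_star hx, h hx, by simp⟩

namespace GroupoidAction

variable (α : GroupoidAction A) (S : InverseSubsemigroup (OpenBisection X)) (hS : S.IsFull)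

/-- `Ψ(b, s) ↦ [b, s]` is a well-defined `*`-homomorphism of `Γ_c(r^*𝒜)` into the crossed
product. -/
theorem exists_starAlgHom_toCrossed : ∃ T : α.ConvAlg →⋆ₙₐ[ℂ] (α.assoc S hS).CrossedProduct,
    ∀ ξ : α.SecC S, T (α.Psi S ξ) = (α.assoc S hS).toCrossed (α.inclC S hS ξ) := by
  classical
  let β := α.assoc S hS
  obtain ⟨T, hT⟩ := α.exists_linearMap_of_compatible (M := β.CrossedProduct)
    (τ := fun s => (β.toCrossed : β.FinSec →ₗ[ℂ] β.CrossedProduct) ∘ₗ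
      InvAction.FinSec.gen s ∘ₗ α.inclFib S hS s) hS
    fun r s b hr hs hrs => InvAction.toCrossed_gen_eq (β := β) (r := r) (s := s)
      (Subtype.ext (OpenBisection.mul_star_mul_of_subset hrs)) _ _
  have hT' : ∀ (s : S) (b : gammaSupp A s.1.rSet), T (α.psiFib s.1 b) =
    β.toCrossed (InvAction.FinSec.gen s (α.inclFib S hS s b)) := hT
  have ind : ∀ {P : α.ConvAlg → Prop} (f) (_zero : P 0) (_add : ∀ f g, P f → P g → P (f + g))
      (_of : ∀ (s : S) (b : gammaSupp A s.1.rSet), P (α.psiFib s.1 b)), P f := by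
    intro P f h0 hadd hof
    obtain ⟨ξ, rfl⟩ := α.Psi_surjective hS f
    induction ξ using DirectSum.induction_on with
    | zero => rwa [map_zero]
    | add ξ η hξ hη => rw [map_add]; exact hadd _ _ hξ hη
    | of s b => exact (α.Psi_of s b) ▸ hof s b
  refine ⟨{ T with
    map_zero' := map_zero T
    map_mul' := ?_
    map_star' := ?_ }, ?_⟩
  · intro f g
    change T (f * g) = T f * T g
    induction f using ind with
    | _zero => rw [zero_mul, map_zero, zero_mul]
    | _add f f' hf hf' => rw [add_mul, map_add, hf, hf', map_add, add_mul]
    | _of s b =>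
      induction g using ind with
      | _zero => rw [mul_zero, map_zero, mul_zero]
      | _add g g' hg hg' => rw [mul_add, map_add, hg, hg', map_add, mul_add]
      | _of t c =>
        obtain ⟨d, hd, h⟩ := α.psiFib_mul_psiFib b c
        have h1 := (β s).rel_symm (α.inclFib S hS s b)
        have h3 := (α.beta_rel_iff.1 h1).2.2
        have h2 : (β s).Rel (((β s).equiv.symm (α.inclFib S hS s b) : Gamma0 A) * c.1) d.1 := by
          refine α.beta_rel_iff.2 ⟨?_, ?_, fun u v x hx => ?_⟩
          · exact (β s).dom_ideal.mul_mem_right _ h1.mem_dom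
          · intro v hv
            refine gammaSupp_vanish d.2 fun hv' => hv ?_
            obtain ⟨⟨u', w, z⟩, ⟨w', x, y, hx, -, -⟩, rfl⟩ := hv'
            exact ⟨_, hx, rfl⟩
          · exact (hd u v x hx).trans ((congrArg (· * α.map x (c.1 u)) (h3 u v x hx)).trans
              (map_mul (α.map x) _ _).symm)
        refine (congrArg T h).trans ((hT' (s * t) d).trans ?_)
        rw [hT', hT', ← map_mul]
        exact congrArg β.toCrossed (InvAction.gen_mul_eq rfl h1 _ h2 _).symm
  · intro f
    change T (star f) = star (T f)
    induction f using ind with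
    | _zero => rw [star_zero, map_zero, star_zero]
    | _add f f' hf hf' => rw [star_add, map_add, hf, hf', map_add, star_add]
    | _of s b =>
      obtain ⟨d, hd, h⟩ := α.star_psiFib b
      have h1 := (β s).rel_symm (α.inclFib S hS s b)
      have h3 := (α.beta_rel_iff.1 h1).2.2
      refine (congrArg T h).trans ((hT' (star s) d).trans ?_)
      rw [hT', ← map_star]
      refine congrArg β.toCrossed (Eq.symm ?_)
      refine (InvAction.star_gen_eq h1).trans (InvAction.FinSec.gen_congr rfl _ _ ?_)
      refine Gamma0.ext fun u => ?_
      by_cases hu : u ∈ s.1.dSet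
      · obtain ⟨⟨u, v, x⟩, hx, rfl⟩ := hu
        have h4 := h3 u v x hx
        change b.1 v = _ at h4
        change _ = d.1 u
        rw [hd u v x hx, h4, α.map_inv_map]
        rfl
      · refine Eq.trans ?_ (gammaSupp_vanish d.2 (by rwa [rSet_star])).symm
        refine (congrArg star (h1.mem_dom u hu)).trans (star_zero _)
  · intro ξ
    change T (α.Psi S ξ) = _
    induction ξ using DirectSum.induction_on with
    | zero => simp only [map_zero]
    | add ξ η hξ hη => simp only [map_add, hξ, hη]
    | of s b =>
      have h1 := α.inclC_of S hS s b
      have h2 := α.Psi_of s b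
      rw [DirectSum.lof_eq_of] at h1 h2
      rw [h1, h2, hT']

/-- The sections with compact support in `r(s)` are dense in `B_{r(s)}`, and `b ↦ [b, s]` is
contractive. -/
theorem denseRange_toCrossed_inclC :
    DenseRange fun ξ : α.SecC S => (α.assoc S hS).toCrossed (α.inclC S hS ξ) := by
  classical
  let β := α.assoc S hS
  let R : Submodule ℂ β.CrossedProduct :=
    LinearMap.range ((β.toCrossed : β.FinSec →ₗ[ℂ] β.CrossedProduct) ∘ₗ α.inclC S hS)
  suffices h : ∀ f, β.toCrossed f ∈ R.topologicalClosure from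
    ((denseRange_toCompletion β.crossedSeminorm).mono (by rintro _ ⟨f, rfl⟩; exact h f) :
      Dense (closure (R : Set β.CrossedProduct))).of_closure
  intro f
  induction f using InvAction.FinSec.induction with
  | zero => rw [map_zero]; exact zero_mem _
  | add f g hf hg => rw [map_add]; exact add_mem hf hg
  | gen s b =>
    refine Metric.mem_closure_iff.2 fun ε hε => ?_
    obtain ⟨c, hc, hbc⟩ := exists_gammaSupp_near s.1.isOpen_rSet b.2 (half_pos hε)
    refine ⟨_, ⟨DirectSum.lof ℂ S (fun s => gammaSupp A s.1.rSet) s ⟨c, hc⟩, rfl⟩,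
      lt_of_le_of_lt ?_ (half_lt_self hε)⟩
    have h1 : ((β.toCrossed : β.FinSec →ₗ[ℂ] β.CrossedProduct) ∘ₗ α.inclC S hS)
        (DirectSum.lof ℂ S (fun s => gammaSupp A s.1.rSet) s ⟨c, hc⟩) =
        β.toCrossed (InvAction.FinSec.gen s (α.inclFib S hS s ⟨c, hc⟩)) :=
      congrArg β.toCrossed (α.inclC_of S hS s ⟨c, hc⟩)
    rw [h1, dist_eq_norm, ← map_sub, ← map_sub]
    exact (InvAction.norm_toCrossed_gen_le _ _).trans hbc

theorem denseRange_finSecHom (h : HasEnveloping α.ConvAlg) :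
    DenseRange (α.finSecHom h.ι S hS) := by
  refine (denseRange_toCompletion h.seminorm).mono ?_
  rintro _ ⟨f, rfl⟩
  obtain ⟨ξ, rfl⟩ := α.Psi_surjective hS f
  exact ⟨α.inclC S hS ξ, α.finSecHom_inclC h.ι S hS ξ⟩

/-- The extension of `finSecHom` to the crossed product and the extension of `Ψ(b, s) ↦ [b, s]` to
the enveloping `C*`-algebra are inverse to each other, since they are so on dense subspaces. -/
theorem exists_equiv (h : HasEnveloping α.ConvAlg) :
    ∃ Φ : (α.assoc S hS).CrossedProduct ≃⋆ₐ[ℂ] h.CStar, ∀ ξ : α.SecC S,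
      Φ ((α.assoc S hS).toCrossed (α.inclC S hS ξ)) = h.ι (α.Psi S ξ) := by
  obtain ⟨T, hT⟩ := α.exists_starAlgHom_toCrossed S hS
  let F : (α.assoc S hS).CrossedProduct →⋆ₙₐ[ℂ] h.CStar :=
    HausdorffCompletion.lift _ (α.finSecHom h.ι S hS)
      (InvAction.norm_le_crossedSeminorm _ (α.denseRange_finSecHom S hS h) (α.diagHom h.ι)
        fun e he b => α.finSecHom_idem h.ι S hS he b)
  let G : h.CStar →⋆ₙₐ[ℂ] (α.assoc S hS).CrossedProduct :=
    HausdorffCompletion.lift _ T fun f =>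
      CStarSeminorm.le_sup (p := CStarSeminorm.ofHom T) h (Set.mem_univ _) f
  have hF : ∀ ξ : α.SecC S, F ((α.assoc S hS).toCrossed (α.inclC S hS ξ)) = h.ι (α.Psi S ξ) :=
    fun ξ => (HausdorffCompletion.lift_toCompletion _ _ _ _).trans (α.finSecHom_inclC h.ι S hS ξ)
  have hG : ∀ ξ : α.SecC S, G (h.ι (α.Psi S ξ)) = (α.assoc S hS).toCrossed (α.inclC S hS ξ) :=
    fun ξ => (HausdorffCompletion.lift_toCompletion _ _ _ _).trans (hT ξ)
  have hGF : ∀ x, G (F x) = x := congrFun <|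
    (α.denseRange_toCrossed_inclC S hS).equalizer
      ((continuous_starAlgHom G).comp (continuous_starAlgHom F)) continuous_id <| by
        funext ξ
        simp only [Function.comp_apply, hF, hG]
  have hFG : ∀ x, F (G x) = x := congrFun <|
    ((denseRange_toCompletion h.seminorm)).equalizer
      ((continuous_starAlgHom F).comp (continuous_starAlgHom G)) continuous_id <| by
        funext f
        obtain ⟨ξ, rfl⟩ := α.Psi_surjective hS f
        change F (G (h.ι _)) = h.ι _
        rw [hG, hF]
  exact ⟨{ F with
    invFun := G
    left_inv := hGF
    right_inv := hFG
    map_smul' := map_smul F }, hF⟩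

end GroupoidAction

end Isomorphism

end

end GpdCStar

theorem mainTheorem1 {X : Type*} [CategoryTheory.Groupoid X] [TopologicalSpace X]
    [TopologicalSpace (Arr X)] [RDiscreteGroupoid X]
    {A : X → Type*} [∀ x, NonUnitalCStarAlgebra (A x)] [TopologicalSpace (Tot A)] [USCBundle A]
    (α : GroupoidAction A) (S : InverseSubsemigroup (OpenBisection X)) (hS : S.IsFull) :
    ∃ h : HasEnveloping α.ConvAlg,
      ∃! Φ : (α.assoc S hS).CrossedProduct ≃⋆ₐ[ℂ] h.CStar,
        ∀ ξ : α.SecC S,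
          Φ ((α.assoc S hS).toCrossed (α.inclC S hS ξ)) = h.ι (α.Psi S ξ) := by
  refine ⟨α.hasEnveloping, ?_⟩
  obtain ⟨Φ, hΦ⟩ := α.exists_equiv S hS α.hasEnveloping
  refine ⟨Φ, hΦ, fun Φ' hΦ' => ?_⟩
  have hc : ∀ Ψ : (α.assoc S hS).CrossedProduct ≃⋆ₐ[ℂ] α.hasEnveloping.CStar, Continuous Ψ :=
    fun Ψ => continuous_starAlgHom
      { Ψ with map_zero' := map_zero Ψ }
  exact StarAlgEquiv.ext fun x => congrFun ((α.denseRange_toCrossed_inclC S hS).equalizer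
    (hc Φ') (hc Φ) (funext fun ξ => (hΦ' ξ).trans (hΦ ξ).symm)) x
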